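/- **Setting.** Let $n\in\{2,3\}$, $0<\rho_-<\rho_+$, $g>0$, $T>0$, and let $\Omega$ be a bounded domain in $\mathbb R^n$ or the periodic channel $\mathbb T^{n-1}\times(-L,L)$, $L>0$, where $\mathbb T$ has periodicity $1$. Let $e_n$ be the last unit vector, $\mathscr D(t)=\Omega+\tfrac12gt^2e_n$, $\mathscr D=\{(y,t):t\in(0,T),\,y\in\mathscr D(t)\}$, $\overline{\mathscr D}^*=\bigcup_{t\in[0,T)}\overline{\mathscr D(t)}\times\{t\}$, $\partial_{rel}\mathscr D=\bigcup_{t\in(0,T)}\partial\mathscr D(t)\times\{t\}$, and let $\vec n$ be the outer unit normal of $\mathscr D(t)$. Let $\mathcal S_0$ be the space of symmetric trace-free $n\times n$ matrices and $Z=\mathbb R\times\mathbb R^n\times\mathbb R^n\times\mathbb R^n\times\mathcal S_0\times\mathbb R\ni z=(\mu,w,m,h,\sigma,e)$. For $q\in\mathbb R$ let $K_q$ be the set of $z\in Z$ with $$m=\mu w,\quad h=(e+q)w,\quad \mu\,w\otimes w=\sigma+\tfrac2n e\,\mathrm{id},\quad \mu\in\{\rho_-,\rho_+\},$$ and, for $\gamma>0$,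 let $K_{\gamma,q}=\{z\in K_q:e\le\gamma\}$. For $z\in Z$ with $\rho_-<\mu<\rho_+$ set $$\tilde M(z)=\frac{\mu\rho_-\rho_+w\otimes w-\rho_-\rho_+(m\otimes w+w\otimes m)+(\rho_++\rho_--\mu)m\otimes m}{(\rho_+-\mu)(\mu-\rho_-)}-\sigma,$$ $$T_\pm(z)=\frac{\rho_\pm}2\,\frac{|m-\rho_\mp w|^2}{(\mu-\rho_\mp)^2},\qquad \tilde e(z)=\frac{T_+(z)-T_-(z)}{\rho_+-\rho_-}.$$ *Initial data.* Let $\mu_0\in L^\infty(\Omega)$ with $\mu_0\in\{\rho_-,\rho_+\}$ a.e., and let $w_0\in L^\infty(\Omega;\mathbb R^n)$ satisfy $\operatorname{div}w_0=0$ in $\Omega$ and $w_0\cdot\vec n=0$ on $\partial\Omega$ in the sense of distributions. *Pressure and dissipation.* A pressure is a function $q\in L^\infty(\mathscr D)\cap L^1(\partial_{rel}\mathscr D)$ whose values on $\partial_{rel}\mathscr D$ are its trace in the spatial variable. A negative dissipation measure is a linear functional $\nu$ on $C_c^\infty(\overline{\mathscr D}^*)$ with $\nu[\psi]\le0$ whenever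 $\psi\ge0$. *Weak solutions of the linear system.* $z\in L^\infty(\mathscr D;Z)$ is a weak solution of $$\partial_tm+\operatorname{div}\sigma+\nabla(\tfrac2ne+q)=0,\quad\operatorname{div}w=0,\quad\partial_t\mu+\operatorname{div}m=0,\quad\partial_te+\operatorname{div}h=\nu\tag{1}$$ with pressure $q$, negative dissipation measure $\nu$, initial data $\mu(\cdot,0)=\mu_0$, $m(\cdot,0)=\mu_0w_0$, $e(\cdot,0)=\frac12\mu_0|w_0|^2$, and boundary conditions $(w-gte_n)\cdot\vec n=0$, $(m-\mu gte_n)\cdot\vec n=0$, $(h-(e+q)gte_n)\cdot\vec n=0$, $(\sigma+\frac2ne\,\mathrm{id}-m\otimes gte_n)\vec n=0$ on $\partial\mathscr D(t)$, if for all $\Phi\in C_c^\infty(\overline{\mathscr D}^*;\mathbb R^n)$ and $\psi\in C_c^\infty(\overline{\mathscr D}^*)$ $$\int_{\mathscr D}\Big[m\cdot\partial_t\Phi+\big(\sigma+\tfrac2ne\,\mathrm{id}+q\,\mathrm{id}\big):\nabla\Phi\Big]-\int_0^T\!\!\int_{\partial\mathscr D(t)}q\,\Phi\cdot\vec n+\int_\Omega\mu_0w_0\cdot\Phi(\cdot,0)=0,$$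 $$\int_{\mathscr D}(w-gte_n)\cdot\nabla\psi=0,\qquad\int_{\mathscr D}[\mu\,\partial_t\psi+m\cdot\nabla\psi]+\int_\Omega\mu_0\psi(\cdot,0)=0,$$ $$\int_{\mathscr D}[e\,\partial_t\psi+h\cdot\nabla\psi]-\int_0^Tgt\int_{\partial\mathscr D(t)}q\,\psi\,e_n\cdot\vec n+\int_\Omega\tfrac12\mu_0|w_0|^2\psi(\cdot,0)=-\nu[\psi].$$ *Weak solutions of the Euler system.* $(\mu,w)\in L^\infty(\mathscr D;\mathbb R\times\mathbb R^n)$ with $\mu\in\{\rho_-,\rho_+\}$ a.e. is a weak solution of $$\partial_t(\mu w)+\operatorname{div}(\mu w\otimes w)+\nabla q=0,\quad\operatorname{div}w=0,\quad\partial_t\mu+\operatorname{div}(\mu w)=0,\quad\partial_t(\tfrac12\mu|w|^2)+\operatorname{div}\big((\tfrac12\mu|w|^2+q)w\big)=\nu\tag{2}$$ with $(w-gte_n)\cdot\vec n=0$ on $\partial\mathscr D(t)$, initial data $(\mu_0,w_0)$, pressure $q$ and dissipation measure $\nu\le0$, if the same four identities hold with $m$, $\sigma+\frac2ne\,\mathrm{id}$,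 $h$, $e$ replaced by $\mu w$, $\mu w\otimes w$, $(\frac12\mu|w|^2+q)w$, $\frac12\mu|w|^2$. **Theorem.** Let $z=(\mu,w,m,h,\sigma,e)\in L^\infty(\mathscr D;Z)$ be a weak solution of (1) with initial data given by $(\mu_0,w_0)$, pressure $q$ and negative dissipation measure $\nu$. Suppose that there is a non-empty open set $\mathscr U\subset\mathscr D$ such that $z$ and $q$ are continuous on $\mathscr U$, the functions $q$, $T_-(z)$, $T_+(z)$ are bounded on $\mathscr U$, and $z(y,t)\in K_{q(y,t)}$ for almost every $(y,t)\in\mathscr D\setminus\mathscr U$. Suppose further that one of the following conditions holds: 1. there is $\varepsilon>0$ such that on all of $\mathscr U$ $$\rho_-<\mu<\rho_+,\qquad\lambda_{\max}(\tilde M(z))+\varepsilon\big|h-(e+q)w-\tilde e(z)(m-\mu w)\big|<\tfrac2n\,e;$$ 2. there is $\gamma>0$ such that $z(y,t)\in\operatorname{int}\big(\operatorname{conv}K_{\gamma,q(y,t)}\big)$ for all $(y,t)\in\mathscr U$. Then there are infinitely many weak solutions of (2), pairwise different as elements of $L^\infty(\mathscr D)$, with the initial data $(\mu_0,w_0)$,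 the given pressure $q$ and the given dissipation measure $\nu$, which coincide with $(\mu,w)$ a.e. on $\mathscr D\setminus\mathscr U$. Moreover, among them there is a sequence $(\mu_k,w_k)$ of pairwise different solutions such that the tuples $z_k=(\mu_k,w_k,m_k,h_k,\sigma_k,e_k)$ defined by $z_k\in K_q$ a.e. in $\mathscr D$ satisfy $z_k\rightharpoonup z$ weakly in $L^2(\mathscr D)$ as $k\to\infty$. -/

import Mathlib

open MeasureTheory Set Filter Topology
open scoped ContDiff

noncomputable section

namespace MixingEuler

/-! ### Vectors and matrices -/

/-- `ℝⁿ` with its Euclidean structure. -/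
abbrev E (n : ℕ) := EuclideanSpace ℝ (Fin n)

/-- The last unit vector `e_n`. -/
def lastVec (n : ℕ) : E n := WithLp.toLp 2 fun i => if (i : ℕ) + 1 = n then 1 else 0

/-- `a ⊗ b`. -/
def outer {n : ℕ} (a b : E n) : Matrix (Fin n) (Fin n) ℝ := Matrix.of fun i j => a i * b j

/-- The largest eigenvalue of a (symmetric) matrix. -/
def lambdaMax {n : ℕ} (A : Matrix (Fin n) (Fin n) ℝ) : ℝ :=
  sSup {l : ℝ | Module.End.HasEigenvalue (Matrix.toLin' A) l}

/-- The space `𝒮₀` of symmetric matrices with vanishing trace. -/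
def tracelessSym (n : ℕ) : Submodule ℝ (Matrix (Fin n) (Fin n) ℝ) where
  carrier := {A | A.IsSymm ∧ A.trace = 0}
  zero_mem' := ⟨Matrix.isSymm_zero, Matrix.trace_zero _ _⟩
  add_mem' := fun ha hb => ⟨ha.1.add hb.1, by rw [Matrix.trace_add, ha.2, hb.2, add_zero]⟩
  smul_mem' := fun c _ ha => ⟨ha.1.smul c, by rw [Matrix.trace_smul, ha.2, smul_zero]⟩

/-! ### The state space `Z`, with elements `z = (μ, w, m, h, σ, e)` -/

abbrev State (n : ℕ) := ℝ × E n × E n × E n × tracelessSym n × ℝ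

namespace State

variable {n : ℕ}

def μ (z : State n) : ℝ := z.1
def w (z : State n) : E n := z.2.1
def m (z : State n) : E n := z.2.2.1
def h (z : State n) : E n := z.2.2.2.1
def σ (z : State n) : Matrix (Fin n) (Fin n) ℝ := (z.2.2.2.2.1 : Matrix (Fin n) (Fin n) ℝ)
def e (z : State n) : ℝ := z.2.2.2.2.2

/-- The matrix `M̃(z)`, meant for `μ ∈ (ρ₋, ρ₊)`. -/
def Mtilde (ρm ρp : ℝ) (z : State n) : Matrix (Fin n) (Fin n) ℝ :=
  ((ρp - z.μ) * (z.μ - ρm))⁻¹ •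
      ((z.μ * ρm * ρp) • outer z.w z.w
        - (ρm * ρp) • (outer z.m z.w + outer z.w z.m)
        + (ρp + ρm - z.μ) • outer z.m z.m)
    - z.σ

/-- `T₊(z)`, meant for `μ ∈ (ρ₋, ρ₊)`. -/
def Tp (ρm ρp : ℝ) (z : State n) : ℝ := ρp / 2 * (‖z.m - ρm • z.w‖ ^ 2 / (z.μ - ρm) ^ 2)

/-- `T₋(z)`, meant for `μ ∈ (ρ₋, ρ₊)`. -/
def Tm (ρm ρp : ℝ) (z : State n) : ℝ := ρm / 2 * (‖z.m - ρp • z.w‖ ^ 2 / (z.μ - ρp) ^ 2)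

/-- `ẽ(z) = (T₊(z) - T₋(z)) / (ρ₊ - ρ₋)`. -/
def etilde (ρm ρp : ℝ) (z : State n) : ℝ := (z.Tp ρm ρp - z.Tm ρm ρp) / (ρp - ρm)

end State

/-- The set `K` of states that satisfy the nonlinear pointwise constraints for the pressure
value `q`. -/
def constraintSet (n : ℕ) (ρm ρp q : ℝ) : Set (State n) :=
  {z | z.m = z.μ • z.w ∧ z.h = (z.e + q) • z.w ∧
    z.μ • outer z.w z.w = z.σ + (2 / (n : ℝ) * z.e) • (1 : Matrix (Fin n) (Fin n) ℝ) ∧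
    (z.μ = ρm ∨ z.μ = ρp)}

/-- The set `K_γ`, i.e. the part of `K` where `e ≤ γ`. -/
def boundedConstraintSet (n : ℕ) (ρm ρp γ q : ℝ) : Set (State n) :=
  {z ∈ constraintSet n ρm ρp q | z.e ≤ γ}

/-! ### Spatial domains -/

/-- A bounded domain in `ℝⁿ`, or the periodic channel `𝕋ⁿ⁻¹ × (-L, L)` with periodicity `1`.
The channel is represented by its lift to `ℝⁿ`: functions on it are functions on `ℝⁿ` that are
`1`-periodic in the first `n - 1` variables, and they are integrated over one period cell. -/
inductive FlowDomain (n : ℕ) where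
  | bounded (Ω : Set (E n)) (hopen : IsOpen Ω) (hconn : IsConnected Ω)
      (hbdd : Bornology.IsBounded Ω)
  | channel (L : ℝ) (hL : 0 < L)

namespace FlowDomain

variable {n : ℕ}

/-- The domain as a subset of `ℝⁿ` (for the channel: its lift). -/
def carrier : FlowDomain n → Set (E n)
  | bounded Ω _ _ _ => Ω
  | channel L _ => {x | |inner ℝ x (lastVec n)| < L}

/-- The periods: only `0` for a bounded domain, `ℤⁿ⁻¹ × {0}` for the channel. -/
def periods : FlowDomain n → Set (E n)
  | bounded _ _ _ _ => {0}
  | channel _ _ => {k | ∀ i : Fin n,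
      ((i : ℕ) + 1 ≠ n → ∃ a : ℤ, k i = a) ∧ ((i : ℕ) + 1 = n → k i = 0)}

/-- A fundamental cell of the periods: `ℝⁿ` for a bounded domain, `[0,1)ⁿ⁻¹ × ℝ` for the
channel. -/
def cell : FlowDomain n → Set (E n)
  | bounded _ _ _ _ => univ
  | channel _ _ => {x | ∀ i : Fin n, (i : ℕ) + 1 ≠ n → x i ∈ Ico (0 : ℝ) 1}

/-- Functions on `ℝⁿ` that descend to the domain. -/
def Periodic {F : Type*} (Ω : FlowDomain n) (f : E n → F) : Prop :=
  ∀ k ∈ Ω.periods, ∀ x, f (x + k) = f x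

/-- Functions of space and time that descend to the domain in the spatial variable. -/
def SpacePeriodic {F : Type*} (Ω : FlowDomain n) (f : E n × ℝ → F) : Prop :=
  ∀ k ∈ Ω.periods, ∀ x t, f (x + k, t) = f (x, t)

/-- Lebesgue measure on (one period cell of) the domain. -/
def initialMeasure (Ω : FlowDomain n) : Measure (E n) := volume.restrict (Ω.carrier ∩ Ω.cell)

end FlowDomain

/-! ### Accelerated space-time domain -/

variable {n : ℕ}

/-- The displacement `½ g t² e_n`. -/
def shift (n : ℕ) (g t : ℝ) : E n := (g * t ^ 2 / 2) • lastVec n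

/-- The slice `𝒟(t) = Ω + ½ g t² e_n`. -/
def slice (Ω : FlowDomain n) (g t : ℝ) : Set (E n) := {y | y - shift n g t ∈ Ω.carrier}

/-- The space-time domain `𝒟`, the union of `𝒟(t) × {t}` over `t ∈ (0, T)`. -/
def spaceTime (Ω : FlowDomain n) (g T : ℝ) : Set (E n × ℝ) :=
  {p | p.2 ∈ Ioo 0 T ∧ p.1 ∈ slice Ω g p.2}

/-- The union of `closure 𝒟(t) × {t}` over `t ∈ [0, T)`. -/
def closedSpaceTime (Ω : FlowDomain n) (g T : ℝ) : Set (E n × ℝ) :=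
  {p | p.2 ∈ Ico 0 T ∧ p.1 ∈ closure (slice Ω g p.2)}

/-- Lebesgue measure on (one period cell of) `𝒟`. -/
def bulkMeasure (Ω : FlowDomain n) (g T : ℝ) : Measure (E n × ℝ) :=
  volume.restrict (spaceTime Ω g T ∩ (Ω.cell ×ˢ univ))

/-- The measure `dS(y) dt` on (one period cell of) the lateral boundary, i.e. on the union of
`∂𝒟(t) × {t}` over `t ∈ (0, T)`, where `dS` is `(n-1)`-dimensional surface measure. As
`∂𝒟(t) = ∂Ω + ½ g t² e_n`, it is the image of `dS dt` on `∂Ω × (0, T)`. -/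
def lateralMeasure (Ω : FlowDomain n) (g T : ℝ) : Measure (E n × ℝ) :=
  (((μHE[n - 1] : Measure (E n)).restrict (frontier Ω.carrier ∩ Ω.cell)).prod
    (volume.restrict (Ioo 0 T))).map fun p => (p.1 + shift n g p.2, p.2)

/-- `ν` is an exterior unit normal of `A` at `x` in the sense of Federer: near `x`, the set `A`
has density zero in the half space `{(y - x) · ν > 0}` and its complement has density zero in the
opposite half space. For sets with a `C¹` boundary this is the classical outer normal. -/
def IsOuterNormal (A : Set (E n)) (x ν : E n) : Prop :=
  ‖ν‖ = 1 ∧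
  Tendsto (fun r : ℝ => volume (Metric.ball x r ∩ {y | y ∈ A ∧ 0 < inner ℝ (y - x) ν})
    / volume (Metric.ball x r)) (𝓝[>] 0) (𝓝 0) ∧
  Tendsto (fun r : ℝ => volume (Metric.ball x r ∩ {y | y ∉ A ∧ inner ℝ (y - x) ν < 0})
    / volume (Metric.ball x r)) (𝓝[>] 0) (𝓝 0)

open Classical in
/-- The outer normal of `A` at `x`, and `0` at the points that have none. -/
def outerNormal (A : Set (E n)) (x : E n) : E n :=
  if hx : ∃ ν, IsOuterNormal A x ν then hx.choose else 0

/-- The outer normal of `𝒟(t)` at `y ∈ ∂𝒟(t)`. -/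
def lateralNormal (Ω : FlowDomain n) (g : ℝ) (p : E n × ℝ) : E n :=
  outerNormal (slice Ω g p.2) p.1

/-! ### Test functions -/

/-- Smooth functions with compact support in `closedSpaceTime Ω g T`, as restrictions of smooth
functions on the whole space-time. They need not vanish at `t = 0` or on the lateral boundary. As
`Ω` is bounded modulo its periods, compactness of the support only says that they vanish near
`t = T`. -/
def testFunctions (Ω : FlowDomain n) (T : ℝ) (F : Type*) [NormedAddCommGroup F]
    [NormedSpace ℝ F] : Submodule ℝ (E n × ℝ → F) where
  carrier := {φ | ContDiff ℝ ∞ φ ∧ Ω.SpacePeriodic φ ∧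
    ∃ T' < T, ∀ x t, T' ≤ t → φ (x, t) = 0}
  zero_mem' := ⟨contDiff_const, fun _ _ _ _ => rfl, T - 1, by linarith, fun _ _ _ => rfl⟩
  add_mem' := by
    rintro a b ⟨ha, ha', Ta, hTa, ha0⟩ ⟨hb, hb', Tb, hTb, hb0⟩
    refine ⟨ha.add hb, fun k hk x t => ?_, max Ta Tb, max_lt hTa hTb, fun x t ht => ?_⟩
    · simp only [Pi.add_apply, ha' k hk x t, hb' k hk x t]
    · simp only [Pi.add_apply, ha0 x t ((le_max_left _ _).trans ht),
        hb0 x t ((le_max_right _ _).trans ht), add_zero]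
  smul_mem' := by
    rintro c a ⟨ha, ha', Ta, hTa, ha0⟩
    refine ⟨contDiff_const.smul ha, fun k hk x t => ?_, Ta, hTa, fun x t ht => ?_⟩
    · simp only [Pi.smul_apply, ha' k hk x t]
    · simp only [Pi.smul_apply, ha0 x t ht, smul_zero]

/-- `∂_t φ`. -/
def dt {F : Type*} [NormedAddCommGroup F] [NormedSpace ℝ F] (φ : E n × ℝ → F)
    (p : E n × ℝ) : F :=
  deriv (fun t => φ (p.1, t)) p.2

/-- The spatial gradient of a scalar function. -/
def spaceGrad (φ : E n × ℝ → ℝ) (p : E n × ℝ) : E n := gradient (fun x => φ (x, p.2)) p.1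

/-- `A : ∇Φ`, the sum of `A i j * ∂_j Φ_i`. -/
def contractGrad (A : Matrix (Fin n) (Fin n) ℝ) (Φ : E n × ℝ → E n) (p : E n × ℝ) : ℝ :=
  ∑ i, ∑ j, A i j * (fderiv ℝ (fun x => Φ (x, p.2)) p.1 (EuclideanSpace.single j 1)) i

/-- A functional on scalar test functions is a negative measure if it is nonpositive on the test
functions that are nonnegative on `closedSpaceTime Ω g T`. In particular, it depends only on the
restriction of the test function to that set. -/
def IsNegativeMeasure (Ω : FlowDomain n) (g T : ℝ) (ν : testFunctions Ω T ℝ →ₗ[ℝ] ℝ) : Prop :=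
  ∀ ψ : testFunctions Ω T ℝ,
    (∀ p ∈ closedSpaceTime Ω g T, 0 ≤ (ψ : E n × ℝ → ℝ) p) → ν ψ ≤ 0

/-! ### Weak solutions -/

/-- Initial data: `μ₀ ∈ L^∞(Ω)` with values in `{ρ₋, ρ₊}`, and `w₀ ∈ L^∞(Ω)` with `div w₀ = 0` in
`Ω` and `w₀ · n = 0` on `∂Ω` in the sense of distributions. -/
structure IsInitialData (ρm ρp : ℝ) (Ω : FlowDomain n) (μ₀ : E n → ℝ) (w₀ : E n → E n) :
    Prop where
  periodic_density : Ω.Periodic μ₀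
  periodic_velocity : Ω.Periodic w₀
  bounded_density : MemLp μ₀ ⊤ Ω.initialMeasure
  bounded_velocity : MemLp w₀ ⊤ Ω.initialMeasure
  two_phase : ∀ᵐ x ∂Ω.initialMeasure, μ₀ x = ρm ∨ μ₀ x = ρp
  div_free : ∀ φ : E n → ℝ, ContDiff ℝ ∞ φ → Ω.Periodic φ →
    ∫ x, inner ℝ (w₀ x) (gradient φ x) ∂Ω.initialMeasure = 0

/-- A pressure: a function on `𝒟` and its lateral boundary that is essentially bounded on `𝒟`,
integrable on the lateral boundary, and whose boundary values are the trace, with respect to the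
spatial variable, of its values in the interior. -/
structure IsPressure (Ω : FlowDomain n) (g T : ℝ) (q : E n × ℝ → ℝ) : Prop where
  periodic : Ω.SpacePeriodic q
  bounded : MemLp q ⊤ (bulkMeasure Ω g T)
  boundary : Integrable q (lateralMeasure Ω g T)
  trace : ∀ᵐ p ∂(lateralMeasure Ω g T), Tendsto
    (fun r : ℝ => ⨍⁻ x in Metric.ball p.1 r ∩ slice Ω g p.2, ‖q (x, p.2) - q p‖ₑ ∂volume)
    (𝓝[>] 0) (𝓝 0)

/-- `z = (μ, w, m, h, σ, e)` is a weak `L^∞` solution on `𝒟`, with initial data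
`(μ₀, μ₀ w₀, ½ μ₀ |w₀|²)`, pressure `q` and negative dissipation measure `ν`, of
`∂ₜm + div σ + ∇(2e/n + q) = 0`, `div w = 0`, `∂ₜμ + div m = 0`, `∂ₜe + div h = ν`.
The boundary conditions `(w - g t e_n) · n = 0`, `(m - μ g t e_n) · n = 0`,
`(h - (e + q) g t e_n) · n = 0` and `(σ + (2e/n) id - m ⊗ g t e_n) n = 0` are part of the weak
formulation, as test functions do not have to vanish on the lateral boundary. -/
structure IsLinearSolution (Ω : FlowDomain n) (g T : ℝ) (μ₀ : E n → ℝ) (w₀ : E n → E n)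
    (z : E n × ℝ → State n) (q : E n × ℝ → ℝ) (ν : testFunctions Ω T ℝ →ₗ[ℝ] ℝ) : Prop where
  periodic : Ω.SpacePeriodic z
  /-- `z ∈ L^∞`: all its coordinates are. -/
  bounded : ∀ l : State n →L[ℝ] ℝ, MemLp (fun p => l (z p)) ⊤ (bulkMeasure Ω g T)
  pressure : IsPressure Ω g T q
  negative : IsNegativeMeasure Ω g T ν
  momentum : ∀ Φ ∈ testFunctions Ω T (E n),
    ∫ p, (inner ℝ (z p).m (dt Φ p)
        + contractGrad ((z p).σ
            + (2 / (n : ℝ) * (z p).e + q p) • (1 : Matrix (Fin n) (Fin n) ℝ)) Φ p)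
        ∂(bulkMeasure Ω g T)
      - ∫ p, q p * inner ℝ (Φ p) (lateralNormal Ω g p) ∂(lateralMeasure Ω g T)
      + ∫ x, inner ℝ (μ₀ x • w₀ x) (Φ (x, 0)) ∂Ω.initialMeasure = 0
  incompressibility : ∀ ψ ∈ testFunctions Ω T ℝ,
    ∫ p, inner ℝ ((z p).w - (g * p.2) • lastVec n) (spaceGrad ψ p) ∂(bulkMeasure Ω g T) = 0
  mass : ∀ ψ ∈ testFunctions Ω T ℝ,
    ∫ p, ((z p).μ * dt ψ p + inner ℝ (z p).m (spaceGrad ψ p)) ∂(bulkMeasure Ω g T)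
      + ∫ x, μ₀ x * ψ (x, 0) ∂Ω.initialMeasure = 0
  energy : ∀ ψ : testFunctions Ω T ℝ,
    ∫ p, ((z p).e * dt (ψ : E n × ℝ → ℝ) p
        + inner ℝ (z p).h (spaceGrad (ψ : E n × ℝ → ℝ) p)) ∂(bulkMeasure Ω g T)
      - ∫ p, g * p.2 * (q p * (ψ : E n × ℝ → ℝ) p * inner ℝ (lastVec n) (lateralNormal Ω g p))
          ∂(lateralMeasure Ω g T)
      + ∫ x, (μ₀ x * ‖w₀ x‖ ^ 2 / 2) * (ψ : E n × ℝ → ℝ) (x, 0) ∂Ω.initialMeasure = -ν ψ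

/-- `(μ, w)` is a weak `L^∞` solution on `𝒟`, with initial data `(μ₀, w₀)`, pressure `q`,
dissipation measure `ν ≤ 0` and `μ ∈ {ρ₋, ρ₊}`, of
`∂ₜ(μw) + div(μ w ⊗ w) + ∇q = 0`, `div w = 0`, `∂ₜμ + div(μw) = 0`,
`∂ₜ(½ μ|w|²) + div((½ μ|w|² + q) w) = ν`, and `(w - g t e_n) · n = 0` on `∂𝒟(t)`. -/
structure IsEulerSolution (ρm ρp : ℝ) (Ω : FlowDomain n) (g T : ℝ) (μ₀ : E n → ℝ)
    (w₀ : E n → E n) (μ : E n × ℝ → ℝ) (w : E n × ℝ → E n) (q : E n × ℝ → ℝ)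
    (ν : testFunctions Ω T ℝ →ₗ[ℝ] ℝ) : Prop where
  periodic_density : Ω.SpacePeriodic μ
  periodic_velocity : Ω.SpacePeriodic w
  bounded_density : MemLp μ ⊤ (bulkMeasure Ω g T)
  bounded_velocity : MemLp w ⊤ (bulkMeasure Ω g T)
  pressure : IsPressure Ω g T q
  negative : IsNegativeMeasure Ω g T ν
  two_phase : ∀ᵐ p ∂(bulkMeasure Ω g T), μ p = ρm ∨ μ p = ρp
  momentum : ∀ Φ ∈ testFunctions Ω T (E n),
    ∫ p, (inner ℝ (μ p • w p) (dt Φ p)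
        + contractGrad (μ p • outer (w p) (w p) + q p • (1 : Matrix (Fin n) (Fin n) ℝ)) Φ p)
        ∂(bulkMeasure Ω g T)
      - ∫ p, q p * inner ℝ (Φ p) (lateralNormal Ω g p) ∂(lateralMeasure Ω g T)
      + ∫ x, inner ℝ (μ₀ x • w₀ x) (Φ (x, 0)) ∂Ω.initialMeasure = 0
  incompressibility : ∀ ψ ∈ testFunctions Ω T ℝ,
    ∫ p, inner ℝ (w p - (g * p.2) • lastVec n) (spaceGrad ψ p) ∂(bulkMeasure Ω g T) = 0
  mass : ∀ ψ ∈ testFunctions Ω T ℝ,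
    ∫ p, (μ p * dt ψ p + inner ℝ (μ p • w p) (spaceGrad ψ p)) ∂(bulkMeasure Ω g T)
      + ∫ x, μ₀ x * ψ (x, 0) ∂Ω.initialMeasure = 0
  energy : ∀ ψ : testFunctions Ω T ℝ,
    ∫ p, (μ p * ‖w p‖ ^ 2 / 2 * dt (ψ : E n × ℝ → ℝ) p
        + inner ℝ ((μ p * ‖w p‖ ^ 2 / 2 + q p) • w p) (spaceGrad (ψ : E n × ℝ → ℝ) p))
        ∂(bulkMeasure Ω g T)
      - ∫ p, g * p.2 * (q p * (ψ : E n × ℝ → ℝ) p * inner ℝ (lastVec n) (lateralNormal Ω g p))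
          ∂(lateralMeasure Ω g T)
      + ∫ x, (μ₀ x * ‖w₀ x‖ ^ 2 / 2) * (ψ : E n × ℝ → ℝ) (x, 0) ∂Ω.initialMeasure = -ν ψ

/-- Weak convergence in `L²(𝒟; Z)`, i.e. weak convergence in `L²(𝒟)` of all coordinates. -/
def WeaklyConverges (Ω : FlowDomain n) (g T : ℝ) (zs : ℕ → E n × ℝ → State n)
    (z : E n × ℝ → State n) : Prop :=
  ∀ l : State n →L[ℝ] ℝ,
    (∀ k, MemLp (fun p => l (zs k p)) 2 (bulkMeasure Ω g T)) ∧
    MemLp (fun p => l (z p)) 2 (bulkMeasure Ω g T) ∧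
    ∀ φ : E n × ℝ → ℝ, MemLp φ 2 (bulkMeasure Ω g T) →
      Tendsto (fun k => ∫ p, l (zs k p) * φ p ∂(bulkMeasure Ω g T)) atTop
        (𝓝 (∫ p, l (z p) * φ p ∂(bulkMeasure Ω g T)))

end MixingEuler

end

noncomputable section

namespace MixingEuler

/-! The theorem is proved by convex integration. A strict subsolution takes values in the interior
of the convex hull of the bounded constraint set. It is perturbed by rapidly oscillating solutions
of the linear system with compact support in the mixing zone. These leave all weak identities intact
and push the state towards the constraint set.

Two facts make large perturbations possible. Every difference of two states in `constraintSet` for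
the same pressure is an amplitude of plane waves of the linear system
(`isWaveDirection_phaseState_sub`). Two phases with velocities `w₁`, `w₂` share a direction of
oscillation that both transport, orthogonal to `w₁ - w₂` in space, and a third order potential
localizes the wave. Therefore no lamination hull has to be computed: the full convex hull is
available. By Carathéodory, an interior point of the hull is also the centre of an admissible
segment in such a direction whose length is comparable to the distance from the constraint set
(`exists_long_segment`). A covering by disjoint balls, each carrying one wave, gives a perturbation
that is weakly small but whose squared `L²` norm controls the integral of the squared distance to
the constraints (`exists_perturbation`).

In the iteration, each increment is chosen almost orthogonal to all earlier iterates, so the norms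
are almost increasing. They are bounded, so the iterates converge strongly and the distance tends to
zero (`exists_strong_limit_of_step`). The limits satisfy the constraints, and can be taken weakly
close to `z`. They differ from `z`, because the constraint set misses the interior of its hull. Weak
convergence to `z` then yields infinitely many different limits (`exists_solutions`).

The pressure enters only through the linear substitution `h ↦ h + q w`, so a single compact set
serves for all points once pointwise linear coordinates are used.

The explicit inequality reduces to the hull condition by a probabilistic construction
(`mem_convexHull_of_quadForm_lt`). The state is split into its two phases, each of which gets a
fluctuating velocity with Reynolds stress `(2/n) e id - M̃`. Skewness of the fluctuations produces
the remaining energy flux, and the `ε` term bounds that skewness, hence the energies involved. In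
the periodic case the construction is done over the interior of one cell and extended periodically.
-/

/-! ### An iteration in Hilbert spaces -/

/-- If every point of a bounded set `X` has points of `X` that are weakly close to it but at
squared distance at least `c * D`, then arbitrarily weakly close to every point of `X` there are
strong limits of sequences in `X` along which `D` tends to zero. -/
theorem exists_strong_limit_of_step {H : Type*} [NormedAddCommGroup H] [InnerProductSpace ℝ H]
    [CompleteSpace H] {X : Set H} {R : ℝ} (hX : ∀ x ∈ X, ‖x‖ ≤ R) {D : H → ℝ}
    (hD : ∀ x, 0 ≤ D x) {c : ℝ} (hc : 0 < c)
    (step : ∀ x ∈ X, ∀ F : Finset H, ∀ ε : ℝ, 0 < ε →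
      ∃ y ∈ X, (∀ f ∈ F, |inner ℝ (y - x) f| ≤ ε) ∧ c * D x ≤ ‖y - x‖ ^ 2)
    {x : H} (hx : x ∈ X) (F : Finset H) {ε : ℝ} (hε : 0 < ε) :
    ∃ (u : ℕ → H) (y : H), (∀ j, u j ∈ X) ∧ Tendsto u atTop (𝓝 y) ∧
      Tendsto (fun j => D (u j)) atTop (𝓝 0) ∧ ∀ f ∈ F, |inner ℝ (y - x) f| ≤ ε := by
  classical
  have step' : ∀ (p : X × Finset H) (j : ℕ), ∃ y : X,
      (∀ f ∈ p.2, |inner ℝ ((y : H) - p.1) f| ≤ ε * (1 / 2) ^ (j + 1)) ∧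
        c * D p.1 ≤ ‖(y : H) - p.1‖ ^ 2 := by
    intro p j
    obtain ⟨y, hy, h1, h2⟩ := step p.1 p.1.2 p.2 (ε * (1 / 2) ^ (j + 1)) (by positivity)
    exact ⟨⟨y, hy⟩, h1, h2⟩
  choose nxt hnxt hnxt' using step'
  -- The list of test vectors grows with the iteration and contains all iterates so far. This forces
  -- every later increment to be almost orthogonal to them.
  let s : ℕ → X × Finset H := fun j => Nat.rec (⟨x, hx⟩, insert x F)
    (fun j p => (nxt p j, insert (nxt p j : H) p.2)) j
  have hs : ∀ j, s (j + 1) = (nxt (s j) j, insert (nxt (s j) j : H) (s j).2) := fun j => rfl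
  set u : ℕ → H := fun j => ((s j).1 : H) with hu
  have hu1 : ∀ j, u (j + 1) = nxt (s j) j := fun j => by simp only [hu, hs]
  have hmono : ∀ j k, j ≤ k → (s j).2 ⊆ (s k).2 := by
    intro j k hjk
    induction k, hjk using Nat.le_induction with
    | base => exact subset_rfl
    | succ k _ ih => rw [hs]; exact ih.trans (Finset.subset_insert _ _)
  have hself : ∀ j, u j ∈ (s j).2 := by
    intro j
    cases j with
    | zero => exact Finset.mem_insert_self _ _
    | succ j => rw [hu1, hs]; exact Finset.mem_insert_self _ _
  have hstep : ∀ j, ∀ f ∈ (s j).2, |inner ℝ (u (j + 1) - u j) f| ≤ ε * (1 / 2) ^ (j + 1) := by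
    intro j f hf; rw [hu1]; exact hnxt (s j) j f hf
  have htel : ∀ j k, j ≤ k → ∀ f ∈ (s j).2,
      |inner ℝ (u k - u j) f| ≤ ε * (1 / 2) ^ j - ε * (1 / 2) ^ k := by
    intro j k hjk f hf
    induction k, hjk using Nat.le_induction with
    | base => simp
    | succ k hk ih =>
      have e : u (k + 1) - u j = (u (k + 1) - u k) + (u k - u j) := by abel
      have h1 := hstep k f (hmono j k hk hf)
      rw [e, inner_add_left]
      refine (abs_add_le _ _).trans ?_
      have : ε * (1 / 2 : ℝ) ^ k = 2 * (ε * (1 / 2) ^ (k + 1)) := by ring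
      linarith
  -- In the expansion of `‖u k‖ ^ 2` around `u j` the cross term is at most `2 ε (2⁻ʲ - 2⁻ᵏ)` by
  -- `htel`. Subtracting `2 ε 2⁻ʲ` from the squared norms absorbs it, so `b` is monotone, and its
  -- increments dominate squared distances.
  set b : ℕ → ℝ := fun j => ‖u j‖ ^ 2 - 2 * (ε * (1 / 2) ^ j) with hb
  have hdiff : ∀ j k, j ≤ k → ‖u k - u j‖ ^ 2 ≤ b k - b j := by
    intro j k hjk
    have h1 := htel j k hjk (u j) (hself j)
    have h2 : ‖u k‖ ^ 2 = ‖u k - u j‖ ^ 2 + 2 * inner ℝ (u k - u j) (u j) + ‖u j‖ ^ 2 := by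
      rw [← norm_add_sq_real, sub_add_cancel]
    have h3 := (abs_le.1 h1).1
    simp only [hb]
    nlinarith
  have hbmono : Monotone b := fun j k hjk => by
    have := hdiff j k hjk
    nlinarith [sq_nonneg ‖u k - u j‖]
  have hbbdd : BddAbove (range b) := by
    refine ⟨R ^ 2, ?_⟩
    rintro _ ⟨j, rfl⟩
    have h1 : ‖u j‖ ≤ R := hX _ (s j).1.2
    have h2 : 0 < ε * (1 / 2 : ℝ) ^ j := by positivity
    simp only [hb]
    nlinarith [norm_nonneg (u j)]
  have hblim := tendsto_atTop_ciSup hbmono hbbdd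
  have hcau : CauchySeq u := by
    rw [Metric.cauchySeq_iff']
    intro δ hδ
    obtain ⟨N, hN⟩ := Metric.cauchySeq_iff'.1 hblim.cauchySeq (δ ^ 2) (by positivity)
    refine ⟨N, fun k hk => ?_⟩
    have h1 := hdiff N k hk
    have h2 := hN k hk
    rw [Real.dist_eq] at h2
    rw [dist_eq_norm]
    exact lt_of_pow_lt_pow_left₀ 2 hδ.le (h1.trans_lt ((le_abs_self _).trans_lt h2))
  obtain ⟨y, hy⟩ := cauchySeq_tendsto_of_complete hcau
  refine ⟨u, y, fun j => (s j).1.2, hy, ?_, fun f hf => ?_⟩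
  · have h0 : Tendsto (fun j => c⁻¹ * (b (j + 1) - b j)) atTop (𝓝 0) := by
      have := ((hblim.comp (tendsto_add_atTop_nat 1)).sub hblim).const_mul c⁻¹
      simpa using this
    refine squeeze_zero (fun j => hD _) (fun j => ?_) h0
    have h1 := hnxt' (s j) j
    rw [← hu1] at h1
    have h2 := h1.trans (hdiff j (j + 1) (Nat.le_succ j))
    rw [le_inv_mul_iff₀ hc]
    exact h2
  · have h1 : Tendsto (fun j => |inner ℝ (u j - x) f|) atTop (𝓝 |inner ℝ (y - x) f|) :=
      ((hy.sub_const x).inner tendsto_const_nhds).abs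
    refine le_of_tendsto' h1 fun j => ?_
    have h2 := htel 0 j (Nat.zero_le j) f (Finset.mem_insert_of_mem hf)
    have h3 : 0 < ε * (1 / 2 : ℝ) ^ j := by positivity
    change |inner ℝ (u j - x) f| ≤ _ at h2
    simp only [pow_zero, mul_one] at h2
    linarith

/-! ### Long segments in the interior of a convex hull -/

/-- Every point in the interior of the convex hull of `K` is the centre of a segment in that
interior whose direction is a difference of points of `K`, and whose length controls the distance
to `K`. -/
theorem exists_long_segment {V : Type*} [NormedAddCommGroup V] [NormedSpace ℝ V]
    [FiniteDimensional ℝ V] {K : Set V} {ζ : V} (hζ : ζ ∈ interior (convexHull ℝ K)) :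
    ∃ a ∈ K, ∃ b ∈ K, ∃ t : ℝ,
      (∀ s : ℝ, |s| ≤ 1 → ζ + s • t • (a - b) ∈ interior (convexHull ℝ K)) ∧
      Metric.infDist ζ K ≤ (2 * (Module.finrank ℝ V + 1)) * ‖t • (a - b)‖ := by
  obtain ⟨ι, hι, z, w, hz, haff, hw, hw1, hsum⟩ :=
    eq_pos_convex_span_of_mem_convexHull (interior_subset hζ)
  have hne : (Finset.univ : Finset ι).Nonempty := by
    rw [Finset.nonempty_iff_ne_empty]
    intro h
    rw [h] at hw1
    simp at hw1
  -- The heaviest vertex `z i` can lose the weight of any other vertex. The vertex `z j` contributes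
  -- the largest term to `ζ - z i = ∑ w k • (z k - z i)`, a sum of at most `dim + 1` terms by
  -- Carathéodory, so this term controls the distance.
  obtain ⟨i, -, hi⟩ := Finset.exists_max_image Finset.univ w hne
  obtain ⟨j, -, hj⟩ := Finset.exists_max_image Finset.univ (fun j => ‖w j • (z j - z i)‖) hne
  have hcard : (Fintype.card ι : ℝ) ≤ Module.finrank ℝ V + 1 := by
    exact_mod_cast haff.card_le_finrank_succ.trans
      (Nat.succ_le_succ (Submodule.finrank_le _))
  -- Half of the admissible shift `w j` is used: averaging with the interior point `ζ` moves the
  -- segment from the hull into its interior.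
  refine ⟨z j, hz ⟨j, rfl⟩, z i, hz ⟨i, rfl⟩, w j / 2, ?_, ?_⟩
  · have hmem : ∀ s : ℝ, |s| ≤ 1 → ζ + s • w j • (z j - z i) ∈ convexHull ℝ K := by
      classical
      intro s hs
      obtain ⟨hs1, hs2⟩ := abs_le.1 hs
      by_cases hij : j = i
      · subst hij; simpa using interior_subset hζ
      let w' : ι → ℝ := fun k => w k + s * w j * ((if k = j then 1 else 0) - if k = i then 1 else 0)
      have h0 : ∀ k ∈ (Finset.univ : Finset ι), 0 ≤ w' k := by
        intro k _
        simp only [w']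
        have hk := hw k
        have hj' := hw j
        have hij' := hi j (Finset.mem_univ j)
        split_ifs with h1 h2 h2
        · simp [hk.le]
        · subst h1; nlinarith
        · subst h2; nlinarith
        · simp [hk.le]
      have h1 : ∑ k, w' k = 1 := by
        simp only [w', Finset.sum_add_distrib, hw1, ← Finset.mul_sum, Finset.sum_sub_distrib]
        simp
      have h2 : ∑ k, w' k • z k = ζ + s • w j • (z j - z i) := by
        simp only [w', add_smul, Finset.sum_add_distrib, hsum, mul_smul, sub_smul,
          ← Finset.smul_sum, Finset.sum_sub_distrib]
        simp
      rw [← h2]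
      exact (convex_convexHull ℝ K).sum_mem h0 h1
        fun k _ => subset_convexHull ℝ K (hz ⟨k, rfl⟩)
    intro s hs
    have h1 := (convex_convexHull ℝ K).combo_interior_self_mem_interior hζ (hmem s hs)
      (a := 1 / 2) (b := 1 / 2) (by norm_num) (by norm_num) (by norm_num)
    convert h1 using 1
    module
  · have h1 : Metric.infDist ζ K ≤ ‖ζ - z i‖ := by
      rw [← dist_eq_norm]; exact Metric.infDist_le_dist_of_mem (hz ⟨i, rfl⟩)
    have h2 : ζ - z i = ∑ k, w k • (z k - z i) := by
      simp only [smul_sub, Finset.sum_sub_distrib, hsum, ← Finset.sum_smul, hw1, one_smul]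
    have h3 : ‖ζ - z i‖ ≤ Fintype.card ι * ‖w j • (z j - z i)‖ := by
      rw [h2]
      refine (norm_sum_le _ _).trans ?_
      refine (Finset.sum_le_card_nsmul _ _ _ fun k hk => hj k hk).trans_eq ?_
      simp
    have h4 : ‖(w j / 2) • (z j - z i)‖ = ‖w j • (z j - z i)‖ / 2 := by
      rw [div_eq_inv_mul, mul_smul, norm_smul]; norm_num; ring
    rw [h4]
    have := mul_le_mul_of_nonneg_right hcard (norm_nonneg (w j • (z j - z i)))
    linarith

/-! ### Localized plane waves -/

section Waves

set_option maxSynthPendingDepth 5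

variable {V : Type} [NormedAddCommGroup V] [NormedSpace ℝ V]
  {Y : Type} [NormedAddCommGroup Y] [NormedSpace ℝ Y]

/-- The third derivative as an iterated linear map. -/
def thirdDeriv (φ : V → ℝ) (p : V) : V →L[ℝ] V →L[ℝ] V →L[ℝ] ℝ :=
  fderiv ℝ (fderiv ℝ (fderiv ℝ φ)) p

/-- The trilinear form `(u, v, w) ↦ l u * l v * l w`. -/
def cube (l : V →L[ℝ] ℝ) : V →L[ℝ] V →L[ℝ] V →L[ℝ] ℝ :=
  l.smulRight (l.smulRight (l.smulRight 1))

@[simp] theorem cube_apply (l : V →L[ℝ] ℝ) (u v w : V) : cube l u v w = l u * l v * l w := by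
  simp [cube, mul_assoc]

/-- A plane wave of frequency `N` in direction `l` with amplitude `N⁻ᵏ χ`; the profile is a
`k`-th antiderivative of the cosine. -/
def wave (l : V →L[ℝ] ℝ) (N : ℝ) (k : ℕ) (χ : V → Y) (p : V) : Y :=
  (N⁻¹ ^ k * Real.cos (N * l p - k * (Real.pi / 2))) • χ p

theorem contDiff_wave (l : V →L[ℝ] ℝ) (N : ℝ) (k : ℕ) {χ : V → Y} (hχ : ContDiff ℝ ∞ χ) :
    ContDiff ℝ ∞ (wave l N k χ) := by
  unfold wave
  refine ContDiff.smul (contDiff_const.mul (Real.contDiff_cos.comp ?_)) hχ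
  exact (contDiff_const.mul l.contDiff).sub contDiff_const

/-- A derivative either falls on the amplitude and keeps the power of `N⁻¹`, or falls on the phase,
where the factor `N` cancels one power and the quarter-period shift turns the profile into its
derivative. -/
theorem fderiv_wave (l : V →L[ℝ] ℝ) {N : ℝ} (hN : N ≠ 0) (k : ℕ) {χ : V → Y}
    (hχ : ContDiff ℝ ∞ χ) :
    fderiv ℝ (wave l N (k + 1) χ) =
      wave l N (k + 1) (fderiv ℝ χ) + wave l N k (fun p => l.smulRight (χ p)) := by
  ext1 p
  have h1 : HasFDerivAt χ (fderiv ℝ χ p) p :=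
    (hχ.differentiable (by simp)).differentiableAt.hasFDerivAt
  have h2 : HasFDerivAt (fun p => N * l p - ((k + 1 : ℕ) : ℝ) * (Real.pi / 2)) (N • l) p :=
    (l.hasFDerivAt.const_mul N).sub_const _
  have h3 := ((h2.cos.const_mul (N⁻¹ ^ (k + 1))).smul h1).fderiv
  have h4 : Real.sin (N * l p - ((k + 1 : ℕ) : ℝ) * (Real.pi / 2))
      = -Real.cos (N * l p - k * (Real.pi / 2)) := by
    rw [← Real.sin_sub_pi_div_two]; congr 1; push_cast; ring
  unfold wave
  simp only [Pi.add_apply]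
  refine h3.trans ?_
  congr 1
  ext v
  simp only [ContinuousLinearMap.smulRight_apply, _root_.smul_apply, smul_eq_mul,
    smul_smul]
  congr 1
  rw [h4, pow_succ]
  field_simp

theorem norm_wave_le (l : V →L[ℝ] ℝ) {N : ℝ} (hN : 1 ≤ N) (k : ℕ) (χ : V → Y) {C : ℝ}
    (hC : ∀ p, ‖χ p‖ ≤ C) (p : V) : ‖wave l N (k + 1) χ p‖ ≤ C / N := by
  have hN0 : 0 < N := by linarith
  have hC0 : 0 ≤ C := (norm_nonneg _).trans (hC p)
  unfold wave
  rw [norm_smul, norm_mul, div_eq_inv_mul C N]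
  have h1 : ‖N⁻¹ ^ (k + 1)‖ ≤ N⁻¹ := by
    rw [Real.norm_of_nonneg (by positivity), pow_succ]
    exact mul_le_of_le_one_left (by positivity) (pow_le_one₀ (by positivity)
        (inv_le_one_of_one_le₀ hN))
  have h2 := Real.abs_cos_le_one (N * l p - ((k + 1 : ℕ) : ℝ) * (Real.pi / 2))
  rw [← Real.norm_eq_abs] at h2
  have h3 := mul_le_mul (mul_le_mul h1 h2 (norm_nonneg _) (by positivity)) (hC p) (norm_nonneg _)
    (by positivity)
  rwa [mul_one] at h3

/-- Of the eight terms produced by three applications of the product rule, only the one with all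
derivatives on the phase carries no negative power of `N`. -/
theorem thirdDeriv_wave_approx (l : V →L[ℝ] ℝ) {χ : V → ℝ} (hχ : ContDiff ℝ ∞ χ)
    (hs : HasCompactSupport χ) :
    ∃ C, ∀ N : ℝ, 1 ≤ N → ∀ p,
      ‖thirdDeriv (wave l N 3 χ) p - (χ p * Real.cos (N * l p)) • cube l‖ ≤ C / N := by
  have bdd : ∀ {Y : Type} [NormedAddCommGroup Y] [NormedSpace ℝ Y] {f : V → Y},
      ContDiff ℝ ∞ f → HasCompactSupport f → ∃ C, ∀ p, ‖f p‖ ≤ C :=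
    fun hf hfs => hf.continuous.bounded_above_of_compact_support hfs |>.imp fun _ h => h
  have dsm : ∀ {Y : Type} [NormedAddCommGroup Y] [NormedSpace ℝ Y] {f : V → Y},
      ContDiff ℝ ∞ f → ContDiff ℝ ∞ (fderiv ℝ f) := fun hf => hf.fderiv_right (by simp)
  have lsm : ∀ {Y : Type} [NormedAddCommGroup Y] [NormedSpace ℝ Y] {f : V → Y},
      ContDiff ℝ ∞ f → ContDiff ℝ ∞ (fun p => l.smulRight (f p)) := fun {Y} _ _ {f} hf =>
    (ContinuousLinearMap.smulRightL ℝ V Y l).contDiff.comp hf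
  have lcs : ∀ {Y : Type} [NormedAddCommGroup Y] [NormedSpace ℝ Y] {f : V → Y},
      HasCompactSupport f → HasCompactSupport (fun p => l.smulRight (f p)) :=
    fun {Y} _ _ {f} hf => hf.comp_left (g := fun y => l.smulRight y) (by ext; simp)
  have d1 := dsm hχ
  have d2 := dsm d1
  have d3 := dsm d2
  have c1 := hs.fderiv ℝ
  have c2 := c1.fderiv ℝ
  have c3 := c2.fderiv ℝ
  obtain ⟨C1, h1⟩ := bdd d3 c3
  obtain ⟨C2, h2⟩ := bdd (lsm d2) (lcs c2)
  obtain ⟨C3, h3⟩ := bdd (dsm (lsm d1)) ((lcs c1).fderiv ℝ)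
  obtain ⟨C4, h4⟩ := bdd (lsm (lsm d1)) (lcs (lcs c1))
  obtain ⟨C5, h5⟩ := bdd (dsm (dsm (lsm hχ))) (((lcs hs).fderiv ℝ).fderiv ℝ)
  obtain ⟨C6, h6⟩ := bdd (lsm (dsm (lsm hχ))) (lcs ((lcs hs).fderiv ℝ))
  obtain ⟨C7, h7⟩ := bdd (dsm (lsm (lsm hχ))) ((lcs (lcs hs)).fderiv ℝ)
  refine ⟨C1 + C2 + C3 + C4 + C5 + C6 + C7, fun N hN p => ?_⟩
  have hN0 : N ≠ 0 := by linarith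
  have dd : ∀ {Y : Type} [NormedAddCommGroup Y] [NormedSpace ℝ Y] {f : V → Y} (k : ℕ),
      ContDiff ℝ ∞ f → Differentiable ℝ (wave l N k f) :=
    fun k hf => (contDiff_wave l N k hf).differentiable (by simp)
  have fadd : ∀ {Y : Type} [NormedAddCommGroup Y] [NormedSpace ℝ Y] {f g : V → Y},
      Differentiable ℝ f → Differentiable ℝ g → fderiv ℝ (f + g) = fderiv ℝ f + fderiv ℝ g :=
    fun hf hg => funext fun p => fderiv_add hf.differentiableAt hg.differentiableAt
  have e : fderiv ℝ (fderiv ℝ (fderiv ℝ (wave l N 3 χ))) =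
      (((wave l N 3 (fderiv ℝ (fderiv ℝ (fderiv ℝ χ)))
        + wave l N 2 (fun p => l.smulRight (fderiv ℝ (fderiv ℝ χ) p)))
      + (wave l N 2 (fderiv ℝ (fun p => l.smulRight (fderiv ℝ χ p)))
        + wave l N 1 (fun p => l.smulRight (l.smulRight (fderiv ℝ χ p)))))
      + ((wave l N 2 (fderiv ℝ (fderiv ℝ (fun p => l.smulRight (χ p))))
        + wave l N 1 (fun p => l.smulRight (fderiv ℝ (fun p => l.smulRight (χ p)) p)))
      + (wave l N 1 (fderiv ℝ (fun p => l.smulRight (l.smulRight (χ p))))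
        + wave l N 0 (fun p => l.smulRight (l.smulRight (l.smulRight (χ p))))))) := by
    rw [fderiv_wave l hN0 2 hχ, fadd (dd _ d1) (dd _ (lsm hχ)), fderiv_wave l hN0 2 d1,
      fderiv_wave l hN0 1 (lsm hχ),
      fadd ((dd _ d2).add (dd _ (lsm d1))) ((dd _ (dsm (lsm hχ))).add (dd _ (lsm (lsm hχ)))),
      fadd (dd _ d2) (dd _ (lsm d1)), fadd (dd _ (dsm (lsm hχ))) (dd _ (lsm (lsm hχ))),
      fderiv_wave l hN0 2 d2, fderiv_wave l hN0 1 (lsm d1), fderiv_wave l hN0 1 (dsm (lsm hχ)),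
      fderiv_wave l hN0 0 (lsm (lsm hχ))]
  have e0 : wave l N 0 (fun p => l.smulRight (l.smulRight (l.smulRight (χ p)))) p
      = (χ p * Real.cos (N * l p)) • cube l := by
    ext u v w
    simp [wave]
    ring
  unfold thirdDeriv
  rw [e]
  simp only [Pi.add_apply, e0]
  have n1 := norm_wave_le l hN 2 _ h1 p
  have n2 := norm_wave_le l hN 1 _ h2 p
  have n3 := norm_wave_le l hN 1 _ h3 p
  have n4 := norm_wave_le l hN 0 _ h4 p
  have n5 := norm_wave_le l hN 1 _ h5 p
  have n6 := norm_wave_le l hN 0 _ h6 p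
  have n7 := norm_wave_le l hN 0 _ h7 p
  simp only [zero_add, Nat.reduceAdd] at n1 n2 n3 n4 n5 n6 n7
  have key : ∀ w1 w2 w3 w4 w5 w6 w7 w8 : V →L[ℝ] V →L[ℝ] V →L[ℝ] ℝ,
      ‖w1 + w2 + (w3 + w4) + (w5 + w6 + (w7 + w8)) - w8‖
        ≤ ‖w1‖ + ‖w2‖ + ‖w3‖ + ‖w4‖ + ‖w5‖ + ‖w6‖ + ‖w7‖ := by
    intro w1 w2 w3 w4 w5 w6 w7 w8
    have e1 : w1 + w2 + (w3 + w4) + (w5 + w6 + (w7 + w8)) - w8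
        = w1 + w2 + w3 + w4 + w5 + w6 + w7 := by abel
    rw [e1]
    have a1 := norm_add_le (w1 + w2 + w3 + w4 + w5 + w6) w7
    have a2 := norm_add_le (w1 + w2 + w3 + w4 + w5) w6
    have a3 := norm_add_le (w1 + w2 + w3 + w4) w5
    have a4 := norm_add_le (w1 + w2 + w3) w4
    have a5 := norm_add_le (w1 + w2) w3
    have a6 := norm_add_le w1 w2
    linarith
  refine (key _ _ _ _ _ _ _ _).trans ?_
  simp only [add_div]
  linarith

theorem tsupport_thirdDeriv_subset (φ : V → ℝ) : tsupport (thirdDeriv φ) ⊆ tsupport φ :=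
  (tsupport_fderiv_subset ℝ).trans ((tsupport_fderiv_subset ℝ).trans (tsupport_fderiv_subset ℝ))

theorem continuous_thirdDeriv {φ : V → ℝ} (hφ : ContDiff ℝ ∞ φ) : Continuous (thirdDeriv φ) := by
  have h1 : ContDiff ℝ ∞ (fderiv ℝ φ) := hφ.fderiv_right (by simp)
  have h2 : ContDiff ℝ ∞ (fderiv ℝ (fderiv ℝ φ)) := h1.fderiv_right (by simp)
  exact h2.continuous_fderiv (by simp)

theorem tsupport_wave_subset (l : V →L[ℝ] ℝ) (N : ℝ) (k : ℕ) (χ : V → Y) :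
    tsupport (wave l N k χ) ⊆ tsupport χ :=
  closure_mono (Function.support_smul_subset_right _ _)

end Waves

/-! ### The Riemann–Lebesgue lemma along a ray of frequencies. -/

section RiemannLebesgue

variable {V : Type*} [NormedAddCommGroup V] [NormedSpace ℝ V] [FiniteDimensional ℝ V]
  [MeasurableSpace V] [BorelSpace V] (m : Measure V) [m.IsAddHaarMeasure]

theorem tendsto_integral_mul_cos {l : V →L[ℝ] ℝ} (hl : l ≠ 0) {f : V → ℝ} (hf : Integrable f m) :
    Tendsto (fun N : ℝ => ∫ p, f p * Real.cos (N * l p) ∂m) atTop (𝓝 0) := by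
  have h := tendsto_integral_exp_smul_cocompact (fun p => (f p : ℂ)) m
  -- `Real.fourierChar` has period `1`, hence the division by `2π`.
  have h1 : Tendsto (fun N : ℝ => (N * (2 * Real.pi)⁻¹) • l) atTop (cocompact (V →L[ℝ] ℝ)) := by
    rw [← Metric.cobounded_eq_cocompact, ← tendsto_norm_atTop_iff_cobounded]
    simp_rw [norm_smul]
    refine Tendsto.atTop_mul_const (norm_pos_iff.2 hl) ?_
    exact tendsto_norm_atTop_atTop.comp (tendsto_id.atTop_mul_const (by positivity))
  have h2 := (Complex.continuous_re.tendsto 0).comp (h.comp h1)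
  refine h2.congr fun N => ?_
  have hi : Integrable
      (fun v => Real.fourierChar (-((N * (2 * Real.pi)⁻¹) • l) v) • (f v : ℂ)) m := by
    refine (VectorFourier.fourierIntegral_convergent_iff (μ := m) Real.continuous_fourierChar
      (L := (topDualPairing ℝ V).flip) ?_ ((N * (2 * Real.pi)⁻¹) • l)).2 hf.ofReal
    exact isBoundedBilinearMap_apply.continuous.comp continuous_swap
  have h3 := (integral_re hi).symm
  simp only [Function.comp_def]
  refine Eq.trans h3 ?_
  refine integral_congr_ae (Eventually.of_forall fun v => ?_)
  simp only [Circle.smul_def, Real.fourierChar_apply, smul_eq_mul, RCLike.re_eq_complex_re,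
    Complex.re_mul_ofReal, Complex.exp_ofReal_mul_I_re]
  rw [mul_comm, ← Real.cos_neg]
  congr 2
  simp only [_root_.smul_apply, smul_eq_mul]
  field_simp

end RiemannLebesgue

/-! ### Lower bound for the `L²` norm of a localized wave. -/

section Mass

variable {V : Type} [NormedAddCommGroup V] [NormedSpace ℝ V] [FiniteDimensional ℝ V]
  [MeasurableSpace V] [BorelSpace V] {Y : Type} [NormedAddCommGroup Y] [NormedSpace ℝ Y]

/-- By `cos² = 1/2 + cos(2·)/2` and Riemann–Lebesgue, the squared oscillation has mean `1/2` in the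
limit. Another factor `1/2` pays for the error `C / N`, and a last one is slack for finite `N`. The
power of `1/2` is the volume ratio of the half ball, where the cutoff equals `1`. -/
theorem eventually_le_integral_wave (m : Measure V) [m.IsAddHaarMeasure] {l : V →L[ℝ] ℝ}
    (hl : l ≠ 0) {p₀ : V} {r : ℝ} (hr : 0 < r)
    {y : Y} (hy0 : y ≠ 0) {δ : ℝ → V → Y} (hcont : ∀ N, Continuous (δ N))
    {χ : ContDiffBump p₀} (hχI : χ.rIn = r / 2) (hχO : χ.rOut = r) {C : ℝ}
    (herr : ∀ N : ℝ, 1 ≤ N → ∀ p, ‖δ N p - (χ p * Real.cos (N * l p)) • y‖ ≤ C / N) :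
    ∀ᶠ N : ℝ in atTop, 1 / 8 * (1 / 2) ^ Module.finrank ℝ V * ‖y‖ ^ 2 *
        m.real (Metric.closedBall p₀ r) ≤ ∫ p in Metric.closedBall p₀ r, ‖δ N p‖ ^ 2 ∂m := by
  have hχ : ContDiff ℝ ∞ χ := χ.contDiff
  have hχs : HasCompactSupport χ := χ.hasCompactSupport
  have hχt : tsupport χ = Metric.closedBall p₀ r := by rw [χ.tsupport_eq, hχO]
  set B := Metric.closedBall p₀ r with hB
  have hCN : Tendsto (fun N : ℝ => C / N) atTop (𝓝 0) := tendsto_const_nhds.div_atTop tendsto_id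
  have hBfin : m B < ⊤ := measure_closedBall_lt_top
  have hχ0' : ∀ p, p ∉ B → χ p = 0 := fun p hp =>
    image_eq_zero_of_notMem_tsupport fun h => hp (hχt ▸ h)
  have hχi : Integrable (fun p => χ p ^ 2) m := by
    have hs : HasCompactSupport (fun p => χ p ^ 2) :=
      hχs.mono fun p hp h => hp (by simp [h])
    exact (hχ.continuous.pow 2).integrable_of_hasCompactSupport hs
  have hlow : (1 / 2) ^ Module.finrank ℝ V * m.real B ≤ ∫ p, χ p ^ 2 ∂m := by
    have h1 : m.real (Metric.closedBall p₀ (r / 2)) = (1 / 2) ^ Module.finrank ℝ V * m.real B := by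
      have h := Measure.addHaar_closedBall_mul_of_pos m p₀ (show (0:ℝ) < 1 / 2 by norm_num) r
      have h' : m (Metric.closedBall 0 r) = m B := (Measure.addHaar_closedBall_center m p₀ r).symm
      rw [h', show (1 / 2 : ℝ) * r = r / 2 by ring] at h
      rw [measureReal_def, h, ENNReal.toReal_mul, ENNReal.toReal_ofReal (by positivity)]
      rfl
    rw [← h1]
    have h2 : m.real (Metric.closedBall p₀ (r / 2))
        = ∫ p in Metric.closedBall p₀ (r / 2), χ p ^ 2 ∂m := by
      rw [setIntegral_congr_fun (g := fun _ => (1 : ℝ)) Metric.isClosed_closedBall.measurableSet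
        (fun p hp => ?_)]
      · simp
      · have : χ p = 1 := χ.one_of_mem_closedBall (hχI ▸ hp)
        simp [this]
    rw [h2]
    exact setIntegral_le_integral hχi (Eventually.of_forall fun p => by positivity)
  have hRL := (tendsto_integral_mul_cos m hl hχi).comp
    (tendsto_id.const_mul_atTop (show (0:ℝ) < 2 by norm_num))
  have hlim : Tendsto (fun N : ℝ => 1 / 4 * ‖y‖ ^ 2 * (∫ p, χ p ^ 2 ∂m) +
      (1 / 4 * ‖y‖ ^ 2 * (∫ p, χ p ^ 2 * Real.cos ((2 * N) * l p) ∂m)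
        - (C / N) ^ 2 * m.real B)) atTop (𝓝 (1 / 4 * ‖y‖ ^ 2 * (∫ p, χ p ^ 2 ∂m))) := by
    have h1 := (hRL.const_mul (1 / 4 * ‖y‖ ^ 2)).sub ((hCN.pow 2).mul_const (m.real B))
    simpa using h1.const_add (1 / 4 * ‖y‖ ^ 2 * (∫ p, χ p ^ 2 ∂m))
  have hBpos : 0 < m.real B :=
    ENNReal.toReal_pos (Metric.measure_closedBall_pos m p₀ hr).ne' hBfin.ne
  have hypos : 0 < ‖y‖ := norm_pos_iff.2 hy0
  have hlt : 1 / 8 * (1 / 2) ^ Module.finrank ℝ V * ‖y‖ ^ 2 * m.real B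
      < 1 / 4 * ‖y‖ ^ 2 * (∫ p, χ p ^ 2 ∂m) := by
    have h1 : 0 < (1 / 2 : ℝ) ^ Module.finrank ℝ V * m.real B := by positivity
    have h2 : 0 < ‖y‖ ^ 2 := by positivity
    nlinarith
  filter_upwards [eventually_ge_atTop 1, hlim.eventually_const_le hlt] with N hN hN'
  refine hN'.trans ?_
  have hi1 : Integrable (fun p => χ p ^ 2 * Real.cos ((2 * N) * l p)) m := by
    refine hχi.mul_bdd (c := 1) (by fun_prop) ?_
    exact Eventually.of_forall fun p => Real.abs_cos_le_one _
  have hset : ∀ f : V → ℝ, (∀ p, p ∉ B → f p = 0) → ∫ p in B, f p ∂m = ∫ p, f p ∂m :=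
    fun f hf => setIntegral_eq_integral_of_forall_compl_eq_zero hf
  rw [← hset (fun p => χ p ^ 2) (fun p hp => by simp [hχ0' p hp]),
    ← hset (fun p => χ p ^ 2 * Real.cos ((2 * N) * l p)) (fun p hp => by simp [hχ0' p hp])]
  have hc : (C / N) ^ 2 * m.real B = ∫ p in B, (C / N) ^ 2 ∂m := by
    rw [setIntegral_const, smul_eq_mul, mul_comm]
  rw [hc, ← integral_const_mul, ← integral_const_mul, ← integral_sub, ← integral_add]
  rotate_left
  · exact hχi.integrableOn.const_mul _
  · exact (hi1.integrableOn.const_mul _).sub (integrableOn_const hBfin.ne)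
  · exact hi1.integrableOn.const_mul _
  · exact integrableOn_const hBfin.ne
  refine integral_mono ?_ ?_ fun p => ?_
  · exact (hχi.integrableOn.const_mul _).add
      ((hi1.integrableOn.const_mul _).sub (integrableOn_const hBfin.ne))
  · exact ((hcont N).norm.pow 2).continuousOn.integrableOn_compact (isCompact_closedBall _ _)
  · have h1 := herr N hN p
    set a := χ p * Real.cos (N * l p) with ha
    have h2 : ‖a • y‖ ≤ ‖δ N p‖ + C / N := by
      have := norm_sub_le (δ N p) (δ N p - a • y)
      rw [sub_sub_cancel] at this
      linarith
    have h3 : ‖a • y‖ ^ 2 = a ^ 2 * ‖y‖ ^ 2 := by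
      rw [norm_smul, mul_pow, Real.norm_eq_abs, sq_abs]
    have h4 : a ^ 2 = χ p ^ 2 * (1 / 2 + Real.cos (2 * N * l p) / 2) := by
      rw [ha, mul_pow, mul_assoc 2 N, Real.cos_sq]
    have h5 : ‖a • y‖ ^ 2 ≤ 2 * ‖δ N p‖ ^ 2 + 2 * (C / N) ^ 2 := by
      have := pow_le_pow_left₀ (norm_nonneg _) h2 2
      nlinarith [sq_nonneg (‖δ N p‖ - C / N)]
    rw [h3, h4] at h5
    simp only
    nlinarith

end Mass

/-! ### Exact localized solutions of the linear constraints. -/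

section LocalizedWaves

set_option maxSynthPendingDepth 5
set_option linter.unusedSectionVars false

variable {V : Type} [NormedAddCommGroup V] [NormedSpace ℝ V] [FiniteDimensional ℝ V]
  [MeasurableSpace V] [BorelSpace V] (m : Measure V) [m.IsAddHaarMeasure]
  {Y : Type} [NormedAddCommGroup Y] [NormedSpace ℝ Y] [FiniteDimensional ℝ Y]

/-- A direction of oscillation that is compatible with the linear constraints
`∫ G p (δ p) = 0`, `G ∈ 𝒯`: it is the symbol, at a nonzero covector, of a homogeneous third order
operator whose values on test functions satisfy the constraints. -/
def IsWaveDirection {Z : Type} [AddCommGroup Z] [Module ℝ Z] [TopologicalSpace Z]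
    (𝒯 : Set (V → Z →L[ℝ] ℝ)) (y : Z) : Prop :=
  ∃ l : V →L[ℝ] ℝ, l ≠ 0 ∧ ∃ A : (V →L[ℝ] V →L[ℝ] V →L[ℝ] ℝ) →ₗ[ℝ] Z, A (cube l) = y ∧
    ∀ φ : V → ℝ, ContDiff ℝ ∞ φ → HasCompactSupport φ → ∀ G ∈ 𝒯,
      ∫ p, G p (A (thirdDeriv φ p)) ∂m = 0

variable {m}

theorem IsWaveDirection.smul {𝒯 : Set (V → Y →L[ℝ] ℝ)} {y : Y} (h : IsWaveDirection m 𝒯 y)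
    (c : ℝ) : IsWaveDirection m 𝒯 (c • y) := by
  obtain ⟨l, hl, A, hA, h⟩ := h
  refine ⟨l, hl, c • A, by simp [hA], fun φ hφ hs G hG => ?_⟩
  simp only [LinearMap.smul_apply, map_smul, smul_eq_mul, integral_const_mul, h φ hφ hs G hG,
    mul_zero]

/-- The wave is the potential operator applied to a cut-off scalar plane wave. The cutoff therefore
costs only an error of order `1 / N` in the values, and none in the linear constraints. Testing with
integrable fields gives small numbers by Riemann–Lebesgue. -/
theorem exists_localized_wave {𝒯 : Set (V → Y →L[ℝ] ℝ)} {y : Y} (hy : IsWaveDirection m 𝒯 y)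
    (p₀ : V) {r : ℝ} (hr : 0 < r) (F : Finset (V → Y →L[ℝ] ℝ)) (hF : ∀ g ∈ F, Integrable g m)
    {ε : ℝ} (hε : 0 < ε) :
    ∃ δ : V → Y, Continuous δ ∧ tsupport δ ⊆ Metric.closedBall p₀ r ∧
      (∀ G ∈ 𝒯, ∫ p, G p (δ p) ∂m = 0) ∧ (∀ p, ∃ s : ℝ, |s| ≤ 1 ∧ ‖δ p - s • y‖ ≤ ε) ∧
      (∀ g ∈ F, |∫ p, g p (δ p) ∂m| ≤ ε) ∧
      1 / 8 * (1 / 2) ^ Module.finrank ℝ V * ‖y‖ ^ 2 * m.real (Metric.closedBall p₀ r)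
        ≤ ∫ p in Metric.closedBall p₀ r, ‖δ p‖ ^ 2 ∂m := by
  by_cases hy0 : y = 0
  · refine ⟨0, continuous_const, by simp [tsupport], by simp, fun p =>
      ⟨0, by simp, by simp [hε.le]⟩, ?_, ?_⟩
    · simp [hε.le]
    · simp [hy0]
  obtain ⟨l, hl, A₀, hA₀, hT₀⟩ := hy
  set A := LinearMap.toContinuousLinearMap A₀ with hAdef
  have hA : A (cube l) = y := hA₀
  have hT : ∀ φ : V → ℝ, ContDiff ℝ ∞ φ → HasCompactSupport φ → ∀ G ∈ 𝒯,
      ∫ p, G p (A (thirdDeriv φ p)) ∂m = 0 := hT₀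
  let χ : ContDiffBump p₀ := ⟨r / 2, r, by positivity, by linarith⟩
  have hχ : ContDiff ℝ ∞ χ := χ.contDiff
  have hχs : HasCompactSupport χ := χ.hasCompactSupport
  have hχt : tsupport χ = Metric.closedBall p₀ r := χ.tsupport_eq
  have hχ0 : ∀ p, 0 ≤ χ p := fun p => χ.nonneg
  have hχ1 : ∀ p, χ p ≤ 1 := fun p => χ.le_one
  obtain ⟨C₀, hC₀⟩ := thirdDeriv_wave_approx l hχ hχs
  set B := Metric.closedBall p₀ r with hB
  set δ : ℝ → V → Y := fun N p => A (thirdDeriv (wave l N 3 χ) p) with hδ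
  have hsupp : ∀ N, tsupport (δ N) ⊆ B := fun N => by
    rw [← hχt]
    refine subset_trans ?_ ((tsupport_thirdDeriv_subset _).trans (tsupport_wave_subset l N 3 χ))
    exact closure_mono (Function.support_comp_subset (map_zero A) _)
  have hcont : ∀ N, Continuous (δ N) := fun N =>
    A.continuous.comp (continuous_thirdDeriv (contDiff_wave l N 3 hχ))
  set C := ‖A‖ * C₀ with hCdef
  have herr : ∀ N : ℝ, 1 ≤ N → ∀ p, ‖δ N p - (χ p * Real.cos (N * l p)) • y‖ ≤ C / N := by
    intro N hN p
    rw [← hA, ← map_smul, ← map_sub, hCdef, mul_div_assoc]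
    exact (A.le_opNorm _).trans (mul_le_mul_of_nonneg_left (hC₀ N hN p) (norm_nonneg _))
  have hCN : Tendsto (fun N : ℝ => C / N) atTop (𝓝 0) := tendsto_const_nhds.div_atTop tendsto_id
  have hBfin : m B < ⊤ := measure_closedBall_lt_top
  have hδ0 : ∀ N p, p ∉ B → δ N p = 0 := fun N p hp =>
    image_eq_zero_of_notMem_tsupport fun h => hp (hsupp N h)
  have hχ0' : ∀ p, p ∉ B → χ p = 0 := fun p hp =>
    image_eq_zero_of_notMem_tsupport fun h => hp (hχt ▸ h)
  have e1 : ∀ᶠ N : ℝ in atTop, ∀ p, ∃ s : ℝ, |s| ≤ 1 ∧ ‖δ N p - s • y‖ ≤ ε := by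
    filter_upwards [eventually_ge_atTop 1, hCN.eventually_le_const hε] with N hN hN' p
    refine ⟨_, ?_, (herr N hN p).trans hN'⟩
    rw [abs_mul, abs_of_nonneg (hχ0 p)]
    exact mul_le_one₀ (hχ1 p) (abs_nonneg _) (Real.abs_cos_le_one _)
  have e2 : ∀ g ∈ F, ∀ᶠ N : ℝ in atTop, |∫ p, g p (δ N p) ∂m| ≤ ε := by
    intro g hg
    have hgi := hF g hg
    have hgy : Integrable (fun p => χ p * g p y) m := by
      refine (hgi.apply_continuousLinearMap y).bdd_mul
          (c := 1) hχ.continuous.aestronglyMeasurable ?_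
      exact Eventually.of_forall fun p => by rw [Real.norm_of_nonneg (hχ0 p)]; exact hχ1 p
    have hRL := tendsto_integral_mul_cos m hl hgy
    have hlim : Tendsto (fun N : ℝ => |∫ p, χ p * g p y * Real.cos (N * l p) ∂m|
        + C / N * ∫ p, ‖g p‖ ∂m) atTop (𝓝 0) := by
      simpa using hRL.abs.add (hCN.mul_const (∫ p, ‖g p‖ ∂m))
    filter_upwards [eventually_ge_atTop 1, hlim.eventually_le_const hε] with N hN hN'
    refine le_trans ?_ hN'
    have hi1 : Integrable (fun p => χ p * g p y * Real.cos (N * l p)) m := by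
      refine hgy.mul_bdd (c := 1) (by fun_prop) ?_
      exact Eventually.of_forall fun p => Real.abs_cos_le_one _
    have hgm : AEStronglyMeasurable (fun p => g p (δ N p - (χ p * Real.cos (N * l p)) • y)) m := by
      refine isBoundedBilinearMap_apply.continuous.comp_aestronglyMeasurable
        (hgi.1.prodMk (Continuous.aestronglyMeasurable ?_))
      exact (hcont N).sub (Continuous.smul (by fun_prop) continuous_const)
    have hi2 : Integrable (fun p => g p (δ N p - (χ p * Real.cos (N * l p)) • y)) m := by
      refine (hgi.norm.const_mul (C / N)).mono' hgm (Eventually.of_forall fun p => ?_)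
      refine ((g p).le_opNorm _).trans ?_
      rw [mul_comm]
      exact mul_le_mul_of_nonneg_right (herr N hN p) (norm_nonneg _)
    have : ∫ p, g p (δ N p) ∂m = ∫ p, χ p * g p y * Real.cos (N * l p) ∂m
        + ∫ p, g p (δ N p - (χ p * Real.cos (N * l p)) • y) ∂m := by
      rw [← integral_add hi1 hi2]
      congr 1 with p
      simp only [map_sub, map_smul, smul_eq_mul]
      ring
    rw [this]
    refine (abs_add_le _ _).trans (add_le_add le_rfl ?_)
    rw [← integral_const_mul, ← Real.norm_eq_abs]
    refine norm_integral_le_of_norm_le (hgi.norm.const_mul _) (Eventually.of_forall fun p => ?_)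
    refine ((g p).le_opNorm _).trans ?_
    rw [mul_comm]
    exact mul_le_mul_of_nonneg_right (herr N hN p) (norm_nonneg _)
  have e3 := eventually_le_integral_wave m hl hr hy0 hcont (χ := χ) rfl rfl herr
  obtain ⟨N, h1, h2, h3⟩ := (e1.and ((F.eventually_all.2 e2).and e3)).exists
  exact ⟨δ N, hcont N, hsupp N, fun G hG => hT _ (contDiff_wave l N 3 hχ)
    (hχs.mono' ((subset_tsupport _).trans (tsupport_wave_subset l N 3 χ))) G hG, h1, h2, h3⟩

end LocalizedWaves

/-! ### Perturbing a strict subsolution towards the constraint set. -/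

section Perturbation

set_option linter.unusedSectionVars false

variable {V : Type} [NormedAddCommGroup V] [NormedSpace ℝ V] [FiniteDimensional ℝ V]
  [MeasurableSpace V] [BorelSpace V] {m : Measure V} [m.IsAddHaarMeasure]
  {Y : Type} [NormedAddCommGroup Y] [NormedSpace ℝ Y] [FiniteDimensional ℝ Y]

/-- Compactly supported continuous perturbations of `z` on `U` that satisfy the linear constraints
and keep the state, in the coordinates `Θ`, in the interior of the convex hull of `K`. -/
structure IsAdmissible (m : Measure V) (𝒯 : Set (V → Y →L[ℝ] ℝ)) (U : Set V) (Θ : V → Y →L[ℝ] Y)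
    (K : Set Y) (z δ : V → Y) : Prop where
  cont : Continuous δ
  compact : HasCompactSupport δ
  supp : tsupport δ ⊆ U
  orth : ∀ G ∈ 𝒯, ∫ p, G p (δ p) ∂m = 0
  mem : ∀ p ∈ U, Θ p (z p + δ p) ∈ interior (convexHull ℝ K)

/-- The data of a convex integration problem: an open set `U`, pointwise linear coordinates `Θ` in
which the constraint set is the fixed compact set `K`, differences of points of which are
directions of oscillation, and a continuous strict subsolution `z`. -/
structure IsConvexIntegrationProblem (m : Measure V) (𝒯 : Set (V → Y →L[ℝ] ℝ)) (U : Set V)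
    (Θ Θi : V → Y →L[ℝ] Y) (C : ℝ) (K : Set Y) (z : V → Y) : Prop where
  isOpen : IsOpen U
  isBounded : Bornology.IsBounded U
  left_inv : ∀ p y, Θi p (Θ p y) = y
  right_inv : ∀ p y, Θ p (Θi p y) = y
  cont_coord : ContinuousOn Θ U
  norm_le : ∀ p ∈ U, ‖Θ p‖ ≤ C
  norm_inv_le : ∀ p ∈ U, ‖Θi p‖ ≤ C
  compact : IsCompact K
  disj : Disjoint K (interior (convexHull ℝ K))
  cont_test : ∀ G ∈ 𝒯, Continuous G
  wave : ∀ p ∈ U, ∀ a ∈ K, ∀ b ∈ K, IsWaveDirection m 𝒯 (Θi p (a - b))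
  cont : ContinuousOn z U
  mem : ∀ p ∈ U, Θ p (z p) ∈ interior (convexHull ℝ K)

variable {𝒯 : Set (V → Y →L[ℝ] ℝ)} {U : Set V} {Θ Θi : V → Y →L[ℝ] Y} {C : ℝ} {K : Set Y}
  {z δ : V → Y}

/-- The long segment at `p₀` is compact and lies in an open set. By continuity, a tube of radius `η`
around it remains admissible at all points near `p₀`, in the coordinates belonging to those points.
-/
theorem IsConvexIntegrationProblem.exists_local_direction
    (h : IsConvexIntegrationProblem m 𝒯 U Θ Θi C K z) (hδ : IsAdmissible m 𝒯 U Θ K z δ)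
    {p₀ : V} (hp₀ : p₀ ∈ U) :
    ∃ (y : Y) (η R : ℝ), IsWaveDirection m 𝒯 y ∧
      Metric.infDist (Θ p₀ (z p₀ + δ p₀)) K ≤ 2 * (Module.finrank ℝ Y + 1) * (C * ‖y‖) ∧
      0 < η ∧ 0 < R ∧ ∀ p ∈ Metric.closedBall p₀ R, p ∈ U ∧
        Metric.infDist (Θ p (z p + δ p)) K ≤ 2 * Metric.infDist (Θ p₀ (z p₀ + δ p₀)) K ∧
        ∀ s : ℝ, |s| ≤ 1 → ∀ e : Y, ‖e‖ ≤ η →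
          Θ p (z p + δ p + (s • y + e)) ∈ interior (convexHull ℝ K) := by
  set ζ := Θ p₀ (z p₀ + δ p₀) with hζ
  have hmem := hδ.mem p₀ hp₀
  obtain ⟨a, ha, b, hb, t, hseg, hdist⟩ := exists_long_segment hmem
  set y := Θi p₀ (t • (a - b)) with hy
  have hΘy : Θ p₀ y = t • (a - b) := h.right_inv _ _
  -- Strict positivity turns continuity of the distance into the bound by twice its value at `p₀`;
  -- it comes from `K` missing the interior of its hull.
  have hpos : 0 < Metric.infDist ζ K := by
    rw [← (h.compact.isClosed.notMem_iff_infDist_pos ⟨a, ha⟩)]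
    exact fun hK => h.disj.ne_of_mem hK hmem rfl
  have hΘc : ContinuousAt Θ p₀ := h.cont_coord.continuousAt (h.isOpen.mem_nhds hp₀)
  have hzc : ContinuousAt (fun p => z p + δ p) p₀ :=
    (h.cont.continuousAt (h.isOpen.mem_nhds hp₀)).add hδ.cont.continuousAt
  have hev : ∀ᶠ x : V × Y in 𝓝 (p₀, 0), ∀ s ∈ Icc (-1 : ℝ) 1,
      Θ x.1 (z x.1 + δ x.1 + (s • y + x.2)) ∈ interior (convexHull ℝ K) := by
    refine isCompact_Icc.eventually_forall_of_forall_eventually fun s hs => ?_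
    have hc : ContinuousAt (fun q : (V × Y) × ℝ => Θ q.1.1 (z q.1.1 + δ q.1.1 + (q.2 • y + q.1.2)))
        ((p₀, 0), s) := by
      have h1 : ContinuousAt (fun q : (V × Y) × ℝ => q.1.1) ((p₀, 0), s) := by fun_prop
      have h2 : ContinuousAt (fun q : (V × Y) × ℝ => Θ q.1.1) ((p₀, 0), s) :=
        ContinuousAt.comp (f := fun q : (V × Y) × ℝ => q.1.1) (x := ((p₀, 0), s)) hΘc h1
      have h3 : ContinuousAt (fun q : (V × Y) × ℝ => z q.1.1 + δ q.1.1) ((p₀, 0), s) :=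
        ContinuousAt.comp (f := fun q : (V × Y) × ℝ => q.1.1) (x := ((p₀, 0), s)) hzc h1
      exact h2.clm_apply (h3.add (by fun_prop))
    refine hc.eventually_mem (isOpen_interior.mem_nhds ?_)
    have := hseg s (abs_le.2 hs)
    simp only [add_zero]
    rwa [map_add, map_smul, hΘy]
  have hev2 : ∀ᶠ p in 𝓝 p₀, Metric.infDist (Θ p (z p + δ p)) K < 2 * Metric.infDist ζ K := by
    have hc : ContinuousAt (fun p => Metric.infDist (Θ p (z p + δ p)) K) p₀ :=
      (Metric.continuous_infDist_pt K).continuousAt.comp (hΘc.clm_apply hzc)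
    exact hc.eventually_lt_const (show Metric.infDist ζ K < 2 * Metric.infDist ζ K by linarith)
  rw [nhds_prod_eq, eventually_prod_iff] at hev
  obtain ⟨P, hP, Q, hQ, hPQ⟩ := hev
  obtain ⟨R, hR, hRs⟩ := Metric.nhds_basis_closedBall.eventually_iff.1
    ((hP.and hev2).and (h.isOpen.eventually_mem hp₀))
  obtain ⟨η, hη, hηs⟩ := Metric.nhds_basis_closedBall.eventually_iff.1 hQ
  refine ⟨y, η, R, ?_, ?_, hη, hR, fun p hp => ⟨(hRs hp).2, (hRs hp).1.2.le, fun s hs e he => ?_⟩⟩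
  · rw [hy, map_smul]
    exact (h.wave p₀ hp₀ a ha b hb).smul t
  · rw [← hΘy] at hdist
    refine hdist.trans (mul_le_mul_of_nonneg_left ?_ (by positivity))
    exact ((Θ p₀).le_opNorm y).trans (mul_le_mul_of_nonneg_right (h.norm_le p₀ hp₀) (norm_nonneg _))
  · exact hPQ (hRs hp).1.1 (hηs (by simpa using he)) s (abs_le.1 hs)

theorem IsConvexIntegrationProblem.integrableOn_infDist_sq
    (h : IsConvexIntegrationProblem m 𝒯 U Θ Θi C K z) (hδ : IsAdmissible m 𝒯 U Θ K z δ) :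
    IntegrableOn (fun p => Metric.infDist (Θ p (z p + δ p)) K ^ 2) U m := by
  rcases U.eq_empty_or_nonempty with rfl | ⟨p₀, hp₀⟩
  · simp
  have hne : K.Nonempty := convexHull_nonempty_iff.1 ⟨_, interior_subset (hδ.mem p₀ hp₀)⟩
  obtain ⟨k, hk⟩ := hne
  have hb : Bornology.IsBounded (convexHull ℝ K) := isBounded_convexHull.2 h.compact.isBounded
  have hc : ContinuousOn (fun p => Metric.infDist (Θ p (z p + δ p)) K ^ 2) U :=
    ((Metric.continuous_infDist_pt K).comp_continuousOn
      (h.cont_coord.clm_apply (h.cont.add hδ.cont.continuousOn))).pow 2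
  refine (integrableOn_const (C := Metric.diam (convexHull ℝ K) ^ 2)
    h.isBounded.measure_lt_top.ne).mono' (hc.aestronglyMeasurable h.isOpen.measurableSet) ?_
  refine (ae_restrict_iff' h.isOpen.measurableSet).2 (Eventually.of_forall fun p hp => ?_)
  rw [Real.norm_of_nonneg (by positivity)]
  refine pow_le_pow_left₀ Metric.infDist_nonneg ?_ 2
  exact (Metric.infDist_le_dist_of_mem hk).trans (Metric.dist_le_diam_of_mem hb
    (interior_subset (hδ.mem p hp)) (subset_convexHull ℝ K hk))

/-- Disjoint small balls cover almost all of `U`, and each carries one wave along its local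
direction. Disjointness keeps the state in the hull and makes the squared norms add up. In the
constant, `64 = 2 * 4 * 8`: half of the distance integral is dropped, the distance varies by a
factor `2` on a ball, and the wave keeps an eighth of `‖y‖ ^ 2` up to the volume ratio. -/
theorem IsConvexIntegrationProblem.exists_perturbation
    (h : IsConvexIntegrationProblem m 𝒯 U Θ Θi C K z) (hδ : IsAdmissible m 𝒯 U Θ K z δ)
    (F : Finset (V → Y →L[ℝ] ℝ)) (hF : ∀ g ∈ F, Integrable g m) {ε : ℝ} (hε : 0 < ε) :
    ∃ δ' : V → Y, IsAdmissible m 𝒯 U Θ K z δ' ∧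
      (∀ g ∈ F, |∫ p, g p (δ' p - δ p) ∂m| ≤ ε) ∧
      ∫ p in U, Metric.infDist (Θ p (z p + δ p)) K ^ 2 ∂m ≤
        64 * 2 ^ Module.finrank ℝ V * (2 * (Module.finrank ℝ Y + 1) * C) ^ 2 *
          ∫ p in U, ‖δ' p - δ p‖ ^ 2 ∂m := by
  classical
  set ρ : V → ℝ := fun p => Metric.infDist (Θ p (z p + δ p)) K with hρ
  have hρ0 : ∀ p, 0 ≤ ρ p := fun p => Metric.infDist_nonneg
  by_cases hD : ∫ p in U, ρ p ^ 2 ∂m ≤ 0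
  · refine ⟨δ, hδ, fun g _ => by simp [hε.le], hD.trans ?_⟩
    simp
  push Not at hD
  set c := 2 * ((Module.finrank ℝ Y : ℝ) + 1) with hc
  have hloc : ∀ p₀, ∃ (y : Y) (η R : ℝ), p₀ ∈ U → IsWaveDirection m 𝒯 y ∧
      ρ p₀ ≤ c * (C * ‖y‖) ∧ 0 < η ∧ 0 < R ∧ ∀ p ∈ Metric.closedBall p₀ R, p ∈ U ∧
        ρ p ≤ 2 * ρ p₀ ∧ ∀ s : ℝ, |s| ≤ 1 → ∀ e : Y, ‖e‖ ≤ η →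
          Θ p (z p + δ p + (s • y + e)) ∈ interior (convexHull ℝ K) := by
    intro p₀
    by_cases hp₀ : p₀ ∈ U
    · obtain ⟨y, η, R, H⟩ := h.exists_local_direction hδ hp₀
      exact ⟨y, η, R, fun _ => H⟩
    · exact ⟨0, 0, 0, fun hp => absurd hp hp₀⟩
  choose y η R hloc using hloc
  obtain ⟨t, r, htc, htU, htr, hcov, hdisj⟩ :=
    Besicovitch.exists_disjoint_closedBall_covering_ae m (fun _ => univ) U
      (fun x _ δ hδ => ⟨δ / 2, mem_univ _, by constructor <;> linarith⟩) R
      (fun x hx => (hloc x hx).2.2.2.1)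
  set B : V → Set V := fun x => Metric.closedBall x (r x) with hB
  have hBR : ∀ x ∈ t, ∀ p ∈ B x, p ∈ Metric.closedBall x (R x) := fun x hx p hp =>
    Metric.closedBall_subset_closedBall (htr x hx).2.2.le hp
  have hBU : ∀ x ∈ t, B x ⊆ U := fun x hx p hp => ((hloc x (htU hx)).2.2.2.2 p (hBR x hx p hp)).1
  have hBm : ∀ x, MeasurableSet (B x) := fun x => Metric.isClosed_closedBall.measurableSet
  have hρi := h.integrableOn_infDist_sq hδ
  have hsub : (⋃ x : t, B x) ⊆ U := iUnion_subset fun x => hBU x x.2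
  have hint : ∫ p in U, ρ p ^ 2 ∂m = ∫ p in ⋃ x : t, B x, ρ p ^ 2 ∂m := by
    refine (setIntegral_congr_set ?_).symm
    refine LE.le.eventuallyLE hsub |>.antisymm ?_
    rw [ae_le_set, iUnion_subtype]
    exact hcov
  have : Countable t := htc.to_subtype
  have hsum := hasSum_integral_iUnion (μ := m) (f := fun p => ρ p ^ 2) (s := fun x : t => B x)
    (fun x => hBm x) (fun x x' hx => hdisj x.2 x'.2 (fun e => hx (Subtype.ext e)))
    (hρi.mono_set hsub)
  rw [← hint] at hsum
  -- Finitely many balls already carry half of the integral, so that a finite sum of waves, still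
  -- continuous with compact support, is enough.
  obtain ⟨s, hs⟩ := (hsum.eventually (eventually_gt_nhds (half_lt_self hD))).exists
  have hwave : ∀ x : t, ∃ d : V → Y, Continuous d ∧ tsupport d ⊆ B x ∧
      (∀ G ∈ 𝒯, ∫ p, G p (d p) ∂m = 0) ∧
      (∀ p, ∃ a : ℝ, |a| ≤ 1 ∧ ‖d p - a • y x‖ ≤ η x) ∧
      (∀ g ∈ F, |∫ p, g p (d p) ∂m| ≤ ε / (s.card + 1)) ∧
      1 / 8 * (1 / 2) ^ Module.finrank ℝ V * ‖y x‖ ^ 2 * m.real (B x)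
        ≤ ∫ p in B x, ‖d p‖ ^ 2 ∂m := by
    intro x
    obtain ⟨hw, -, hη, -, -⟩ := hloc x (htU x.2)
    have hε' : 0 < ε / (s.card + 1) := by positivity
    obtain ⟨d, h1, h2, h3, h4, h5, h6⟩ := exists_localized_wave hw x (htr x x.2).2.1 F hF
      (lt_min hη hε')
    exact ⟨d, h1, h2, h3, fun p => (h4 p).imp fun a ha => ⟨ha.1, ha.2.trans (min_le_left _ _)⟩,
      fun g hg => (h5 g hg).trans (min_le_right _ _), h6⟩
  choose d hdc hds hdo hdp hdw hdm using hwave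
  have hd0 : ∀ (x : t) p, p ∉ B x → d x p = 0 := fun x p hp =>
    image_eq_zero_of_notMem_tsupport fun h' => hp (hds x h')
  have hdcs : ∀ x : t, HasCompactSupport (d x) := fun x =>
    HasCompactSupport.of_support_subset_isCompact (isCompact_closedBall (x : V) (r x))
      ((subset_tsupport _).trans (hds x))
  set Δ : V → Y := fun p => ∑ x ∈ s, d x p with hΔ
  have hΔB : ∀ x ∈ s, ∀ p ∈ B x, Δ p = d x p := by
    intro x hx p hp
    refine Finset.sum_eq_single_of_mem x hx fun x' _ hne => hd0 x' p fun hp' => ?_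
    exact disjoint_left.1 (hdisj x'.2 x.2 (fun e => hne (Subtype.ext e))) hp' hp
  have hΔ0 : ∀ p, (∀ x ∈ s, p ∉ B x) → Δ p = 0 := fun p hp =>
    Finset.sum_eq_zero fun x hx => hd0 x p (hp x hx)
  have hΔc : Continuous Δ := continuous_finsetSum _ fun x _ => hdc x
  have hΔs : tsupport Δ ⊆ ⋃ x ∈ s, B x := by
    refine closure_minimal (fun p hp => ?_)
      (s.finite_toSet.isClosed_biUnion fun x _ => Metric.isClosed_closedBall)
    by_contra hcon
    simp only [mem_iUnion, not_exists] at hcon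
    exact hp (hΔ0 p hcon)
  have hΔcs : HasCompactSupport Δ :=
    (s.finite_toSet.isCompact_biUnion fun (x : t) _ => isCompact_closedBall (x : V)
        (r x)).of_isClosed_subset
      (isClosed_tsupport _) hΔs
  have hsB : (⋃ x ∈ s, B x) ⊆ U := iUnion₂_subset fun x _ => hBU x x.2
  have hgd : ∀ (g : V → Y →L[ℝ] ℝ), LocallyIntegrable g m → ∀ f : V → Y, Continuous f →
      HasCompactSupport f → Integrable (fun p => g p (f p)) m := by
    intro g hg f hf hfs
    obtain ⟨M, hM⟩ := hf.bounded_above_of_compact_support hfs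
    have h1 : IntegrableOn g (tsupport f) m := hg.integrableOn_isCompact hfs
    have h2 : IntegrableOn (fun p => g p (f p)) (tsupport f) m := by
      refine (h1.norm.mul_const M).mono'
        (isBoundedBilinearMap_apply.continuous.comp_aestronglyMeasurable
          (h1.1.prodMk hf.aestronglyMeasurable)) (Eventually.of_forall fun p => ?_)
      exact ((g p).le_opNorm _).trans (mul_le_mul_of_nonneg_left (hM p) (norm_nonneg _))
    refine (integrableOn_iff_integrable_of_support_subset fun p hp => ?_).1 h2
    by_contra hcon
    exact hp (by simp [image_eq_zero_of_notMem_tsupport hcon])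
  have hgΔ : ∀ g : V → Y →L[ℝ] ℝ, LocallyIntegrable g m →
      ∫ p, g p (Δ p) ∂m = ∑ x ∈ s, ∫ p, g p (d x p) ∂m := by
    intro g hg
    rw [← integral_finsetSum _ fun x _ => hgd g hg _ (hdc x) (hdcs x)]
    simp only [hΔ, map_sum]
  refine ⟨fun p => δ p + Δ p, ⟨hδ.cont.add hΔc, hδ.compact.add hΔcs, ?_, fun G hG => ?_,
    fun p hp => ?_⟩, fun g hg => ?_, ?_⟩
  · exact (tsupport_add δ Δ).trans (union_subset hδ.supp (hΔs.trans hsB))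
  · have hGl := (h.cont_test G hG).locallyIntegrable (μ := m)
    simp only [map_add]
    rw [integral_add (hgd G hGl _ hδ.cont hδ.compact) (hgd G hGl _ hΔc hΔcs), hδ.orth G hG,
      hgΔ G hGl, Finset.sum_eq_zero fun x _ => hdo x G hG, add_zero]
  · rw [← add_assoc]
    by_cases hps : ∃ x ∈ s, p ∈ B x
    · obtain ⟨x, hx, hpx⟩ := hps
      obtain ⟨a, ha, ha'⟩ := hdp x p
      have := ((hloc x (htU x.2)).2.2.2.2 p (hBR x x.2 p hpx)).2.2 a ha _ ha'
      rw [hΔB x hx p hpx]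
      simpa using this
    · rw [hΔ0 p (fun x hx hpx => hps ⟨x, hx, hpx⟩), add_zero]
      exact hδ.mem p hp
  · simp only [add_sub_cancel_left]
    rw [hgΔ g (hF g hg).locallyIntegrable]
    refine (Finset.abs_sum_le_sum_abs _ _).trans ?_
    refine (Finset.sum_le_card_nsmul _ _ _ fun x _ => hdw x g hg).trans ?_
    rw [nsmul_eq_mul, mul_div_assoc', div_le_iff₀ (by positivity)]
    nlinarith
  · simp only [add_sub_cancel_left]
    have h1 : ∑ x ∈ s, ∫ p in B x, ‖d x p‖ ^ 2 ∂m ≤ ∫ p in U, ‖Δ p‖ ^ 2 ∂m := by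
      have hΔi : Integrable (fun p => ‖Δ p‖ ^ 2) m :=
        (hΔc.norm.pow 2).integrable_of_hasCompactSupport
          (hΔcs.mono fun p hp h => hp (by simp [h]))
      have e1 : ∑ x ∈ s, ∫ p in B x, ‖d x p‖ ^ 2 ∂m = ∫ p in ⋃ x ∈ s, B x, ‖Δ p‖ ^ 2 ∂m := by
        rw [integral_biUnion_finset s (fun x _ => hBm x)
          (fun x _ x' _ hx => hdisj x.2 x'.2 (fun e => hx (Subtype.ext e)))
          (fun x _ => hΔi.integrableOn)]
        refine Finset.sum_congr rfl fun x hx => setIntegral_congr_fun (hBm x) fun p hp => ?_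
        simp only [hΔB x hx p hp]
      rw [e1]
      exact setIntegral_mono_set hΔi.integrableOn (Eventually.of_forall fun p => by positivity)
        hsB.eventuallyLE
    have h2 : ∀ x ∈ s, ∫ p in B x, ρ p ^ 2 ∂m ≤
        32 * 2 ^ Module.finrank ℝ V * (c * C) ^ 2 * ∫ p in B x, ‖d x p‖ ^ 2 ∂m := by
      intro x hx
      obtain ⟨-, hx1, -, -, hx2⟩ := hloc x (htU x.2)
      have h3 : ∫ p in B x, ρ p ^ 2 ∂m ≤ ∫ p in B x, (2 * (c * (C * ‖y x‖))) ^ 2 ∂m := by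
        refine setIntegral_mono_on (hρi.mono_set (hBU x x.2))
          (integrableOn_const measure_closedBall_lt_top.ne) (hBm x) fun p hp => ?_
        refine pow_le_pow_left₀ (hρ0 p) ?_ 2
        exact (hx2 p (hBR x x.2 p hp)).2.1.trans (mul_le_mul_of_nonneg_left hx1 (by norm_num))
      rw [setIntegral_const, smul_eq_mul] at h3
      refine h3.trans ?_
      have h4 := mul_le_mul_of_nonneg_left (hdm x)
        (show 0 ≤ 32 * 2 ^ Module.finrank ℝ V * (c * C) ^ 2 by positivity)
      refine le_trans (le_of_eq ?_) h4
      have h5 : (2 : ℝ) ^ Module.finrank ℝ V * (1 / 2) ^ Module.finrank ℝ V = 1 := by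
        rw [← mul_pow]; norm_num
      linear_combination (-(4 * (c * C) ^ 2 * ‖y x‖ ^ 2 * m.real (B x))) * h5
    have h3 := Finset.sum_le_sum h2
    rw [← Finset.mul_sum] at h3
    have h4 := mul_le_mul_of_nonneg_left h1
      (show 0 ≤ 32 * 2 ^ Module.finrank ℝ V * (c * C) ^ 2 by positivity)
    linarith

end Perturbation

/-! ### Exact solutions as strong limits of admissible perturbations. -/

section Solutions

set_option linter.unusedSectionVars false

variable {V : Type} [NormedAddCommGroup V] [NormedSpace ℝ V] [FiniteDimensional ℝ V]
  [MeasurableSpace V] [BorelSpace V] {m : Measure V} [m.IsAddHaarMeasure]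
  {Y : Type} [NormedAddCommGroup Y] [InnerProductSpace ℝ Y] [FiniteDimensional ℝ Y]
  {𝒯 : Set (V → Y →L[ℝ] ℝ)} {U : Set V} {Θ Θi : V → Y →L[ℝ] Y} {C : ℝ} {K : Set Y}
  {z δ : V → Y}

theorem IsConvexIntegrationProblem.isAdmissible_zero
    (h : IsConvexIntegrationProblem m 𝒯 U Θ Θi C K z) : IsAdmissible m 𝒯 U Θ K z 0 :=
  ⟨continuous_const, HasCompactSupport.zero, by simp [tsupport], by simp,
    fun p hp => by simpa using h.mem p hp⟩

theorem IsConvexIntegrationProblem.exists_bound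
    (h : IsConvexIntegrationProblem m 𝒯 U Θ Θi C K z) :
    ∃ M, ∀ δ, IsAdmissible m 𝒯 U Θ K z δ → ∀ p ∈ U, ‖z p + δ p‖ ≤ M := by
  obtain ⟨M, hM⟩ := (isBounded_convexHull.2 h.compact.isBounded).exists_norm_le
      (s := convexHull ℝ K)
  refine ⟨C * M, fun δ hδ p hp => ?_⟩
  have h1 := hM _ (interior_subset (hδ.mem p hp))
  have h2 := (Θi p).le_opNorm (Θ p (z p + δ p))
  rw [h.left_inv] at h2
  exact h2.trans (mul_le_mul (h.norm_inv_le p hp) h1 (norm_nonneg _)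
    ((norm_nonneg _).trans (h.norm_le p hp)))

theorem IsConvexIntegrationProblem.memLp
    (h : IsConvexIntegrationProblem m 𝒯 U Θ Θi C K z) (hδ : IsAdmissible m 𝒯 U Θ K z δ) :
    MemLp (fun p => z p + δ p) 2 (m.restrict U) := by
  obtain ⟨M, hM⟩ := h.exists_bound
  have : IsFiniteMeasure (m.restrict U) := ⟨by simpa using h.isBounded.measure_lt_top⟩
  refine MemLp.of_bound ((h.cont.add hδ.cont.continuousOn).aestronglyMeasurable
    h.isOpen.measurableSet) M ?_
  exact (ae_restrict_iff' h.isOpen.measurableSet).2 (Eventually.of_forall fun p hp => hM δ hδ p hp)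

theorem norm_sq_eq_integral {α : Type*} [MeasurableSpace α] {μ : Measure α} (f : Lp Y 2 μ) :
    ‖f‖ ^ 2 = ∫ p, ‖f p‖ ^ 2 ∂μ := by
  rw [← real_inner_self_eq_norm_sq, L2.inner_def]
  simp only [real_inner_self_eq_norm_sq]

theorem integrable_norm_sq {α : Type*} [MeasurableSpace α] {μ : Measure α} (f : Lp Y 2 μ) :
    Integrable (fun p => ‖f p‖ ^ 2) μ :=
  (Lp.memLp f).integrable_norm_pow (p := 2) (by norm_num)

/-- The elements of `L²(U)` that are represented by admissible perturbations of `z`. -/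
def admissibleSet (m : Measure V) (𝒯 : Set (V → Y →L[ℝ] ℝ)) (U : Set V) (Θ : V → Y →L[ℝ] Y)
    (K : Set Y) (z : V → Y) : Set (Lp Y 2 (m.restrict U)) :=
  {f | ∃ δ, IsAdmissible m 𝒯 U Θ K z δ ∧ f =ᵐ[m.restrict U] fun p => z p + δ p}

/-- This puts the perturbation result in the form required by the Hilbert space iteration. Elements
of `L²(U)` serve as integrable test fields after extension by zero, because `U` is bounded. -/
theorem IsConvexIntegrationProblem.step
    (h : IsConvexIntegrationProblem m 𝒯 U Θ Θi C K z) :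
    ∃ c : ℝ, 0 < c ∧ ∀ x ∈ admissibleSet m 𝒯 U Θ K z, ∀ F : Finset (Lp Y 2 (m.restrict U)),
      ∀ ε : ℝ, 0 < ε → ∃ y ∈ admissibleSet m 𝒯 U Θ K z,
        (∀ f ∈ F, |inner ℝ (y - x) f| ≤ ε) ∧
        c * ∫ p in U, Metric.infDist (Θ p (x p)) K ^ 2 ∂m ≤ ‖y - x‖ ^ 2 := by
  classical
  have : IsFiniteMeasure (m.restrict U) := ⟨by simpa using h.isBounded.measure_lt_top⟩
  set c₀ : ℝ := 64 * 2 ^ Module.finrank ℝ V * (2 * (Module.finrank ℝ Y + 1) * C) ^ 2 with hc₀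
  have hc₀' : 0 ≤ c₀ := by positivity
  -- Adding `1` keeps the constant positive when `c₀ = 0`.
  refine ⟨(c₀ + 1)⁻¹, by positivity, ?_⟩
  rintro x ⟨δ, hδ, hx⟩ F ε hε
  let g : Lp Y 2 (m.restrict U) → V → Y →L[ℝ] ℝ := fun f p => innerSL ℝ (U.indicator f p)
  have hg : ∀ f, Integrable (g f) m := by
    intro f
    have hf : Integrable (⇑f) (m.restrict U) := (Lp.memLp f).integrable (by norm_num)
    exact ContinuousLinearMap.integrable_comp (innerSL ℝ (E := Y))
      ((integrable_indicator_iff h.isOpen.measurableSet).2 hf)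
  obtain ⟨δ', hδ', hw, hdist⟩ := h.exists_perturbation hδ (F.image g)
    (by simp only [Finset.mem_image]; rintro _ ⟨f, -, rfl⟩; exact hg f) hε
  have hy := (h.memLp hδ').coeFn_toLp
  set y := (h.memLp hδ').toLp with hydef
  have hyx : ⇑(y - x) =ᵐ[m.restrict U] fun p => δ' p - δ p := by
    filter_upwards [Lp.coeFn_sub y x, hy, hx] with p h1 h2 h3
    rw [h1, Pi.sub_apply, h2, h3]
    abel
  refine ⟨y, ⟨δ', hδ', hy⟩, fun f hf => ?_, ?_⟩
  · have h1 := hw (g f) (Finset.mem_image_of_mem g hf)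
    have h2 : ∫ p, g f p (δ' p - δ p) ∂m = inner ℝ (y - x) f := by
      have e : (fun p => g f p (δ' p - δ p))
          = U.indicator fun p => inner ℝ (f p) (δ' p - δ p) := by
        ext p
        by_cases hp : p ∈ U <;> simp [g, hp]
      rw [e, integral_indicator h.isOpen.measurableSet, L2.inner_def]
      refine integral_congr_ae ?_
      filter_upwards [hyx] with p hp
      rw [hp, real_inner_comm]
    rwa [h2] at h1
  · have h1 : ∫ p in U, Metric.infDist (Θ p (x p)) K ^ 2 ∂m
        = ∫ p in U, Metric.infDist (Θ p (z p + δ p)) K ^ 2 ∂m := by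
      refine integral_congr_ae ?_
      filter_upwards [hx] with p hp
      rw [hp]
    have h2 : ‖y - x‖ ^ 2 = ∫ p in U, ‖δ' p - δ p‖ ^ 2 ∂m := by
      rw [norm_sq_eq_integral]
      refine integral_congr_ae ?_
      filter_upwards [hyx] with p hp
      rw [hp]
    rw [h1, h2, inv_mul_le_iff₀ (by positivity)]
    have h3 : 0 ≤ ∫ p in U, ‖δ' p - δ p‖ ^ 2 ∂m := integral_nonneg fun p => by positivity
    linarith

/-- A strong limit of admissible perturbations along which the distance to the constraint set
tends to zero satisfies the constraints. -/
theorem IsConvexIntegrationProblem.mem_of_limit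
    (h : IsConvexIntegrationProblem m 𝒯 U Θ Θi C K z) {u : ℕ → Lp Y 2 (m.restrict U)}
    {y : Lp Y 2 (m.restrict U)} (hu : ∀ j, u j ∈ admissibleSet m 𝒯 U Θ K z)
    (huy : Tendsto u atTop (𝓝 y))
    (hD : Tendsto (fun j => ∫ p in U, Metric.infDist (Θ p (u j p)) K ^ 2 ∂m) atTop (𝓝 0)) :
    ∀ᵐ p ∂m.restrict U, Θ p (y p) ∈ K := by
  have hΘm : AEStronglyMeasurable Θ (m.restrict U) :=
    h.cont_coord.aestronglyMeasurable h.isOpen.measurableSet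
  -- The distance to `K` is `1`-Lipschitz and `Θ p` has norm at most `C`, so strong convergence
  -- transfers the vanishing of the distance integral to the limit.
  have hle : ∀ j, ∀ᵐ p ∂m.restrict U, Metric.infDist (Θ p (y p)) K ^ 2 ≤
      2 * Metric.infDist (Θ p (u j p)) K ^ 2 + 2 * C ^ 2 * ‖(u j - y) p‖ ^ 2 := by
    intro j
    filter_upwards [Lp.coeFn_sub (u j) y, ae_restrict_mem h.isOpen.measurableSet] with p h1 h2
    have h3 : Metric.infDist (Θ p (y p)) K
        ≤ Metric.infDist (Θ p (u j p)) K + C * ‖(u j - y) p‖ := by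
      refine (Metric.infDist_le_infDist_add_dist (y := Θ p (u j p))).trans ?_
      rw [dist_comm, dist_eq_norm, ← map_sub, h1, Pi.sub_apply]
      gcongr
      exact ((Θ p).le_opNorm _).trans (mul_le_mul_of_nonneg_right (h.norm_le p h2) (norm_nonneg _))
    have h4 := pow_le_pow_left₀ Metric.infDist_nonneg h3 2
    nlinarith [sq_nonneg (Metric.infDist (Θ p (u j p)) K - C * ‖(u j - y) p‖)]
  have hi1 : ∀ j, Integrable (fun p => Metric.infDist (Θ p (u j p)) K ^ 2) (m.restrict U) := by
    intro j
    obtain ⟨δ, hδ, hx⟩ := hu j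
    refine (h.integrableOn_infDist_sq hδ).congr ?_
    filter_upwards [hx] with p hp
    rw [hp]
  have hi2 : ∀ j, Integrable (fun p => 2 * Metric.infDist (Θ p (u j p)) K ^ 2
      + 2 * C ^ 2 * ‖(u j - y) p‖ ^ 2) (m.restrict U) := fun j =>
    ((hi1 j).const_mul 2).add ((integrable_norm_sq (u j - y)).const_mul (2 * C ^ 2))
  have hi : Integrable (fun p => Metric.infDist (Θ p (y p)) K ^ 2) (m.restrict U) := by
    refine (hi2 0).mono' ?_ ?_
    · refine ((Metric.continuous_infDist_pt K).pow 2).comp_aestronglyMeasurable ?_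
      exact isBoundedBilinearMap_apply.continuous.comp_aestronglyMeasurable
        (hΘm.prodMk (Lp.aestronglyMeasurable y))
    · filter_upwards [hle 0] with p hp
      rw [Real.norm_of_nonneg (by positivity)]
      exact hp
  have h0 : ∫ p in U, Metric.infDist (Θ p (y p)) K ^ 2 ∂m ≤ 0 := by
    have hlim : Tendsto (fun j => 2 * (∫ p in U, Metric.infDist (Θ p (u j p)) K ^ 2 ∂m)
        + 2 * C ^ 2 * ‖u j - y‖ ^ 2) atTop (𝓝 0) := by
      have h1 := (huy.sub_const y).norm.pow 2
      simpa using (hD.const_mul 2).add (h1.const_mul (2 * C ^ 2))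
    refine ge_of_tendsto' hlim fun j => ?_
    refine (integral_mono_ae hi (hi2 j) (hle j)).trans_eq ?_
    rw [integral_add ((hi1 j).const_mul 2)
      ((integrable_norm_sq (u j - y)).const_mul (2 * C ^ 2)), integral_const_mul,
      integral_const_mul, norm_sq_eq_integral]
  have h1 := (integral_eq_zero_iff_of_nonneg (fun p => by positivity) hi).1
    (le_antisymm h0 (integral_nonneg fun p => by positivity))
  filter_upwards [h1, ae_restrict_mem h.isOpen.measurableSet] with p hp hpU
  have hne : K.Nonempty := convexHull_nonempty_iff.1 ⟨_, interior_subset (h.mem p hpU)⟩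
  rw [h.compact.isClosed.mem_iff_infDist_zero hne]
  simpa using hp

/-- A functional that is continuous in space-time is represented by an element of `L²(U)`. -/
theorem exists_integral_eq_inner (hU : IsOpen U) (hUb : Bornology.IsBounded U)
    {G : V → Y →L[ℝ] ℝ} (hG : Continuous G) :
    ∃ g : Lp Y 2 (m.restrict U), ∀ f : V → Y, ∀ f' : Lp Y 2 (m.restrict U),
      f' =ᵐ[m.restrict U] f → inner ℝ g f' = ∫ p in U, G p (f p) ∂m := by
  have : IsFiniteMeasure (m.restrict U) := ⟨by simpa using hUb.measure_lt_top⟩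
  have hc : Continuous fun p => (InnerProductSpace.toDual ℝ Y).symm (G p) :=
    (InnerProductSpace.toDual ℝ Y).symm.continuous.comp hG
  obtain ⟨M, hM⟩ := (hUb.isCompact_closure.image hc).isBounded.exists_norm_le
  have hm : MemLp (fun p => (InnerProductSpace.toDual ℝ Y).symm (G p)) 2 (m.restrict U) := by
    refine MemLp.of_bound hc.aestronglyMeasurable M ?_
    exact (ae_restrict_iff' hU.measurableSet).2
      (Eventually.of_forall fun p hp => hM _ ⟨p, subset_closure hp, rfl⟩)
  refine ⟨hm.toLp, fun f f' hf => ?_⟩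
  rw [L2.inner_def]
  refine integral_congr_ae ?_
  filter_upwards [hm.coeFn_toLp, hf] with p h1 h2
  rw [h1, h2, InnerProductSpace.toDual_symm_apply]

/-- Each `y k` is the limit of an iteration started at `z` and tested, up to `1 / (k + 1)`, with the
first `k + 1` members of a dense sequence. Boundedness then gives weak convergence to `z`. The
linear constraints are continuous functionals on `L²(U)` and pass to the limits. -/
theorem IsConvexIntegrationProblem.exists_solutions
    (h : IsConvexIntegrationProblem m 𝒯 U Θ Θi C K z) (hne : U.Nonempty) :
    ∃ ys : ℕ → V → Y, (∀ k, MemLp (ys k) 2 (m.restrict U)) ∧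
      (∀ k, ∀ᵐ p ∂m.restrict U, Θ p (ys k p) ∈ K) ∧
      (∀ k, ∀ G ∈ 𝒯, ∫ p in U, G p (ys k p - z p) ∂m = 0) ∧
      (∀ f : V → Y, MemLp f 2 (m.restrict U) →
        Tendsto (fun k => ∫ p in U, inner ℝ (ys k p - z p) (f p) ∂m) atTop (𝓝 0)) ∧
      ∀ j k, j ≠ k → ¬ ys j =ᵐ[m.restrict U] ys k := by
  classical
  have : IsFiniteMeasure (m.restrict U) := ⟨by simpa using h.isBounded.measure_lt_top⟩
  have : NeZero (m.restrict U) := ⟨by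
    rw [Ne, Measure.restrict_eq_zero]; exact (h.isOpen.measure_pos m hne).ne'⟩
  obtain ⟨M, hM⟩ := h.exists_bound
  have hM0 : 0 ≤ M := by
    obtain ⟨p, hp⟩ := hne
    exact (norm_nonneg _).trans (hM 0 h.isAdmissible_zero p hp)
  set X := admissibleSet m 𝒯 U Θ K z with hX
  obtain ⟨R, hR⟩ : ∃ R, ∀ x ∈ X, ‖x‖ ≤ R := by
    refine ⟨measureUnivNNReal (m.restrict U) ^ (2 : ENNReal).toReal⁻¹ * M, ?_⟩
    rintro x ⟨δ, hδ, hx⟩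
    refine Lp.norm_le_of_ae_bound hM0 ?_
    filter_upwards [hx, ae_restrict_mem h.isOpen.measurableSet] with p h1 h2
    rw [h1]
    exact hM δ hδ p h2
  obtain ⟨c, hc, hstep⟩ := h.step
  have hz : MemLp z 2 (m.restrict U) := by simpa using h.memLp h.isAdmissible_zero
  set x₀ := hz.toLp with hx₀
  have hx₀z : x₀ =ᵐ[m.restrict U] z := hz.coeFn_toLp
  have hx₀X : x₀ ∈ X := ⟨0, h.isAdmissible_zero, by simpa using hx₀z⟩
  have : ProperSpace V := FiniteDimensional.proper_real V
  have : ProperSpace Y := FiniteDimensional.proper_real Y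
  have : Fact ((2 : ENNReal) ≠ ⊤) := ⟨by norm_num⟩
  have : SecondCountableTopology (Lp Y 2 (m.restrict U)) := Lp.SecondCountableTopology
  let dns : ℕ → Lp Y 2 (m.restrict U) := TopologicalSpace.denseSeq _
  have hex : ∀ k : ℕ, ∃ y : Lp Y 2 (m.restrict U), (∀ᵐ p ∂m.restrict U, Θ p (y p) ∈ K) ∧
      ‖y‖ ≤ R ∧ (∀ G ∈ 𝒯, ∫ p in U, G p (y p - z p) ∂m = 0) ∧
      ∀ i ≤ k, |inner ℝ (y - x₀) (dns i)| ≤ 1 / ((k : ℝ) + 1) := by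
    intro k
    obtain ⟨u, y, hu, huy, hD, hF⟩ := exists_strong_limit_of_step hR
      (D := fun x => ∫ p in U, Metric.infDist (Θ p (x p)) K ^ 2 ∂m)
      (fun x => integral_nonneg fun p => by positivity) hc hstep hx₀X
      ((Finset.range (k + 1)).image dns) (ε := 1 / ((k : ℝ) + 1)) (by positivity)
    refine ⟨y, h.mem_of_limit hu huy hD, ?_, fun G hG => ?_, fun i hi => ?_⟩
    · exact le_of_tendsto' huy.norm fun j => hR _ (hu j)
    · obtain ⟨g, hg⟩ := exists_integral_eq_inner (m := m) h.isOpen h.isBounded (h.cont_test G hG)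
      have h1 : ∀ j, inner ℝ g (u j - x₀) = 0 := by
        intro j
        obtain ⟨δ, hδ, hx⟩ := hu j
        rw [hg δ]
        · rw [setIntegral_eq_integral_of_forall_compl_eq_zero, hδ.orth G hG]
          intro p hp
          rw [image_eq_zero_of_notMem_tsupport fun h' => hp (hδ.supp h'), map_zero]
        · filter_upwards [Lp.coeFn_sub (u j) x₀, hx, hx₀z] with p h1 h2 h3
          rw [h1, Pi.sub_apply, h2, h3, add_sub_cancel_left]
      have h2 : Tendsto (fun j => inner ℝ g (u j - x₀)) atTop (𝓝 (inner ℝ g (y - x₀))) :=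
        tendsto_const_nhds.inner (huy.sub_const x₀)
      simp only [h1] at h2
      rw [← hg _ (y - x₀), tendsto_nhds_unique h2 tendsto_const_nhds]
      filter_upwards [Lp.coeFn_sub y x₀, hx₀z] with p h1 h3
      rw [h1, Pi.sub_apply, h3]
    · exact hF _ (Finset.mem_image_of_mem _ (by simpa using Nat.lt_succ_of_le hi))
  choose y hyK hyR hyG hyd using hex
  have hweak : ∀ f : Lp Y 2 (m.restrict U),
      Tendsto (fun k => inner ℝ (y k - x₀) f) atTop (𝓝 0) := by
    intro f
    rw [Metric.tendsto_atTop]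
    intro ε hε
    have hR0 : 0 ≤ R := (norm_nonneg _).trans (hyR 0)
    obtain ⟨i, hi⟩ := (TopologicalSpace.denseRange_denseSeq (Lp Y 2
        (m.restrict U))).exists_dist_lt f
      (ε := ε / (2 * (2 * R + 1))) (by positivity)
    obtain ⟨N, hN⟩ := exists_nat_one_div_lt (half_pos hε)
    refine ⟨max i N, fun k hk => ?_⟩
    have h1 := hyd k i ((le_max_left _ _).trans hk)
    have h2 : 1 / ((k : ℝ) + 1) ≤ 1 / ((N : ℝ) + 1) := by
      have : (N : ℝ) ≤ k := by exact_mod_cast (le_max_right _ _).trans hk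
      gcongr
    have h3 : |inner ℝ (y k - x₀) (f - dns i)| ≤ ε / 2 := by
      refine (abs_real_inner_le_norm _ _).trans ?_
      have h4 : ‖y k - x₀‖ ≤ 2 * R + 1 := by
        have := norm_sub_le (y k) x₀
        have := hyR k
        have := hR _ hx₀X
        linarith
      rw [dist_eq_norm] at hi
      refine (mul_le_mul h4 hi.le (norm_nonneg _) (by positivity)).trans_eq ?_
      field_simp
    have h5 : inner ℝ (y k - x₀) f = inner ℝ (y k - x₀) (f - dns i) + inner ℝ (y k - x₀)
        (dns i) := by
      rw [← inner_add_right, sub_add_cancel]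
    rw [Real.dist_eq, sub_zero, h5]
    refine (abs_add_le _ _).trans_lt ?_
    linarith
  have hyx : ∀ k, y k ≠ x₀ := by
    intro k hk
    have h1 := hyK k
    have : ∀ᵐ p ∂m.restrict U, False := by
      filter_upwards [hyK k, hx₀z, ae_restrict_mem h.isOpen.measurableSet] with p h1 h2 h3
      rw [hk, h2] at h1
      exact h.disj.ne_of_mem h1 (h.mem p h3) rfl
    obtain ⟨p, hp⟩ := this.exists
    exact hp
  -- If `y k = y j`, then testing `y k - x₀` with `y j - x₀` gives the positive number `‖y j - x₀‖ ^
  -- 2`. Weak convergence excludes this for large `k`.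
  have hdiff : ∀ j, ∀ᶠ k in atTop, y j ≠ y k := by
    intro j
    have h1 : 0 < ‖y j - x₀‖ ^ 2 := by
      have := norm_pos_iff.2 (sub_ne_zero.2 (hyx j))
      positivity
    filter_upwards [(hweak (y j - x₀)).eventually_lt_const h1] with k hk hjk
    rw [← hjk, real_inner_self_eq_norm_sq] at hk
    exact lt_irrefl _ hk
  obtain ⟨φ, -, hφ⟩ := exists_seq_of_forall_finset_exists (fun _ : ℕ => True)
    (fun j k => j < k ∧ y j ≠ y k) (fun s _ => by
      have : ∀ᶠ k in atTop, ∀ j ∈ s, j < k ∧ y j ≠ y k :=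
        s.eventually_all.2 fun j _ => (eventually_gt_atTop j).and (hdiff j)
      obtain ⟨k, hk⟩ := this.exists
      exact ⟨k, trivial, hk⟩)
  have hφm : StrictMono φ := fun j k hjk => (hφ j k hjk).1
  refine ⟨fun k => y (φ k), fun k => Lp.memLp _, fun k => hyK _, fun k => hyG _, fun f hf => ?_,
    fun j k hjk he => ?_⟩
  · refine ((hweak hf.toLp).comp hφm.tendsto_atTop).congr fun k => ?_
    simp only [Function.comp_apply]
    rw [L2.inner_def]
    refine integral_congr_ae ?_
    filter_upwards [Lp.coeFn_sub (y (φ k)) x₀, hx₀z, hf.coeFn_toLp] with p h1 h2 h3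
    rw [h1, Pi.sub_apply, h2, h3]
  · have he' : y (φ j) = y (φ k) := Lp.ext he
    rcases lt_or_gt_of_ne hjk with hlt | hlt
    · exact (hφ j k hlt).2 he'
    · exact (hφ k j hlt).2 he'.symm

end Solutions

/-! ### Coordinates on the state space -/

section StateCoordinates

variable {n : ℕ}

theorem outer_apply (a b : E n) (i j : Fin n) : outer a b i j = a i * b j := rfl

theorem trace_outer (a b : E n) : (outer a b).trace = inner ℝ a b := by
  simp [Matrix.trace, outer_apply, PiLp.inner_apply, mul_comm]

/-- The symmetric trace-free part of `a ⊗ b`. -/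
def devOuter (a b : E n) : tracelessSym n :=
  ⟨(1 / 2 : ℝ) • (outer a b + outer b a) - (inner ℝ a b / n) • 1, by
    refine ⟨?_, ?_⟩
    · ext i j
      simp only [Matrix.transpose_apply, Matrix.sub_apply, Matrix.smul_apply, Matrix.add_apply,
        outer_apply, Matrix.one_apply, smul_eq_mul, eq_comm (a := j) (b := i)]
      ring
    · rw [Matrix.trace_sub, Matrix.trace_smul, Matrix.trace_smul, Matrix.trace_add, trace_outer,
        trace_outer, Matrix.trace_one, real_inner_comm a b]
      rcases n with _ | n
      · simp [PiLp.inner_apply]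
      · simp only [smul_eq_mul, Fintype.card_fin]
        field_simp
        ring⟩

theorem coe_devOuter (a b : E n) : (devOuter a b : Matrix (Fin n) (Fin n) ℝ)
    = (1 / 2 : ℝ) • (outer a b + outer b a) - (inner ℝ a b / n) • 1 := rfl

/-- The state with density `ρ` and velocity `w` that satisfies the constraints for the pressure
`q`. -/
def phaseState (ρ q : ℝ) (w : E n) : State n :=
  (ρ, w, ρ • w, (ρ * ‖w‖ ^ 2 / 2 + q) • w, ρ • devOuter w w, ρ * ‖w‖ ^ 2 / 2)

theorem phaseState_mem_constraintSet {ρm ρp ρ : ℝ} (hρ : ρ = ρm ∨ ρ = ρp) (q : ℝ) (w : E n) :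
    phaseState ρ q w ∈ constraintSet n ρm ρp q := by
  refine ⟨rfl, rfl, ?_, hρ⟩
  simp only [State.μ, State.w, State.σ, State.e, phaseState, Submodule.coe_smul, coe_devOuter,
    real_inner_self_eq_norm_sq]
  ext i j
  simp only [Matrix.smul_apply, Matrix.add_apply, Matrix.sub_apply, smul_eq_mul]
  ring

theorem energy_of_mem_constraintSet (hn : n ≠ 0) {ρm ρp q : ℝ} {z : State n}
    (hz : z ∈ constraintSet n ρm ρp q) : z.e = z.μ * ‖z.w‖ ^ 2 / 2 := by
  have h := congrArg Matrix.trace hz.2.2.1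
  have hσ : z.σ.trace = 0 := z.2.2.2.2.1.2.2
  rw [Matrix.trace_smul, trace_outer, Matrix.trace_add, hσ, Matrix.trace_smul, Matrix.trace_one,
    real_inner_self_eq_norm_sq] at h
  have hn' : (n : ℝ) ≠ 0 := by exact_mod_cast hn
  simp only [smul_eq_mul, Fintype.card_fin, zero_add] at h
  field_simp at h
  linarith

/-- The trace of the stress identity determines the energy, and then density and velocity determine
all other components. The constraint set is thus a union of two graphs over the space of velocities.
-/
theorem mem_constraintSet_iff (hn : n ≠ 0) {ρm ρp q : ℝ} {z : State n} :
    z ∈ constraintSet n ρm ρp q ↔ ∃ ρ w, (ρ = ρm ∨ ρ = ρp) ∧ z = phaseState ρ q w := by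
  constructor
  · intro hz
    have he := energy_of_mem_constraintSet hn hz
    obtain ⟨h1, h2, h3, h4⟩ := hz
    refine ⟨z.μ, z.w, h4, ?_⟩
    have hσ : z.2.2.2.2.1 = z.μ • devOuter z.w z.w := by
      apply Subtype.ext
      rw [Submodule.coe_smul, coe_devOuter, real_inner_self_eq_norm_sq]
      have h5 : (z.2.2.2.2.1 : Matrix (Fin n) (Fin n) ℝ) = z.μ • outer z.w z.w
          - (2 / (n : ℝ) * z.e) • (1 : Matrix (Fin n) (Fin n) ℝ) := eq_sub_of_add_eq h3.symm
      rw [h5, he]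
      ext i j
      simp only [Matrix.smul_apply, Matrix.add_apply, Matrix.sub_apply, smul_eq_mul]
      ring
    refine Prod.ext rfl (Prod.ext rfl (Prod.ext h1 (Prod.ext ?_ (Prod.ext hσ he))))
    change z.h = (z.μ * ‖z.w‖ ^ 2 / 2 + q) • z.w
    rw [← he]
    exact h2
  · rintro ⟨ρ, w, hρ, rfl⟩
    exact phaseState_mem_constraintSet hρ q w

/-- The linear change of coordinates `h ↦ h + q w`. -/
def pressureShift (n : ℕ) (q : ℝ) : State n ≃L[ℝ] State n :=
  LinearEquiv.toContinuousLinearEquiv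
    { toFun := fun z => (z.1, z.2.1, z.2.2.1, z.2.2.2.1 + q • z.2.1, z.2.2.2.2.1, z.2.2.2.2.2)
      invFun := fun z => (z.1, z.2.1, z.2.2.1, z.2.2.2.1 - q • z.2.1, z.2.2.2.2.1, z.2.2.2.2.2)
      map_add' := fun x y => by
        simp only [Prod.fst_add, Prod.snd_add, smul_add, Prod.mk_add_mk]
        abel_nf
      map_smul' := fun c x => by
        simp only [Prod.smul_fst, Prod.smul_snd, smul_add, Prod.smul_mk, RingHom.id_apply,
          smul_comm c q]
      left_inv := fun x => by simp
      right_inv := fun x => by simp }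

theorem pressureShift_apply (q : ℝ) (z : State n) : pressureShift n q z
    = (z.1, z.2.1, z.2.2.1, z.2.2.2.1 + q • z.2.1, z.2.2.2.2.1, z.2.2.2.2.2) := rfl

theorem pressureShift_symm_apply (q : ℝ) (z : State n) : (pressureShift n q).symm z
    = (z.1, z.2.1, z.2.2.1, z.2.2.2.1 - q • z.2.1, z.2.2.2.2.1, z.2.2.2.2.2) := rfl

theorem pressureShift_phaseState (ρ q : ℝ) (w : E n) :
    pressureShift n q (phaseState ρ 0 w) = phaseState ρ q w := by
  simp [pressureShift_apply, phaseState, add_smul]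

theorem boundedConstraintSet_eq (hn : n ≠ 0) (ρm ρp γ q : ℝ) :
    boundedConstraintSet n ρm ρp γ q =
      (phaseState ρm q '' {w | ρm * ‖w‖ ^ 2 / 2 ≤ γ}) ∪
        (phaseState ρp q '' {w | ρp * ‖w‖ ^ 2 / 2 ≤ γ}) := by
  ext z
  constructor
  · rintro ⟨hz, hγ⟩
    obtain ⟨ρ, w, rfl | rfl, rfl⟩ := (mem_constraintSet_iff hn).1 hz
    · exact Or.inl ⟨w, hγ, rfl⟩
    · exact Or.inr ⟨w, hγ, rfl⟩
  · rintro (⟨w, hw, rfl⟩ | ⟨w, hw, rfl⟩)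
    · exact ⟨phaseState_mem_constraintSet (Or.inl rfl) q w, hw⟩
    · exact ⟨phaseState_mem_constraintSet (Or.inr rfl) q w, hw⟩

/-- All dependence on the pressure sits in a linear isomorphism, which lets one fixed compact set,
that for `q = 0`, serve at all points. -/
theorem image_pressureShift (hn : n ≠ 0) (ρm ρp γ q : ℝ) :
    pressureShift n q '' boundedConstraintSet n ρm ρp γ 0 = boundedConstraintSet n ρm ρp γ q := by
  simp only [boundedConstraintSet_eq hn, image_union, image_image, pressureShift_phaseState]

theorem mem_interior_convexHull_iff (hn : n ≠ 0) (ρm ρp γ q : ℝ) (z : State n) :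
    (pressureShift n q).symm z ∈ interior (convexHull ℝ (boundedConstraintSet n ρm ρp γ 0)) ↔
      z ∈ interior (convexHull ℝ (boundedConstraintSet n ρm ρp γ q)) := by
  have h1 : convexHull ℝ (boundedConstraintSet n ρm ρp γ q)
      = pressureShift n q '' convexHull ℝ (boundedConstraintSet n ρm ρp γ 0) := by
    rw [← image_pressureShift hn]
    exact ((pressureShift n q).toLinearEquiv.toLinearMap.image_convexHull _).symm
  have h2 := (pressureShift n q).toHomeomorph.image_interior
    (convexHull ℝ (boundedConstraintSet n ρm ρp γ 0))
  rw [h1]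
  change _ ↔ z ∈ interior ((pressureShift n q).toHomeomorph '' _)
  rw [← h2]
  constructor
  · intro h
    exact ⟨_, h, (pressureShift n q).apply_symm_apply z⟩
  · rintro ⟨x, hx, rfl⟩
    change (pressureShift n q).symm (pressureShift n q x) ∈ _
    rwa [ContinuousLinearEquiv.symm_apply_apply]

theorem continuous_devOuter_self : Continuous fun w : E n => devOuter w w := by
  refine Continuous.subtype_mk ?_ _
  refine continuous_matrix fun i j => ?_
  simp only [Matrix.smul_apply, Matrix.add_apply, Matrix.sub_apply, outer_apply, smul_eq_mul]
  fun_prop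

theorem continuous_phaseState (ρ q : ℝ) : Continuous (phaseState ρ q : E n → State n) := by
  unfold phaseState
  have := continuous_devOuter_self (n := n)
  fun_prop

theorem isCompact_boundedConstraintSet (hn : n ≠ 0) {ρm ρp : ℝ} (hρm : 0 < ρm) (hρp : 0 < ρp)
    (γ q : ℝ) : IsCompact (boundedConstraintSet n ρm ρp γ q) := by
  have h : ∀ ρ : ℝ, 0 < ρ → IsCompact {w : E n | ρ * ‖w‖ ^ 2 / 2 ≤ γ} := by
    intro ρ hρ
    refine Metric.isCompact_of_isClosed_isBounded (isClosed_le (by fun_prop) continuous_const) ?_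
    refine isBounded_iff_forall_norm_le.2 ⟨1 + 2 * γ / ρ, fun w hw => ?_⟩
    have hw' : ρ * ‖w‖ ^ 2 / 2 ≤ γ := hw
    have h1 : ‖w‖ ^ 2 ≤ 2 * γ / ρ := by rw [le_div_iff₀ hρ]; linarith
    nlinarith [sq_nonneg (‖w‖ - 1)]
  rw [boundedConstraintSet_eq hn]
  exact ((h ρm hρm).image (continuous_phaseState ρm q)).union
    ((h ρp hρp).image (continuous_phaseState ρp q))

/-- At a point with velocity `w₀`, the linear functional `e - w₀ · m + |w₀|² μ / 2` supports the
hull: on the constraint set it equals `ρ |w - w₀|² / 2`, which is nonnegative and vanishes at `w₀`.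
Lowering `e` alone makes it negative, so the point is not interior. -/
theorem disjoint_interior_convexHull (hn : n ≠ 0) {ρm ρp : ℝ} (hρm : 0 < ρm) (hρp : 0 < ρp)
    (γ : ℝ) : Disjoint (boundedConstraintSet n ρm ρp γ 0)
      (interior (convexHull ℝ (boundedConstraintSet n ρm ρp γ 0))) := by
  rw [disjoint_left]
  intro z hz hint
  obtain ⟨ρ, w₀, -, rfl⟩ := (mem_constraintSet_iff hn).1 hz.1
  let l : State n →ₗ[ℝ] ℝ :=
    { toFun := fun z => z.2.2.2.2.2 - inner ℝ w₀ z.2.2.1 + ‖w₀‖ ^ 2 / 2 * z.1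
      map_add' := fun x y => by
        simp only [Prod.fst_add, Prod.snd_add, inner_add_right]; ring
      map_smul' := fun c x => by
        simp only [Prod.smul_fst, Prod.smul_snd, inner_smul_right, smul_eq_mul,
          RingHom.id_apply]; ring }
  have hl : ∀ (ρ' : ℝ) (w : E n), l (phaseState ρ' 0 w) = ρ' / 2 * ‖w - w₀‖ ^ 2 := by
    intro ρ' w
    simp only [l, phaseState, LinearMap.coe_mk, AddHom.coe_mk, inner_smul_right,
      norm_sub_sq_real, real_inner_comm w₀ w]
    ring
  have hpos : ∀ x ∈ convexHull ℝ (boundedConstraintSet n ρm ρp γ 0), 0 ≤ l x := by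
    refine convexHull_min (fun x hx => ?_) (convex_halfSpace_ge l.isLinear 0)
    obtain ⟨ρ', w, hρ', rfl⟩ := (mem_constraintSet_iff hn).1 hx.1
    change 0 ≤ l (phaseState ρ' 0 w)
    rw [hl]
    rcases hρ' with rfl | rfl <;> positivity
  have hc : Tendsto (fun s : ℝ => phaseState ρ 0 w₀ + s • ((0, 0, 0, 0, 0, 1) : State n)) (𝓝 0)
      (𝓝 (phaseState ρ 0 w₀)) := by
    have : Continuous fun s : ℝ => phaseState ρ 0 w₀ + s • ((0, 0, 0, 0, 0, 1) : State n) := by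
      fun_prop
    simpa using this.tendsto 0
  have hev : ∀ᶠ s in 𝓝 (0 : ℝ), phaseState ρ 0 w₀ + s • ((0, 0, 0, 0, 0, 1) : State n) ∈
      convexHull ℝ (boundedConstraintSet n ρm ρp γ 0) :=
    hc.eventually (mem_interior_iff_mem_nhds.1 hint)
  obtain ⟨s, hs, hs0⟩ := ((hev.filter_mono nhdsWithin_le_nhds).and
    (self_mem_nhdsWithin (s := Iio (0 : ℝ)))).exists
  have h1 := hpos _ hs
  rw [map_add, hl, map_smul] at h1
  simp only [l, LinearMap.coe_mk, AddHom.coe_mk, sub_self, norm_zero, inner_zero_right,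
    smul_eq_mul] at h1
  have : s < 0 := hs0
  norm_num at h1
  linarith

end StateCoordinates

/-! ### The linear system and its plane waves -/

section NullIntegral

variable {α : Type*} [MeasurableSpace α] {m : Measure α}

/-- Integrable functions with vanishing integral. -/
def IsNullIntegral (m : Measure α) (f : α → ℝ) : Prop := Integrable f m ∧ ∫ p, f p ∂m = 0

theorem IsNullIntegral.add {f g : α → ℝ} (hf : IsNullIntegral m f) (hg : IsNullIntegral m g) :
    IsNullIntegral m (fun p => f p + g p) :=
  ⟨hf.1.add hg.1, by rw [integral_add hf.1 hg.1, hf.2, hg.2, add_zero]⟩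

theorem IsNullIntegral.const_mul {f : α → ℝ} (hf : IsNullIntegral m f) (c : ℝ) :
    IsNullIntegral m (fun p => c * f p) :=
  ⟨hf.1.const_mul c, by rw [integral_const_mul, hf.2, mul_zero]⟩

end NullIntegral

/-! ### Symmetry of third derivatives and antisymmetric integration by parts. -/

section SymmetricDerivatives

set_option maxSynthPendingDepth 5

variable {V : Type} [NormedAddCommGroup V] [NormedSpace ℝ V]

theorem thirdDeriv_swap_left {φ : V → ℝ} (hφ : ContDiff ℝ ∞ φ) (p u v w : V) :
    thirdDeriv φ p u v w = thirdDeriv φ p v u w := by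
  have h1 : ContDiff ℝ ∞ (fderiv ℝ φ) := hφ.fderiv_right (by simp)
  have h2 : IsSymmSndFDerivAt ℝ (fderiv ℝ φ) p :=
    h1.contDiffAt.isSymmSndFDerivAt
      (by rw [minSmoothness_of_isRCLikeNormedField]; exact WithTop.coe_le_coe.2 (le_top :
          (2 : ℕ∞) ≤ ⊤))
  unfold thirdDeriv
  rw [h2.eq u v]

theorem thirdDeriv_swap_right {φ : V → ℝ} (hφ : ContDiff ℝ ∞ φ) (p u v w : V) :
    thirdDeriv φ p u v w = thirdDeriv φ p u w v := by
  have h1 : ContDiff ℝ ∞ (fderiv ℝ φ) := hφ.fderiv_right (by simp)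
  have h2 : Differentiable ℝ (fderiv ℝ (fderiv ℝ φ)) :=
    (h1.fderiv_right (m := ∞) (by simp)).differentiable (by simp)
  have key : ∀ v w : V, thirdDeriv φ p u v w
      = fderiv ℝ (fun q => fderiv ℝ (fderiv ℝ φ) q v w) p u := by
    intro v w
    have e1 : HasFDerivAt (fun q => fderiv ℝ (fderiv ℝ φ) q v)
        ((ContinuousLinearMap.apply ℝ (V →L[ℝ] ℝ) v).comp (thirdDeriv φ p)) p :=
      (ContinuousLinearMap.apply ℝ (V →L[ℝ] ℝ) v).hasFDerivAt.comp p (h2 p).hasFDerivAt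
    have e2 := ((ContinuousLinearMap.apply ℝ ℝ w).hasFDerivAt.comp p e1).fderiv
    exact (congrArg (fun L : V →L[ℝ] ℝ => L u) e2).symm
  rw [key v w, key w v]
  congr 2
  ext q
  have h3 : IsSymmSndFDerivAt ℝ φ q := hφ.contDiffAt.isSymmSndFDerivAt
      (by rw [minSmoothness_of_isRCLikeNormedField]; exact WithTop.coe_le_coe.2 (le_top :
          (2 : ℕ∞) ≤ ⊤))
  exact h3.eq v w

variable [FiniteDimensional ℝ V] [MeasurableSpace V] [BorelSpace V] {m : Measure V}
  [m.IsAddHaarMeasure]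

/-- The basic antisymmetric integration by parts behind all compactly supported solutions of the
linear system. -/
theorem isNullIntegral_deriv_mul_deriv {f ψ : V → ℝ} (hf : ContDiff ℝ ∞ f)
    (hs : HasCompactSupport f) (hψ : ContDiff ℝ ∞ ψ) (u v : V) :
    IsNullIntegral m (fun p => fderiv ℝ f p u * fderiv ℝ ψ p v
      - fderiv ℝ f p v * fderiv ℝ ψ p u) := by
  have hf' : ∀ u, Continuous fun p => fderiv ℝ f p u := fun u =>
    (hf.continuous_fderiv (by simp)).clm_apply continuous_const
  have hd : ContDiff ℝ ∞ (fderiv ℝ ψ) := hψ.fderiv_right (by simp)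
  have hψ' : ∀ v, ContDiff ℝ ∞ fun p => fderiv ℝ ψ p v := fun v => hd.clm_apply contDiff_const
  have hψ'' : ∀ u v, Continuous fun p => fderiv ℝ (fun q => fderiv ℝ ψ q v) p u := fun u v =>
    ((hψ' v).continuous_fderiv (by simp)).clm_apply continuous_const
  have hs' : ∀ u, HasCompactSupport fun p => fderiv ℝ f p u := fun u => hs.fderiv_apply ℝ u
  have hi : ∀ u v, Integrable (fun p => fderiv ℝ f p u * fderiv ℝ ψ p v) m := fun u v =>
    ((hf' u).mul (hψ' v).continuous).integrable_of_hasCompactSupport (hs' u).mul_right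
  have hibp : ∀ u v, ∫ p, fderiv ℝ f p u * fderiv ℝ ψ p v ∂m
      = -∫ p, f p * fderiv ℝ (fun q => fderiv ℝ ψ q v) p u ∂m := by
    intro u v
    have := integral_mul_fderiv_eq_neg_fderiv_mul_of_integrable (μ := m) (f := f)
      (g := fun q => fderiv ℝ ψ q v) (v := u) (hi u v)
      ((hf.continuous.mul (hψ'' u v)).integrable_of_hasCompactSupport hs.mul_right)
      ((hf.continuous.mul (hψ' v).continuous).integrable_of_hasCompactSupport hs.mul_right)
      (fun x _ => (hf.differentiable (by simp)).differentiableAt)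
      (fun x _ => ((hψ' v).differentiable (by simp)).differentiableAt)
    rw [this, neg_neg]
  refine ⟨(hi u v).sub (hi v u), ?_⟩
  rw [integral_sub (hi u v) (hi v u), hibp u v, hibp v u, sub_eq_zero]
  congr 2
  ext p
  congr 1
  have key : ∀ u v : V, fderiv ℝ (fun q => fderiv ℝ ψ q v) p u = fderiv ℝ (fderiv ℝ ψ) p u v := by
    intro u v
    have e := ((ContinuousLinearMap.apply ℝ ℝ v).hasFDerivAt.comp p
      (hd.differentiable (by simp) p).hasFDerivAt).fderiv
    exact congrArg (fun L : V →L[ℝ] ℝ => L u) e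
  rw [key, key]
  have h3 : IsSymmSndFDerivAt ℝ ψ p := hψ.contDiffAt.isSymmSndFDerivAt
      (by rw [minSmoothness_of_isRCLikeNormedField]; exact WithTop.coe_le_coe.2 (le_top :
          (2 : ℕ∞) ≤ ⊤))
  exact h3.eq u v

theorem isNullIntegral_thirdDeriv {φ ψ : V → ℝ} (hφ : ContDiff ℝ ∞ φ) (hs : HasCompactSupport φ)
    (hψ : ContDiff ℝ ∞ ψ) (u x v w : V) :
    IsNullIntegral m (fun p => thirdDeriv φ p u v w * fderiv ℝ ψ p x
      - thirdDeriv φ p x v w * fderiv ℝ ψ p u) := by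
  have h1 : ContDiff ℝ ∞ (fderiv ℝ φ) := hφ.fderiv_right (by simp)
  have h2 : ContDiff ℝ ∞ (fderiv ℝ (fderiv ℝ φ)) := h1.fderiv_right (by simp)
  have h3 : ContDiff ℝ ∞ (fun q => fderiv ℝ (fderiv ℝ φ) q v w) :=
    (h2.clm_apply contDiff_const).clm_apply contDiff_const
  have hs3 : HasCompactSupport (fun q => fderiv ℝ (fderiv ℝ φ) q v w) :=
    ((hs.fderiv ℝ).fderiv ℝ).comp_left (g := fun L : V →L[ℝ] V →L[ℝ] ℝ => L v w) (by simp)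
  have key : ∀ p u, thirdDeriv φ p u v w
      = fderiv ℝ (fun q => fderiv ℝ (fderiv ℝ φ) q v w) p u := by
    intro p u
    have e1 : HasFDerivAt (fun q => fderiv ℝ (fderiv ℝ φ) q v)
        ((ContinuousLinearMap.apply ℝ (V →L[ℝ] ℝ) v).comp (thirdDeriv φ p)) p :=
      (ContinuousLinearMap.apply ℝ (V →L[ℝ] ℝ) v).hasFDerivAt.comp p
        (h2.differentiable (by simp) p).hasFDerivAt
    have e2 := ((ContinuousLinearMap.apply ℝ ℝ w).hasFDerivAt.comp p e1).fderiv
    exact (congrArg (fun L : V →L[ℝ] ℝ => L u) e2).symm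
  simp only [key]
  exact isNullIntegral_deriv_mul_deriv h3 hs3 hψ u x

end SymmetricDerivatives

/-! ### The weak equations as fields of linear functionals of the state. -/

section LinearForms

variable {n : ℕ}

theorem dt_eq_fderiv {F : Type*} [NormedAddCommGroup F] [NormedSpace ℝ F] {φ : E n × ℝ → F}
    (hφ : Differentiable ℝ φ) (p : E n × ℝ) : dt φ p = fderiv ℝ φ p (0, 1) := by
  have h1 : HasDerivAt (fun t : ℝ => (p.1, t)) ((0 : E n), (1 : ℝ)) p.2 :=
    (hasDerivAt_const p.2 p.1).prodMk (hasDerivAt_id p.2)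
  exact ((hφ p).hasFDerivAt.comp_hasDerivAt p.2 h1).deriv

theorem fderiv_slice {F : Type*} [NormedAddCommGroup F] [NormedSpace ℝ F] {φ : E n × ℝ → F}
    (hφ : Differentiable ℝ φ) (p : E n × ℝ) (v : E n) :
    fderiv ℝ (fun x => φ (x, p.2)) p.1 v = fderiv ℝ φ p (v, 0) := by
  have h1 : HasFDerivAt (fun x : E n => (x, p.2)) (ContinuousLinearMap.inl ℝ (E n) ℝ) p.1 :=
    hasFDerivAt_prodMk_left p.1 p.2
  exact congrArg (fun L : E n →L[ℝ] F => L v) ((hφ p).hasFDerivAt.comp p.1 h1).fderiv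

theorem inner_spaceGrad {ψ : E n × ℝ → ℝ} (hψ : Differentiable ℝ ψ) (p : E n × ℝ) (v : E n) :
    inner ℝ v (spaceGrad ψ p) = fderiv ℝ ψ p (v, 0) := by
  rw [← fderiv_slice hψ, spaceGrad, gradient, real_inner_comm, InnerProductSpace.toDual_symm_apply]

theorem contractGrad_add (A B : Matrix (Fin n) (Fin n) ℝ) (Φ : E n × ℝ → E n) (p : E n × ℝ) :
    contractGrad (A + B) Φ p = contractGrad A Φ p + contractGrad B Φ p := by
  simp only [contractGrad, Matrix.add_apply, add_mul, Finset.sum_add_distrib]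

theorem contractGrad_smul (c : ℝ) (A : Matrix (Fin n) (Fin n) ℝ) (Φ : E n × ℝ → E n)
    (p : E n × ℝ) : contractGrad (c • A) Φ p = c * contractGrad A Φ p := by
  simp only [contractGrad, Matrix.smul_apply, smul_eq_mul, Finset.mul_sum, mul_assoc]

theorem contractGrad_outer {Φ : E n × ℝ → E n} (hΦ : Differentiable ℝ Φ) (u v : E n)
    (p : E n × ℝ) : contractGrad (outer u v) Φ p = inner ℝ u (fderiv ℝ Φ p (v, 0)) := by
  rw [← fderiv_slice hΦ]
  set L := fderiv ℝ (fun x => Φ (x, p.2)) p.1 with hL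
  have hv : v = ∑ j, v j • EuclideanSpace.single j (1 : ℝ) := by
    ext i
    simp [Finset.sum_apply, Pi.single_apply]
  conv_rhs => rw [hv]
  simp only [map_sum, map_smul, inner_sum, inner_smul_right, PiLp.inner_apply, contractGrad,
    outer_apply, ← hL, Finset.mul_sum]
  rw [Finset.sum_comm]
  refine Finset.sum_congr rfl fun j _ => Finset.sum_congr rfl fun i _ => ?_
  simp
  ring

/-- The integrand of the weak momentum balance. -/
def momentumForm (Φ : E n × ℝ → E n) (p : E n × ℝ) : State n →L[ℝ] ℝ :=
  LinearMap.toContinuousLinearMap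
    { toFun := fun z => inner ℝ z.m (dt Φ p)
        + contractGrad (z.σ + (2 / (n : ℝ) * z.e) • (1 : Matrix (Fin n) (Fin n) ℝ)) Φ p
      map_add' := fun x y => by
        simp only [State.m, State.σ, State.e, Prod.fst_add, Prod.snd_add, inner_add_left,
          contractGrad_add, contractGrad_smul, Submodule.coe_add]
        ring
      map_smul' := fun c x => by
        simp only [State.m, State.σ, State.e, Prod.smul_fst, Prod.smul_snd, real_inner_smul_left,
          contractGrad_add, contractGrad_smul, Submodule.coe_smul, smul_eq_mul, RingHom.id_apply]
        ring }

/-- The integrand of the weak incompressibility condition. -/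
def incompressibilityForm (ψ : E n × ℝ → ℝ) (p : E n × ℝ) : State n →L[ℝ] ℝ :=
  LinearMap.toContinuousLinearMap
    { toFun := fun z => inner ℝ z.w (spaceGrad ψ p)
      map_add' := fun x y => by simp [State.w, inner_add_left]
      map_smul' := fun c x => by simp [State.w, real_inner_smul_left] }

/-- The integrand of the weak mass balance. -/
def massForm (ψ : E n × ℝ → ℝ) (p : E n × ℝ) : State n →L[ℝ] ℝ :=
  LinearMap.toContinuousLinearMap
    { toFun := fun z => z.μ * dt ψ p + inner ℝ z.m (spaceGrad ψ p)
      map_add' := fun x y => by simp [State.μ, State.m, inner_add_left]; ring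
      map_smul' := fun c x => by simp [State.μ, State.m, real_inner_smul_left]; ring }

/-- The integrand of the weak energy balance. -/
def energyForm (ψ : E n × ℝ → ℝ) (p : E n × ℝ) : State n →L[ℝ] ℝ :=
  LinearMap.toContinuousLinearMap
    { toFun := fun z => z.e * dt ψ p + inner ℝ z.h (spaceGrad ψ p)
      map_add' := fun x y => by simp [State.e, State.h, inner_add_left]; ring
      map_smul' := fun c x => by simp [State.e, State.h, real_inner_smul_left]; ring }

/-- The linear constraints of the relaxed system, tested with smooth functions. -/
def linearForms (n : ℕ) : Set (E n × ℝ → State n →L[ℝ] ℝ) :=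
  {G | (∃ Φ : E n × ℝ → E n, ContDiff ℝ ∞ Φ ∧ G = momentumForm Φ) ∨
    ∃ ψ : E n × ℝ → ℝ, ContDiff ℝ ∞ ψ ∧
      (G = incompressibilityForm ψ ∨ G = massForm ψ ∨ G = energyForm ψ)}

theorem momentumForm_apply (Φ : E n × ℝ → E n) (p : E n × ℝ) (z : State n) :
    momentumForm Φ p z = inner ℝ z.m (dt Φ p)
      + contractGrad (z.σ + (2 / (n : ℝ) * z.e) • (1 : Matrix (Fin n) (Fin n) ℝ)) Φ p := rfl

theorem massForm_apply {ψ : E n × ℝ → ℝ} (hψ : Differentiable ℝ ψ) (p : E n × ℝ)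
    (z : State n) : massForm ψ p z = z.μ * fderiv ℝ ψ p (0, 1) + fderiv ℝ ψ p (z.m, 0) := by
  rw [← inner_spaceGrad hψ, ← dt_eq_fderiv hψ]; rfl

theorem energyForm_apply {ψ : E n × ℝ → ℝ} (hψ : Differentiable ℝ ψ) (p : E n × ℝ)
    (z : State n) : energyForm ψ p z = z.e * fderiv ℝ ψ p (0, 1) + fderiv ℝ ψ p (z.h, 0) := by
  rw [← inner_spaceGrad hψ, ← dt_eq_fderiv hψ]; rfl

theorem incompressibilityForm_apply {ψ : E n × ℝ → ℝ} (hψ : Differentiable ℝ ψ) (p : E n × ℝ)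
    (z : State n) : incompressibilityForm ψ p z = fderiv ℝ ψ p (z.w, 0) := by
  rw [← inner_spaceGrad hψ]; rfl

theorem continuous_of_mem_linearForms {G : E n × ℝ → State n →L[ℝ] ℝ} (hG : G ∈ linearForms n)
    (z : State n) : Continuous fun p => G p z := by
  rcases hG with ⟨Φ, hΦ, rfl⟩ | ⟨ψ, hψ, rfl | rfl | rfl⟩
  · have hd := hΦ.differentiable (by simp)
    have hc := hΦ.continuous_fderiv (by simp)
    simp only [momentumForm_apply, contractGrad, dt_eq_fderiv hd, fderiv_slice hd]
    fun_prop
  all_goals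
    have hd := hψ.differentiable (by simp)
    have hc := hψ.continuous_fderiv (by simp)
  · simp only [incompressibilityForm_apply hd]
    fun_prop
  · simp only [massForm_apply hd]
    fun_prop
  · simp only [energyForm_apply hd]
    fun_prop

end LinearForms

/-! ### Potentials and plane waves for the linear system. -/

section PlaneWaves

set_option maxSynthPendingDepth 5

variable {n : ℕ}

instance : (volume : Measure (E n × ℝ)).IsAddHaarMeasure :=
  inferInstanceAs ((volume : Measure (E n)).prod (volume : Measure ℝ)).IsAddHaarMeasure

/-- The potential that generates the part of a plane wave that belongs to the phase `c`, `w`;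
`ξ` is the spatial direction of oscillation. -/
def phasePotential (c : ℝ) (w ξ : E n)
    (L : (E n × ℝ) →L[ℝ] (E n × ℝ) →L[ℝ] (E n × ℝ) →L[ℝ] ℝ) : State n :=
  (c * L (ξ, 0) (ξ, 0) (ξ, 0), 0,
    (c * L (ξ, 0) (ξ, 0) (ξ, 0)) • w - (c * L (w, 1) (ξ, 0) (ξ, 0)) • ξ,
    -(c / 2 * (L (0, 1) (ξ, 0) (ξ, 0) * inner ℝ w w - 2 * L (0, 1) (w, 1) (ξ, 0) * inner ℝ w ξ
      + L (0, 1) (w, 1) (w, 1) * inner ℝ ξ ξ)) • ξ,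
    (c * L (ξ, 0) (ξ, 0) (ξ, 0)) • devOuter w w - (2 * c * L (w, 1) (ξ, 0) (ξ, 0)) • devOuter w ξ
      + (c * L (w, 1) (w, 1) (ξ, 0)) • devOuter ξ ξ,
    c / 2 * (L (ξ, 0) (ξ, 0) (ξ, 0) * inner ℝ w w - 2 * L (w, 1) (ξ, 0) (ξ, 0) * inner ℝ w ξ
      + L (w, 1) (w, 1) (ξ, 0) * inner ℝ ξ ξ))

/-- The potential for solenoidal oscillations of the velocity and of the energy flux. -/
def curlPotential (v k ξ : E n)
    (L : (E n × ℝ) →L[ℝ] (E n × ℝ) →L[ℝ] (E n × ℝ) →L[ℝ] ℝ) : State n :=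
  (0, L (ξ, 0) (ξ, 0) (ξ, 0) • v - L (v, 0) (ξ, 0) (ξ, 0) • ξ, 0,
    L (ξ, 0) (ξ, 0) (ξ, 0) • k - L (k, 0) (ξ, 0) (ξ, 0) • ξ, 0, 0)

theorem isLinearMap_phasePotential (c : ℝ) (w ξ : E n) :
    IsLinearMap ℝ (phasePotential c w ξ) := by
  constructor
  · intro L M
    unfold phasePotential
    simp only [_root_.add_apply]
    refine Prod.ext ?_ (Prod.ext ?_ (Prod.ext ?_ (Prod.ext ?_ (Prod.ext ?_ ?_))))
    all_goals simp only [Prod.fst_add, Prod.snd_add]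
    · ring
    · simp
    · module
    · module
    · module
    · ring
  · intro a L
    unfold phasePotential
    simp only [_root_.smul_apply, smul_eq_mul]
    refine Prod.ext ?_ (Prod.ext ?_ (Prod.ext ?_ (Prod.ext ?_ (Prod.ext ?_ ?_))))
    all_goals simp only [Prod.smul_fst, Prod.smul_snd]
    · simp only [smul_eq_mul]; ring
    · simp
    · module
    · module
    · module
    · simp only [smul_eq_mul]; ring

theorem isLinearMap_curlPotential (v k ξ : E n) : IsLinearMap ℝ (curlPotential v k ξ) := by
  constructor
  · intro L M
    unfold curlPotential
    simp only [_root_.add_apply]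
    refine Prod.ext ?_ (Prod.ext ?_ (Prod.ext ?_ (Prod.ext ?_ (Prod.ext ?_ ?_))))
    all_goals simp only [Prod.fst_add, Prod.snd_add]
    · simp
    · module
    · simp
    · module
    · simp
    · simp
  · intro a L
    unfold curlPotential
    simp only [_root_.smul_apply, smul_eq_mul]
    refine Prod.ext ?_ (Prod.ext ?_ (Prod.ext ?_ (Prod.ext ?_ (Prod.ext ?_ ?_))))
    all_goals simp only [Prod.smul_fst, Prod.smul_snd]
    · simp
    · module
    · simp
    · module
    · simp
    · simp

variable {φ : E n × ℝ → ℝ}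

theorem fderiv_split {F : Type*} [NormedAddCommGroup F] [NormedSpace ℝ F] (ψ : E n × ℝ → F)
    (p : E n × ℝ) (w : E n) :
    fderiv ℝ ψ p (w, 1) = fderiv ℝ ψ p (w, 0) + fderiv ℝ ψ p (0, 1) := by
  rw [← map_add]; simp

theorem fderiv_smul_zero (ψ : E n × ℝ → ℝ) (p : E n × ℝ) (a : ℝ) (u : E n) :
    fderiv ℝ ψ p (a • u, 0) = a * fderiv ℝ ψ p (u, 0) := by
  rw [← smul_eq_mul, ← map_smul]; simp

theorem fderiv_sub_smul (ψ : E n × ℝ → ℝ) (p : E n × ℝ) (a b : ℝ) (u v : E n) :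
    fderiv ℝ ψ p (a • u - b • v, 0) = a * fderiv ℝ ψ p (u, 0) - b * fderiv ℝ ψ p (v, 0) := by
  rw [← fderiv_smul_zero, ← fderiv_smul_zero, ← map_sub]; simp

/-- Density, momentum and momentum flux of the potential form the space-time tensor `c D_ξ (a ⊗ a)`
with the operator `a = D_ξ (w, 1) - D_(w,1) (ξ, 0)`. Its space-time divergence vanishes because
`D_ξ` and `D_(w,1)` commute. This cancellation, tested with the components of `Φ` along `w` and `ξ`,
gives the two terms below. -/
theorem isNullIntegral_momentum_phasePotential (c : ℝ) (w ξ : E n) {Φ : E n × ℝ → E n}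
    (hΦ : ContDiff ℝ ∞ Φ) (hφ : ContDiff ℝ ∞ φ) (hs : HasCompactSupport φ) :
    IsNullIntegral volume
      (fun p => momentumForm Φ p (phasePotential c w ξ (thirdDeriv φ p))) := by
  have hd := hΦ.differentiable (by simp)
  have hi : ∀ u : E n, ContDiff ℝ ∞ fun p => inner ℝ u (Φ p) := fun u =>
    contDiff_const.inner ℝ hΦ
  have hid : ∀ (u : E n) p v, fderiv ℝ (fun p => inner ℝ u (Φ p)) p v
      = inner ℝ u (fderiv ℝ Φ p v) := by
    intro u p v
    rw [fderiv_inner_apply ℝ (differentiableAt_const _) (hd p)]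
    simp
  have h1 := (isNullIntegral_thirdDeriv (m := volume) hφ hs (hi w) (ξ, 0) (w, 1) (ξ, 0)
    (ξ, 0)).const_mul c
  have h2 := (isNullIntegral_thirdDeriv (m := volume) hφ hs (hi ξ) (w, 1) (ξ, 0) (w, 1)
    (ξ, 0)).const_mul c
  convert h1.add h2 using 1
  ext p
  have e1 : ∀ L, (phasePotential c w ξ L).σ + (2 / (n : ℝ) * (phasePotential c w ξ L).e) •
      (1 : Matrix (Fin n) (Fin n) ℝ) = (c * L (ξ, 0) (ξ, 0) (ξ, 0)) • outer w w
        + ((-(c * L (w, 1) (ξ, 0) (ξ, 0))) • (outer w ξ + outer ξ w)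
        + (c * L (w, 1) (w, 1) (ξ, 0)) • outer ξ ξ) := by
    intro L
    ext i j
    simp only [State.σ, State.e, phasePotential, Submodule.coe_add, Submodule.coe_sub,
      Submodule.coe_smul, coe_devOuter, Matrix.smul_apply, Matrix.add_apply, Matrix.sub_apply,
      smul_eq_mul]
    ring
  simp only [momentumForm_apply, e1, contractGrad_add, contractGrad_smul, contractGrad_outer hd,
    dt_eq_fderiv hd, hid]
  rw [fderiv_split Φ p w]
  rw [thirdDeriv_swap_left hφ p (ξ, 0) (w, 1) (ξ, 0)]
  simp only [State.m, phasePotential, inner_sub_left, real_inner_smul_left, inner_add_right]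
  ring

theorem isNullIntegral_mass_phasePotential (c : ℝ) (w ξ : E n) {ψ : E n × ℝ → ℝ}
    (hψ : ContDiff ℝ ∞ ψ) (hφ : ContDiff ℝ ∞ φ) (hs : HasCompactSupport φ) :
    IsNullIntegral volume
      (fun p => massForm ψ p (phasePotential c w ξ (thirdDeriv φ p))) := by
  have hd := hψ.differentiable (by simp)
  have h1 := (isNullIntegral_thirdDeriv (m := volume) hφ hs hψ (ξ, 0) (w, 1) (ξ, 0)
    (ξ, 0)).const_mul c
  convert h1 using 1
  ext p
  simp only [massForm_apply hd, State.μ, State.m, phasePotential, fderiv_sub_smul]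
  rw [fderiv_split ψ p w]
  ring

/-- The energy is a `ξ`-derivative. Its flux is directed along `ξ` and has this derivative replaced
by minus the time derivative, so the two contributions to the balance cancel. -/
theorem isNullIntegral_energy_phasePotential (c : ℝ) (w ξ : E n) {ψ : E n × ℝ → ℝ}
    (hψ : ContDiff ℝ ∞ ψ) (hφ : ContDiff ℝ ∞ φ) (hs : HasCompactSupport φ) :
    IsNullIntegral volume
      (fun p => energyForm ψ p (phasePotential c w ξ (thirdDeriv φ p))) := by
  have hd := hψ.differentiable (by simp)
  have h1 := (isNullIntegral_thirdDeriv (m := volume) hφ hs hψ (ξ, 0) (0, 1) (ξ, 0)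
    (ξ, 0)).const_mul (c * inner ℝ w w / 2)
  have h2 := (isNullIntegral_thirdDeriv (m := volume) hφ hs hψ (ξ, 0) (0, 1) (w, 1)
    (ξ, 0)).const_mul (-(c * inner ℝ w ξ))
  have h3 := (isNullIntegral_thirdDeriv (m := volume) hφ hs hψ (ξ, 0) (0, 1) (w, 1)
    (w, 1)).const_mul (c * inner ℝ ξ ξ / 2)
  convert (h1.add h2).add h3 using 1
  ext p
  simp only [energyForm_apply hd, State.e, State.h, phasePotential, fderiv_smul_zero]
  rw [thirdDeriv_swap_right hφ p (w, 1) (w, 1) (ξ, 0),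
    thirdDeriv_swap_left hφ p (w, 1) (ξ, 0) (w, 1),
    thirdDeriv_swap_left hφ p (w, 1) (ξ, 0) (ξ, 0)]
  ring

theorem isNullIntegral_curlPotential (v k ξ : E n) {G : E n × ℝ → State n →L[ℝ] ℝ}
    (hG : G ∈ linearForms n) (hφ : ContDiff ℝ ∞ φ) (hs : HasCompactSupport φ) :
    IsNullIntegral volume (fun p => G p (curlPotential v k ξ (thirdDeriv φ p))) := by
  rcases hG with ⟨Φ, hΦ, rfl⟩ | ⟨ψ, hψ, rfl | rfl | rfl⟩
  · have e : ∀ p L, momentumForm Φ p (curlPotential v k ξ L) = 0 := by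
      intro p L
      simp [curlPotential, momentumForm_apply, State.m, State.σ, State.e, contractGrad]
    simp only [e]
    simp [IsNullIntegral]
  all_goals have hd := hψ.differentiable (by simp)
  · convert isNullIntegral_thirdDeriv (m := volume) hφ hs hψ (ξ, 0) (v, 0) (ξ, 0) (ξ, 0) using 1
    ext p
    simp only [curlPotential, incompressibilityForm_apply hd, State.w, fderiv_sub_smul]
  · have e : ∀ p L, massForm ψ p (curlPotential v k ξ L) = 0 := by
      intro p L
      simp [curlPotential, massForm_apply hd, State.m, State.μ, Prod.mk_zero_zero]
    simp only [e]
    simp [IsNullIntegral]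
  · convert isNullIntegral_thirdDeriv (m := volume) hφ hs hψ (ξ, 0) (k, 0) (ξ, 0) (ξ, 0) using 1
    ext p
    simp only [curlPotential, energyForm_apply hd, State.e, State.h, fderiv_sub_smul, zero_mul,
      zero_add]

theorem isNullIntegral_phasePotential (c : ℝ) (w ξ : E n) {G : E n × ℝ → State n →L[ℝ] ℝ}
    (hG : G ∈ linearForms n) (hφ : ContDiff ℝ ∞ φ) (hs : HasCompactSupport φ) :
    IsNullIntegral volume (fun p => G p (phasePotential c w ξ (thirdDeriv φ p))) := by
  rcases hG with ⟨Φ, hΦ, rfl⟩ | ⟨ψ, hψ, rfl | rfl | rfl⟩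
  · exact isNullIntegral_momentum_phasePotential c w ξ hΦ hφ hs
  · have hd := hψ.differentiable (by simp)
    have e : ∀ p, incompressibilityForm ψ p (phasePotential c w ξ (thirdDeriv φ p)) = 0 := by
      intro p
      simp [phasePotential, incompressibilityForm_apply hd, State.w, Prod.mk_zero_zero]
    simp only [e]
    simp [IsNullIntegral]
  · exact isNullIntegral_mass_phasePotential c w ξ hψ hφ hs
  · exact isNullIntegral_energy_phasePotential c w ξ hψ hφ hs

theorem exists_unit_orthogonal (hn : 2 ≤ n) (v : E n) : ∃ ξ : E n, ‖ξ‖ = 1 ∧ inner ℝ v ξ = 0 := by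
  have h1 : (ℝ ∙ v)ᗮ ≠ ⊥ := by
    intro h
    have h2 := Submodule.finrank_add_finrank_orthogonal (ℝ ∙ v)
    rw [h, finrank_bot, finrank_euclideanSpace, Fintype.card_fin] at h2
    have h3 := finrank_span_le_card (R := ℝ) ({v} : Set (E n))
    simp only [Set.toFinset_singleton, Finset.card_singleton] at h3
    omega
  obtain ⟨x, hx, hx0⟩ := Submodule.exists_mem_ne_zero_of_ne_bot h1
  refine ⟨‖x‖⁻¹ • x, ?_, ?_⟩
  · rw [norm_smul, norm_inv, norm_norm, inv_mul_cancel₀ (norm_ne_zero_iff.2 hx0)]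
  · rw [inner_smul_right, Submodule.mem_orthogonal_singleton_iff_inner_right.1 hx, mul_zero]

/-- Differences of states that satisfy the constraints are directions of oscillation. -/
theorem isWaveDirection_phaseState_sub (hn : 2 ≤ n) (ρ₁ ρ₂ q : ℝ) (w₁ w₂ : E n) :
    IsWaveDirection (volume : Measure (E n × ℝ)) (linearForms n)
      (phaseState ρ₁ q w₁ - phaseState ρ₂ q w₂) := by
  obtain ⟨ξ, hξ, hort⟩ := exists_unit_orthogonal hn (w₁ - w₂)
  have hξξ : inner ℝ ξ ξ = (1 : ℝ) := by rw [real_inner_self_eq_norm_sq, hξ, one_pow]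
  rw [inner_sub_left, sub_eq_zero] at hort
  -- The covector `l (x, t) = ξ · x + c t` annihilates `(w₁, 1)` and, since `ξ` is orthogonal to `w₁
  -- - w₂`, also `(w₂, 1)`: both phases transport the wave. In the symbols of the phase potentials
  -- only the `D_ξ³` terms and the energy flux along `ξ` survive.
  set c : ℝ := -inner ℝ w₁ ξ with hc
  have hc₁ : inner ℝ ξ w₁ = -c := by rw [hc, neg_neg, real_inner_comm]
  have hc₂ : inner ℝ ξ w₂ = -c := by rw [hc, neg_neg, hort, real_inner_comm]
  set ê : ℝ := ρ₁ * ‖w₁‖ ^ 2 / 2 - ρ₂ * ‖w₂‖ ^ 2 / 2 with hê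
  -- The phase potentials contribute the energy flux `-(c * ê) • ξ`. What is missing from the flux
  -- difference is `k`, which is orthogonal to `ξ` and hence attainable by a solenoidal wave.
  set k : E n := (ρ₁ * ‖w₁‖ ^ 2 / 2 + q) • w₁ - (ρ₂ * ‖w₂‖ ^ 2 / 2 + q) • w₂ + (c * ê) • ξ with hk
  have hkξ : inner ℝ ξ k = 0 := by
    rw [hk, inner_add_right, inner_sub_right, inner_smul_right, inner_smul_right, inner_smul_right,
      hc₁, hc₂, hξξ, hê]
    ring
  let l : E n × ℝ →L[ℝ] ℝ := (innerSL ℝ ξ).comp (ContinuousLinearMap.fst ℝ (E n) ℝ)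
    + c • ContinuousLinearMap.snd ℝ (E n) ℝ
  have hl : ∀ (x : E n) (t : ℝ), l (x, t) = inner ℝ ξ x + c * t := fun x t => by simp [l]
  refine ⟨l, fun h0 => ?_, (isLinearMap_phasePotential ρ₁ w₁ ξ).mk' _
    + (isLinearMap_phasePotential (-ρ₂) w₂ ξ).mk' _
    + (isLinearMap_curlPotential (w₁ - w₂) k ξ).mk' _, ?_, fun φ hφ hs G hG => ?_⟩
  · have := hl ξ 0
    rw [h0, hξξ] at this
    simp at this
  · have e1 : l (ξ, 0) = 1 := by rw [hl, hξξ]; ring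
    have e2 : l (w₁, 1) = 0 := by rw [hl, hc₁]; ring
    have e3 : l (w₂, 1) = 0 := by rw [hl, hc₂]; ring
    have e4 : l (w₁ - w₂, 0) = 0 := by rw [hl, inner_sub_right, hc₁, hc₂]; ring
    have e5 : l (k, 0) = 0 := by rw [hl, hkξ]; ring
    have e6 : l (0, 1) = c := by rw [hl, inner_zero_right]; ring
    simp only [LinearMap.add_apply, IsLinearMap.mk'_apply, phasePotential, curlPotential,
      cube_apply, e1, e2, e3, e4, e5, e6, phaseState, real_inner_self_eq_norm_sq]
    refine Prod.ext ?_ (Prod.ext ?_ (Prod.ext ?_ (Prod.ext ?_ (Prod.ext ?_ ?_))))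
    all_goals simp only [Prod.fst_add, Prod.snd_add, Prod.fst_sub, Prod.snd_sub]
    · ring
    · module
    · module
    · simp only [hk, hê]
      module
    · module
    · ring
  · have h := ((isNullIntegral_phasePotential ρ₁ w₁ ξ hG hφ hs).add
      (isNullIntegral_phasePotential (-ρ₂) w₂ ξ hG hφ hs)).add
      (isNullIntegral_curlPotential (w₁ - w₂) k ξ hG hφ hs)
    simpa only [LinearMap.add_apply, IsLinearMap.mk'_apply, map_add] using h.2

end PlaneWaves

/-! ### Convex integration for the relaxed system with a given pressure. -/

section Transport

set_option maxSynthPendingDepth 5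

variable {n : ℕ}

/-- The nilpotent map `(μ, w, m, h, σ, e) ↦ (0, 0, 0, w, 0, 0)`. -/
def velocityToFlux (n : ℕ) : State n →L[ℝ] State n :=
  LinearMap.toContinuousLinearMap
    { toFun := fun z => (0, 0, 0, z.2.1, 0, 0)
      map_add' := fun x y => by simp
      map_smul' := fun c x => by simp }

theorem pressureShift_eq (q : ℝ) (z : State n) :
    pressureShift n q z = z + q • velocityToFlux n z := by
  rw [pressureShift_apply]
  refine Prod.ext ?_ (Prod.ext ?_ (Prod.ext ?_ (Prod.ext ?_ (Prod.ext ?_ ?_)))) <;>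
    simp [velocityToFlux]

theorem pressureShift_symm_eq (q : ℝ) (z : State n) :
    (pressureShift n q).symm z = z - q • velocityToFlux n z := by
  rw [pressureShift_symm_apply]
  refine Prod.ext ?_ (Prod.ext ?_ (Prod.ext ?_ (Prod.ext ?_ (Prod.ext ?_ ?_)))) <;>
    simp [velocityToFlux]

theorem IsWaveDirection.map {V Z Y : Type} [NormedAddCommGroup V] [NormedSpace ℝ V]
    [MeasurableSpace V] {m : Measure V}
    [AddCommGroup Z] [Module ℝ Z] [TopologicalSpace Z]
    [NormedAddCommGroup Y] [NormedSpace ℝ Y] {𝒯 : Set (V → Z →L[ℝ] ℝ)} {y : Z}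
    (h : IsWaveDirection m 𝒯 y) (S : Z ≃L[ℝ] Y) :
    IsWaveDirection m
      ((fun (G : V → Z →L[ℝ] ℝ) p => (G p).comp (S.symm : Y →L[ℝ] Z)) '' 𝒯) (S y) := by
  obtain ⟨l, hl, A, hA, h⟩ := h
  refine ⟨l, hl, (S.toLinearEquiv : Z →ₗ[ℝ] Y) ∘ₗ A, congrArg S hA, ?_⟩
  rintro φ hφ hs _ ⟨G, hG, rfl⟩
  simpa using h φ hφ hs G hG

/-- Convex integration for the relaxed system: a continuous strict subsolution on a bounded open
set is the weak limit of pairwise different bounded states that satisfy the constraints and the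
same linear equations. -/
theorem exists_seq_mem_boundedConstraintSet (hn : 2 ≤ n) {ρm ρp γ C : ℝ} (hρm : 0 < ρm)
    (hρp : 0 < ρp) {U : Set (E n × ℝ)} (hU : IsOpen U) (hb : Bornology.IsBounded U)
    (hne : U.Nonempty) {z : E n × ℝ → State n} {q : E n × ℝ → ℝ} (hz : ContinuousOn z U)
    (hq : ContinuousOn q U) (hC : ∀ p ∈ U, |q p| ≤ C)
    (hmem : ∀ p ∈ U, z p ∈ interior (convexHull ℝ (boundedConstraintSet n ρm ρp γ (q p)))) :
    ∃ zs : ℕ → E n × ℝ → State n,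
      (∀ k, ∀ l : State n →L[ℝ] ℝ, MemLp (fun p => l (zs k p)) 2 (volume.restrict U)) ∧
      (∀ k, ∀ᵐ p ∂volume.restrict U, zs k p ∈ boundedConstraintSet n ρm ρp γ (q p)) ∧
      (∀ k, ∀ G ∈ linearForms n, ∫ p in U, G p (zs k p - z p) = 0) ∧
      (∀ (l : State n →L[ℝ] ℝ) (φ : E n × ℝ → ℝ), MemLp φ 2 (volume.restrict U) →
        Tendsto (fun k => ∫ p in U, l (zs k p - z p) * φ p) atTop (𝓝 0)) ∧
      ∀ j k, j ≠ k → ¬ zs j =ᵐ[volume.restrict U] zs k := by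
  have hn0 : n ≠ 0 := by omega
  -- The product norm on `State n` is not Hilbertian, whereas the iteration needs an inner product.
  set S : State n ≃L[ℝ] EuclideanSpace ℝ (Fin (Module.finrank ℝ (State n))) := toEuclidean with hS
  let B := ((S : State n →L[ℝ] EuclideanSpace ℝ (Fin (Module.finrank ℝ (State n)))).comp
      (velocityToFlux n)).comp
    (S.symm : EuclideanSpace ℝ (Fin (Module.finrank ℝ (State n))) →L[ℝ] State n)
  -- `B` is conjugate to `velocityToFlux n`, whose square is zero, so `id - q B` and `id + q B` are
  -- inverse to each other. They represent the pressure shift and its inverse.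
  let Θ := fun p => ContinuousLinearMap.id ℝ _ - q p • B
  let Θi := fun p => ContinuousLinearMap.id ℝ _ + q p • B
  have hΘ : ∀ p x, Θ p (S x) = S ((pressureShift n (q p)).symm x) := by
    intro p x
    simp [Θ, B, pressureShift_symm_eq]
  have hΘi : ∀ p x, Θi p (S x) = S (pressureShift n (q p) x) := by
    intro p x
    simp [Θi, B, pressureShift_eq]
  have hconv : interior (convexHull ℝ (S '' boundedConstraintSet n ρm ρp γ 0))
      = S '' interior (convexHull ℝ (boundedConstraintSet n ρm ρp γ 0)) := by
    have h1 := S.toLinearEquiv.toLinearMap.image_convexHull (boundedConstraintSet n ρm ρp γ 0)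
    have h2 := S.toHomeomorph.image_interior (convexHull ℝ (boundedConstraintSet n ρm ρp γ 0))
    change S '' _ = convexHull ℝ (S '' _) at h1
    change S '' _ = interior (S '' _) at h2
    rw [h2, h1]
  have hsurj : ∀ y, ∃ x, S x = y := S.surjective
  have hprob : IsConvexIntegrationProblem volume
      ((fun (G : E n × ℝ → State n →L[ℝ] ℝ) p => (G p).comp (S.symm : EuclideanSpace ℝ (Fin
          (Module.finrank ℝ (State n))) →L[ℝ] State n)) ''
        linearForms n) U Θ Θi (1 + C * ‖B‖) (S '' boundedConstraintSet n ρm ρp γ 0)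
      (fun p => S (z p)) := by
    have hid : ‖ContinuousLinearMap.id ℝ
        (EuclideanSpace ℝ (Fin (Module.finrank ℝ (State n))))‖ ≤ 1 :=
      ContinuousLinearMap.norm_id_le
    have hqB : ∀ p ∈ U, ‖q p • B‖ ≤ C * ‖B‖ := fun p hp => by
      rw [norm_smul]
      exact mul_le_mul_of_nonneg_right (hC p hp) (norm_nonneg _)
    refine ⟨hU, hb, fun p y => ?_, fun p y => ?_, ?_, fun p hp => ?_, fun p hp => ?_, ?_, ?_, ?_,
      ?_, ?_, fun p hp => ?_⟩
    · obtain ⟨x, rfl⟩ := hsurj y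
      rw [hΘ, hΘi, ContinuousLinearEquiv.apply_symm_apply]
    · obtain ⟨x, rfl⟩ := hsurj y
      rw [hΘi, hΘ, ContinuousLinearEquiv.symm_apply_apply]
    · exact continuousOn_const.sub (hq.smul continuousOn_const)
    · exact (norm_sub_le _ _).trans (add_le_add hid (hqB p hp))
    · exact (norm_add_le _ _).trans (add_le_add hid (hqB p hp))
    · exact (isCompact_boundedConstraintSet hn0 hρm hρp γ 0).image S.continuous
    · rw [hconv, disjoint_image_iff S.injective]
      exact disjoint_interior_convexHull hn0 hρm hρp γ
    · rintro _ ⟨G, hG, rfl⟩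
      exact continuous_clm_apply.2 fun y => continuous_of_mem_linearForms hG (S.symm y)
    · rintro p - _ ⟨a, ha, rfl⟩ _ ⟨b, hb, rfl⟩
      obtain ⟨ρ₁, w₁, -, rfl⟩ := (mem_constraintSet_iff hn0).1 ha.1
      obtain ⟨ρ₂, w₂, -, rfl⟩ := (mem_constraintSet_iff hn0).1 hb.1
      rw [← map_sub, hΘi, map_sub, pressureShift_phaseState, pressureShift_phaseState]
      exact (isWaveDirection_phaseState_sub hn ρ₁ ρ₂ (q p) w₁ w₂).map S
    · exact S.continuous.comp_continuousOn hz
    · rw [hΘ, hconv]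
      exact mem_image_of_mem _ ((mem_interior_convexHull_iff hn0 ρm ρp γ (q p) (z p)).2 (hmem p hp))
  obtain ⟨ys, h1, h2, h3, h4, h5⟩ := hprob.exists_solutions hne
  refine ⟨fun k p => S.symm (ys k p), fun k l => ?_, fun k => ?_, fun k G hG => ?_,
    fun l φ hφ => ?_, fun j k hjk h => ?_⟩
  · exact (l.comp (S.symm : EuclideanSpace ℝ (Fin (Module.finrank ℝ
      (State n))) →L[ℝ] State n)).comp_memLp' (h1 k)
  · filter_upwards [h2 k] with p ⟨x, hx, hxp⟩
    have : ys k p = S (pressureShift n (q p) x) := by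
      rw [← hΘi, hxp, hprob.left_inv]
    rw [this, ContinuousLinearEquiv.symm_apply_apply, ← image_pressureShift hn0]
    exact mem_image_of_mem _ hx
  · have := h3 k _ (mem_image_of_mem _ hG)
    simpa using this
  · have hf : MemLp (fun p => φ p • (InnerProductSpace.toDual ℝ _).symm
        (l.comp (S.symm : EuclideanSpace ℝ (Fin (Module.finrank ℝ (State n))) →L[ℝ] State n))) 2
            (volume.restrict U) := by
      exact (ContinuousLinearMap.toSpanSingleton ℝ ((InnerProductSpace.toDual ℝ _).symm
        (l.comp (S.symm : EuclideanSpace ℝ (Fin (Module.finrank ℝ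
            (State n))) →L[ℝ] State n)))).comp_memLp' hφ
    refine (h4 _ hf).congr fun k => integral_congr_ae (Eventually.of_forall fun p => ?_)
    simp only [inner_smul_right]
    rw [real_inner_comm, InnerProductSpace.toDual_symm_apply]
    simp [mul_comm]
  · refine h5 j k hjk ?_
    filter_upwards [h] with p hp
    exact S.symm.injective hp

end Transport

/-! ### Explicit states in the convex hull. -/

section Hull

variable {n : ℕ}

theorem devOuter_add_smul (w v : E n) (u : ℝ) : devOuter (w + u • v) (w + u • v)
    = devOuter w w + (2 * u) • devOuter w v + u ^ 2 • devOuter v v := by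
  apply Subtype.ext
  simp only [Submodule.coe_add, Submodule.coe_smul, coe_devOuter]
  ext i j
  simp only [Matrix.smul_apply, Matrix.add_apply, Matrix.sub_apply, smul_eq_mul, outer_apply,
    PiLp.add_apply, PiLp.smul_apply, inner_add_left, inner_add_right, real_inner_smul_left,
    real_inner_smul_right, real_inner_comm w v]
  ring

/-- The barycenter of two states in the phase `ρ` whose velocities `w + u v` have mean `w`, where
`u` has second moment `s` and third moment `s κ`. -/
def axisState (ρ q : ℝ) (w v : E n) (s κ : ℝ) : State n :=
  (ρ, w, ρ • w, (ρ * ‖w‖ ^ 2 / 2 + q) • w + (s * ρ / 2) • w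
    + (s * ρ * inner ℝ w v + s * κ * ρ / 2) • v,
    ρ • devOuter w w + (s * ρ) • devOuter v v, ρ * ‖w‖ ^ 2 / 2 + s * ρ / 2)

/-- A fluctuation that takes only two values `a` and `-b` along `v`, with probabilities `b / (a +
b)` and `a / (a + b)`, has mean zero, second moment `a b` and third moment `a b (a - b)`.
Prescribing `a b = s` and `a - b = κ` determines `a` and `b`. -/
theorem axisState_mem_convexHull {ρm ρp ρ : ℝ} (hρ : ρ = ρm ∨ ρ = ρp) (hρ0 : 0 < ρ) {γ : ℝ} (q : ℝ)
    {w v : E n} (hv : ‖v‖ = 1) {s κ : ℝ} (hs : 0 < s)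
    (hγ : ρ * (‖w‖ ^ 2 + κ ^ 2 + 4 * s) ≤ γ) :
    axisState ρ q w v s κ ∈ convexHull ℝ (boundedConstraintSet n ρm ρp γ q) := by
  set r := √(κ ^ 2 + 4 * s) with hr
  have hr2 : r ^ 2 = κ ^ 2 + 4 * s := Real.sq_sqrt (by positivity)
  have hr0 : 0 < r := Real.sqrt_pos.2 (by positivity)
  have hκ : |κ| < r := by
    rw [← abs_of_pos hr0]
    exact sq_lt_sq.1 (by linarith)
  obtain ⟨hκ1, hκ2⟩ := abs_lt.1 hκ
  set a := (r + κ) / 2 with ha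
  set b := (r - κ) / 2 with hb
  have ha0 : 0 < a := by rw [ha]; linarith
  have hb0 : 0 < b := by rw [hb]; linarith
  have hab : a + b = r := by rw [ha, hb]; ring
  have hmem : ∀ u : ℝ, u ^ 2 ≤ r ^ 2 →
      phaseState ρ q (w + u • v) ∈ boundedConstraintSet n ρm ρp γ q := by
    intro u hu
    refine ⟨phaseState_mem_constraintSet hρ q _, ?_⟩
    change ρ * ‖w + u • v‖ ^ 2 / 2 ≤ γ
    have h1 : ‖w + u • v‖ ^ 2 ≤ 2 * (‖w‖ ^ 2 + u ^ 2) := by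
      have h2 := norm_add_le w (u • v)
      rw [norm_smul, hv, mul_one, Real.norm_eq_abs] at h2
      have h3 := sq_abs u
      nlinarith [sq_nonneg (‖w‖ - |u|), norm_nonneg (w + u • v)]
    have h4 : ‖w + u • v‖ ^ 2 / 2 ≤ ‖w‖ ^ 2 + κ ^ 2 + 4 * s := by linarith
    calc ρ * ‖w + u • v‖ ^ 2 / 2 = ρ * (‖w + u • v‖ ^ 2 / 2) := by ring
      _ ≤ ρ * (‖w‖ ^ 2 + κ ^ 2 + 4 * s) := mul_le_mul_of_nonneg_left h4 hρ0.le
      _ ≤ γ := hγ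
  have h1 := hmem a (by rw [ha]; nlinarith)
  have h2 := hmem (-b) (by rw [hb]; nlinarith)
  have h3 := (convex_convexHull ℝ (boundedConstraintSet n ρm ρp γ q))
    (subset_convexHull ℝ _ h1) (subset_convexHull ℝ _ h2) (a := b / r) (b := a / r)
    (by positivity) (by positivity) (by rw [← add_div, add_comm b a, hab, div_self hr0.ne'])
  have hsum : b / r + a / r = 1 := by rw [← add_div, add_comm b a, hab, div_self hr0.ne']
  have hm1 : b / r * a + a / r * (-b) = 0 := by ring
  have hsab : a * b = s := by rw [ha, hb]; nlinarith
  have hm2 : b / r * a ^ 2 + a / r * (-b) ^ 2 = s := by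
    rw [← hsab, ← hab]; field_simp
  have hm3 : b / r * a ^ 3 + a / r * (-b) ^ 3 = s * κ := by
    have : κ = a - b := by rw [ha, hb]; ring
    rw [← hsab, this, ← hab]; field_simp; ring
  clear_value a b r
  generalize b / r = x at *
  generalize a / r = y at *
  generalize -b = c at *
  obtain rfl : x = 1 - y := by linarith
  convert h3 using 1
  have hw : inner ℝ v v = (1 : ℝ) := by rw [real_inner_self_eq_norm_sq, hv, one_pow]
  have hnorm : ∀ u : ℝ, ‖w + u • v‖ ^ 2 = ‖w‖ ^ 2 + 2 * u * inner ℝ w v + u ^ 2 := by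
    intro u
    rw [norm_add_sq_real, norm_smul, hv, inner_smul_right, mul_one, Real.norm_eq_abs, sq_abs]
    ring
  simp only [phaseState, axisState, hnorm, devOuter_add_smul]
  refine Prod.ext ?_ (Prod.ext ?_ (Prod.ext ?_ (Prod.ext ?_ (Prod.ext ?_ ?_))))
  all_goals simp only [Prod.fst_add, Prod.snd_add, Prod.smul_fst, Prod.smul_snd, smul_eq_mul]
  · ring
  · match_scalars
    · ring
    · linear_combination -hm1
  · match_scalars
    · ring
    · linear_combination -ρ * hm1
  · match_scalars
    · linear_combination (-ρ / 2) * hm2 - ρ * inner ℝ w v * hm1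
    · linear_combination (-ρ * inner ℝ w v) * hm2 - ρ / 2 * hm3 - (ρ * ‖w‖ ^ 2 / 2 + q) * hm1
  · match_scalars
    · ring
    · linear_combination -ρ * hm2
    · linear_combination (-2 * ρ) * hm1
  · linear_combination (-ρ / 2) * hm2 - ρ * inner ℝ w v * hm1

theorem mulVec_outer (a b v : E n) : (outer a b).mulVec v.ofLp = (inner ℝ b v : ℝ) • a.ofLp := by
  ext i
  simp only [Matrix.mulVec, dotProduct, outer_apply, PiLp.inner_apply, Pi.smul_apply, smul_eq_mul,
    Finset.sum_mul]
  refine Finset.sum_congr rfl fun j _ => ?_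
  simp
  ring

/-- The quadratic form `v ↦ v · A v`. -/
def quadForm (A : Matrix (Fin n) (Fin n) ℝ) (v : E n) : ℝ := ∑ i, ∑ j, A i j * (v i * v j)

theorem quadForm_sum_outer {b : Fin n → E n} (η : Fin n → ℝ) (v : E n) :
    quadForm (∑ k, η k • outer (b k) (b k)) v = ∑ k, η k * (inner ℝ (b k) v : ℝ) ^ 2 := by
  have h : ∀ a : E n, (inner ℝ a v : ℝ) ^ 2 = ∑ i, ∑ j, (a i * a j) * (v i * v j) := by
    intro a
    simp only [PiLp.inner_apply, sq, Finset.sum_mul_sum]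
    refine Finset.sum_congr rfl fun i _ => Finset.sum_congr rfl fun j _ => ?_
    simp
    ring
  simp only [quadForm, h, Matrix.sum_apply, Matrix.smul_apply, outer_apply, smul_eq_mul,
    Finset.sum_mul, Finset.mul_sum]
  refine ((Finset.sum_congr rfl fun i _ => Finset.sum_comm).trans Finset.sum_comm).trans ?_
  simp only [mul_assoc]

theorem exists_spectral_decomposition {A : Matrix (Fin n) (Fin n) ℝ} (hA : A.IsSymm) :
    ∃ (b : OrthonormalBasis (Fin n) ℝ (E n)) (η : Fin n → ℝ),
      (∀ k, A.mulVec (b k).ofLp = η k • (b k).ofLp) ∧ A = ∑ k, η k • outer (b k) (b k) := by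
  have hH : A.IsHermitian := by
    rw [Matrix.IsHermitian, Matrix.conjTranspose_eq_transpose_of_trivial]
    exact hA
  refine ⟨hH.eigenvectorBasis, hH.eigenvalues, hH.mulVec_eigenvectorBasis, ?_⟩
  set b := hH.eigenvectorBasis
  have key : ∀ v : E n, A.mulVec v.ofLp
      = (∑ k, hH.eigenvalues k • outer (b k) (b k)).mulVec v.ofLp := by
    intro v
    have h1 : v.ofLp = ∑ k, (inner ℝ (b k) v : ℝ) • (b k).ofLp := by
      conv_lhs => rw [← b.sum_repr' v]
      simp
    rw [Matrix.sum_mulVec]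
    simp only [Matrix.smul_mulVec, mulVec_outer]
    conv_lhs => rw [h1]
    rw [Matrix.mulVec_sum]
    refine Finset.sum_congr rfl fun k _ => ?_
    rw [Matrix.mulVec_smul, hH.mulVec_eigenvectorBasis k, smul_comm]
  refine Matrix.ext_of_mulVec_single fun i => ?_
  simpa using key (EuclideanSpace.single i 1)

theorem quadForm_le_lambdaMax {A : Matrix (Fin n) (Fin n) ℝ} (hA : A.IsSymm) {v : E n}
    (hv : ‖v‖ = 1) : quadForm A v ≤ lambdaMax A := by
  obtain ⟨b, η, hη, hAb⟩ := exists_spectral_decomposition hA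
  have h1 : ∀ k, η k ≤ lambdaMax A := by
    intro k
    refine le_csSup (Module.End.finite_hasEigenvalue _).bddAbove ?_
    refine Module.End.hasEigenvalue_of_hasEigenvector (x := (b k).ofLp) ⟨?_, ?_⟩
    · rw [Module.End.mem_eigenspace_iff, Matrix.toLin'_apply, hη]
    · intro h0
      have h2 : ‖b k‖ = 1 := b.orthonormal.1 k
      have h3 : b k = 0 := by ext i; exact congrFun h0 i
      rw [h3, norm_zero] at h2
      exact zero_ne_one h2
  rw [hAb, quadForm_sum_outer, ← hAb]
  calc ∑ k, η k * (inner ℝ (b k) v : ℝ) ^ 2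
      ≤ ∑ k, lambdaMax A * (inner ℝ (b k) v : ℝ) ^ 2 :=
        Finset.sum_le_sum fun k _ => mul_le_mul_of_nonneg_right (h1 k) (sq_nonneg _)
    _ = lambdaMax A := by
      rw [← Finset.mul_sum, b.sum_sq_inner_right, hv, one_pow, mul_one]

end Hull

section Hull

variable {n : ℕ}

theorem sum_outer_orthonormalBasis (b : OrthonormalBasis (Fin n) ℝ (E n)) :
    ∑ k, outer (b k) (b k) = 1 := by
  refine Matrix.ext_of_mulVec_single fun i => ?_
  have h1 := congrArg WithLp.ofLp (b.sum_repr' (EuclideanSpace.single i 1))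
  have h2 : (∑ k, outer (b k) (b k)).mulVec (EuclideanSpace.single i (1 : ℝ)).ofLp
      = (EuclideanSpace.single i (1 : ℝ)).ofLp := by
    rw [Matrix.sum_mulVec]
    simp only [mulVec_outer]
    rw [← h1]
    simp
  rw [Matrix.one_mulVec]
  exact h2

/-- The state with density `ρ`, velocity `w`, Reynolds stress `∑ λᵢ bᵢ ⊗ bᵢ` and turbulent
transport of energy `f`. -/
def turbulentState (ρ q : ℝ) (w : E n) (b : Fin n → E n) (l : Fin n → ℝ) (f : E n) : State n :=
  (ρ, w, ρ • w, (ρ * ‖w‖ ^ 2 / 2 + q + (∑ k, l k) / 2) • w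
    + ∑ k, (l k * inner ℝ (b k) w) • b k + f,
    ρ • devOuter w w + ∑ k, l k • devOuter (b k) (b k), ρ * ‖w‖ ^ 2 / 2 + (∑ k, l k) / 2)

/-- The `n` axes are mixed with equal probability. The variance `n * l k / ρ` on axis `k`
compensates for the factor `1 / n`, and the skewness `2 ⟨b k, f⟩ / l k` makes the third moments add
up to `f`. -/
theorem turbulentState_mem_convexHull (hn : n ≠ 0) {ρm ρp ρ : ℝ} (hρ : ρ = ρm ∨ ρ = ρp)
    (hρ0 : 0 < ρ) {γ : ℝ} (q : ℝ) {w f : E n} (b : OrthonormalBasis (Fin n) ℝ (E n))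
    {l : Fin n → ℝ} (hl : ∀ k, 0 < l k)
    (hγ : ∀ k, ρ * (‖w‖ ^ 2 + (2 * inner ℝ (b k) f / l k) ^ 2) + 4 * (n * l k) ≤ γ) :
    turbulentState ρ q w b l f ∈ convexHull ℝ (boundedConstraintSet n ρm ρp γ q) := by
  have hn0 : (n : ℝ) ≠ 0 := by exact_mod_cast hn
  have hn1 : (0 : ℝ) < n := by positivity
  have h1 : ∑ k : Fin n, (1 / (n : ℝ)) • axisState ρ q w (b k) (n * l k / ρ)
      (2 * inner ℝ (b k) f / l k) ∈ convexHull ℝ (boundedConstraintSet n ρm ρp γ q) := by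
    refine (convex_convexHull ℝ _).sum_mem (fun k _ => by positivity) ?_ fun k _ => ?_
    · simp [hn0]
    · refine axisState_mem_convexHull hρ hρ0 q (b.orthonormal.1 k)
        (div_pos (mul_pos hn1 (hl k)) hρ0) ((le_of_eq ?_).trans (hγ k))
      field_simp
  convert h1 using 1
  have e1 : ∀ k, (1 / (n : ℝ)) • axisState ρ q w (b k) (n * l k / ρ) (2 * inner ℝ (b k) f / l k)
      = ((1 / n : ℝ) * ρ, (1 / n : ℝ) • w, (1 / n : ℝ) • ρ • w,
        (1 / n : ℝ) • (ρ * ‖w‖ ^ 2 / 2 + q) • w + (l k / 2) • w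
          + (l k * inner ℝ (b k) w) • b k + (inner ℝ (b k) f : ℝ) • b k,
        (1 / n : ℝ) • ρ • devOuter w w + l k • devOuter (b k) (b k),
        (1 / n : ℝ) * (ρ * ‖w‖ ^ 2 / 2) + l k / 2) := by
    intro k
    have := (hl k).ne'
    simp only [axisState]
    refine Prod.ext ?_ (Prod.ext ?_ (Prod.ext ?_ (Prod.ext ?_ (Prod.ext ?_ ?_))))
    all_goals simp only [Prod.smul_fst, Prod.smul_snd, smul_eq_mul]
    · rw [real_inner_comm (b k) w]
      match_scalars
      · field_simp
      · field_simp
    · match_scalars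
      · field_simp
      · field_simp
    · field_simp
  have e2 : ∀ {F : Type} [AddCommGroup F] [Module ℝ F] (x : F),
      ∑ _k : Fin n, (1 / n : ℝ) • x = x := by
    intro F _ _ x
    rw [Finset.sum_const, Finset.card_univ, Fintype.card_fin, ← Nat.cast_smul_eq_nsmul ℝ, smul_smul,
      mul_one_div_cancel hn0, one_smul]
  have e3 : ∀ x : ℝ, ∑ _k : Fin n, (1 / n : ℝ) * x = x := e2 (F := ℝ)
  simp only [e1, turbulentState]
  refine Prod.ext ?_ (Prod.ext ?_ (Prod.ext ?_ (Prod.ext ?_ (Prod.ext ?_ ?_))))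
  all_goals simp only [Prod.fst_sum, Prod.snd_sum, Finset.sum_add_distrib, e2, e3]
  · rw [← Finset.sum_smul, b.sum_repr', Finset.sum_div, add_smul]
  · congr 1
    exact (e2 _).symm
  · rw [Finset.sum_div]

/-- The conditional mean velocity of one phase; `ρ` is the density of the other one. -/
def phaseVelocity (ρ : ℝ) (z : State n) : E n := (z.μ - ρ)⁻¹ • (z.m - ρ • z.w)

theorem Tp_eq (ρm ρp : ℝ) (z : State n) :
    z.Tp ρm ρp = ρp * ‖phaseVelocity ρm z‖ ^ 2 / 2 := by
  rw [State.Tp, phaseVelocity, norm_smul, mul_pow, norm_inv, inv_pow, Real.norm_eq_abs, sq_abs]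
  ring

theorem Tm_eq (ρm ρp : ℝ) (z : State n) :
    z.Tm ρm ρp = ρm * ‖phaseVelocity ρp z‖ ^ 2 / 2 := by
  rw [State.Tm, phaseVelocity, norm_smul, mul_pow, norm_inv, inv_pow, Real.norm_eq_abs, sq_abs]
  ring

theorem Mtilde_isSymm (ρm ρp : ℝ) (z : State n) : (z.Mtilde ρm ρp).IsSymm := by
  have h1 : z.σ.IsSymm := z.2.2.2.2.1.2.1
  ext i j
  have h2 := h1.apply i j
  simp only [State.Mtilde, Matrix.transpose_apply, Matrix.sub_apply, Matrix.smul_apply,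
    Matrix.add_apply, outer_apply, smul_eq_mul, h2]
  ring

/-- With `(μ - ρ₋) / (ρ₊ - ρ₋)` as the volume fraction of the heavy phase, `M̃ + σ` is the momentum
flux of the mean velocities of the phases. Hence `(2/n) e id - M̃` is the Reynolds stress left for
fluctuations. -/
theorem Mtilde_eq {ρm ρp : ℝ} {z : State n} (h1 : ρm < z.μ) (h2 : z.μ < ρp) :
    z.Mtilde ρm ρp = ((z.μ - ρm) / (ρp - ρm) * ρp) •
        outer (phaseVelocity ρm z) (phaseVelocity ρm z)
      + ((ρp - z.μ) / (ρp - ρm) * ρm) • outer (phaseVelocity ρp z) (phaseVelocity ρp z)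
      - z.σ := by
  have a1 : z.μ - ρm ≠ 0 := (sub_pos.2 h1).ne'
  have a2 : z.μ - ρp ≠ 0 := (sub_neg.2 h2).ne
  have a3 : ρp - z.μ ≠ 0 := (sub_pos.2 h2).ne'
  have a4 : ρp - ρm ≠ 0 := (sub_pos.2 (h1.trans h2)).ne'
  rw [State.Mtilde]
  congr 1
  ext i j
  simp only [Matrix.smul_apply, Matrix.add_apply, Matrix.sub_apply, outer_apply, smul_eq_mul,
    phaseVelocity, PiLp.smul_apply, PiLp.sub_apply]
  have a5 : z.μ - ρp = -(ρp - z.μ) := by ring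
  rw [a5]
  field_simp
  ring

/-- A bound for the energies of the phases that are needed to represent a state. -/
def energyBound (n : ℕ) (ρm ρp ε B : ℝ) : ℝ :=
  ρp * (2 * B / ρm + (2 * (1 / ε + √(2 * B / ρm))) ^ 2) + 4 * (n * (2 * B))

/-- The state is decomposed into its two phases, with the same Reynolds stress `(2/n) e id - M̃ = ∑
l k • b k ⊗ b k` and the same turbulent transport `f` in both. The hypothesis gives `l k > ε ‖d‖`:
positivity makes the fluctuations possible, and the bound from below limits their skewness. -/
theorem mem_convexHull_of_quadForm_lt (hn : n ≠ 0) {ρm ρp ε B : ℝ} (hρm : 0 < ρm) (hε : 0 < ε)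
    {q : ℝ} {z : State n} (h1 : ρm < z.μ) (h2 : z.μ < ρp)
    (hq : ∀ v : E n, ‖v‖ = 1 → quadForm (z.Mtilde ρm ρp) v
      + ε * ‖z.h - (z.e + q) • z.w - z.etilde ρm ρp • (z.m - z.μ • z.w)‖ < 2 / (n : ℝ) * z.e)
    (hTm : z.Tm ρm ρp ≤ B) (hTp : z.Tp ρm ρp ≤ B) (he : z.e ≤ B) :
    z ∈ convexHull ℝ (boundedConstraintSet n ρm ρp (energyBound n ρm ρp ε B) q) := by
  have hn0 : (n : ℝ) ≠ 0 := by exact_mod_cast hn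
  have a1 : 0 < z.μ - ρm := sub_pos.2 h1
  have a3 : 0 < ρp - z.μ := sub_pos.2 h2
  have a4 : 0 < ρp - ρm := sub_pos.2 (h1.trans h2)
  have hρp : 0 < ρp := by linarith
  set d := z.h - (z.e + q) • z.w - z.etilde ρm ρp • (z.m - z.μ • z.w) with hd
  set α := (z.μ - ρm) / (ρp - ρm) with hα
  have hβ : (ρp - z.μ) / (ρp - ρm) = 1 - α := by rw [hα]; field_simp; ring
  have hα0 : 0 ≤ α := by positivity
  have hα1 : 0 ≤ 1 - α := by rw [← hβ]; positivity
  set u := phaseVelocity ρm z with hu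
  set v := phaseVelocity ρp z with hv
  have hαu : α • u = (ρp - ρm)⁻¹ • (z.m - ρm • z.w) := by
    rw [hu, phaseVelocity, smul_smul, hα]
    congr 1
    field_simp
  have hβv : (1 - α) • v = (ρp - ρm)⁻¹ • (ρp • z.w - z.m) := by
    rw [hv, phaseVelocity, smul_smul, ← hβ, ← neg_sub z.m, smul_neg, ← neg_smul]
    congr 1
    have : z.μ - ρp = -(ρp - z.μ) := by ring
    rw [this]
    field_simp
  have hw : z.w = α • u + (1 - α) • v := by
    rw [hαu, hβv]
    match_scalars <;> field_simp <;> ring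
  have hm : z.m = α • ρp • u + (1 - α) • ρm • v := by
    rw [smul_comm α, smul_comm (1 - α), hαu, hβv]
    match_scalars <;> field_simp <;> ring
  have hμ : z.μ = α * ρp + (1 - α) * ρm := by
    rw [hα]; field_simp; ring
  rw [Tp_eq, ← hu] at hTp
  rw [Tm_eq, ← hv] at hTm
  have hM := Mtilde_eq h1 h2
  rw [hβ, ← hα, ← hu, ← hv] at hM
  obtain ⟨b, η, hη, hAb⟩ := exists_spectral_decomposition (Mtilde_isSymm ρm ρp z)
  set l : Fin n → ℝ := fun k => 2 / (n : ℝ) * z.e - η k with hl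
  have hηk : ∀ k, quadForm (z.Mtilde ρm ρp) (b k) = η k := by
    intro k
    rw [hAb, quadForm_sum_outer]
    simp [b.inner_eq_ite]
  have hld : ∀ k, ε * ‖d‖ < l k := by
    intro k
    have := hq (b k) (b.orthonormal.1 k)
    rw [hηk] at this
    simp only [hl]
    linarith
  have hl0 : ∀ k, 0 < l k := fun k => lt_of_le_of_lt (by positivity) (hld k)
  have hsum : ∑ k, l k = 2 * z.e - (α * ρp * ‖u‖ ^ 2 + (1 - α) * ρm * ‖v‖ ^ 2) := by
    have t1 := congrArg Matrix.trace hAb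
    rw [hM, Matrix.trace_sub, Matrix.trace_add, Matrix.trace_smul, Matrix.trace_smul, trace_outer,
      trace_outer, Matrix.trace_sum, real_inner_self_eq_norm_sq, real_inner_self_eq_norm_sq,
      show z.σ.trace = 0 from z.2.2.2.2.1.2.2] at t1
    simp only [Matrix.trace_smul, trace_outer, real_inner_self_eq_norm_sq, b.orthonormal.1,
      smul_eq_mul, one_pow, mul_one, sub_zero] at t1
    simp only [hl, Finset.sum_sub_distrib, Finset.sum_const, Finset.card_univ, Fintype.card_fin,
      nsmul_eq_mul, ← t1]
    field_simp
  -- The trace of the Reynolds stress is twice the energy not carried by the mean velocities, hence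
  -- at most `2 B`.
  have hlB : ∀ k, l k ≤ 2 * B := by
    intro k
    have t1 : l k ≤ ∑ k, l k := Finset.single_le_sum (fun i _ => (hl0 i).le) (Finset.mem_univ k)
    have t2 : 0 ≤ α * ρp * ‖u‖ ^ 2 + (1 - α) * ρm * ‖v‖ ^ 2 := by positivity
    linarith
  have hW : ∀ (ρ : ℝ) (x : E n), ρm ≤ ρ → ρ * ‖x‖ ^ 2 / 2 ≤ B → ‖x‖ ^ 2 ≤ 2 * B / ρm := by
    intro ρ x h3 h4
    rw [le_div_iff₀ hρm]
    nlinarith [mul_le_mul_of_nonneg_right h3 (sq_nonneg ‖x‖)]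
  have hWu := hW ρp u (h1.trans h2).le hTp
  have hWv := hW ρm v le_rfl hTm
  set W := √(2 * B / ρm) with hWdef
  have hwW : ‖z.w‖ ≤ W := by
    rw [hw]
    refine (norm_add_le _ _).trans ?_
    rw [norm_smul, norm_smul, Real.norm_of_nonneg hα0, Real.norm_of_nonneg hα1]
    have t1 : ‖u‖ ≤ W := Real.le_sqrt_of_sq_le hWu
    have t2 : ‖v‖ ≤ W := Real.le_sqrt_of_sq_le hWv
    nlinarith
  -- The Reynolds stress, applied to the mean velocity, already transports energy. Only the rest of
  -- `d` has to come from third moments.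
  set f := d - ∑ k, (l k * inner ℝ (b k) z.w) • b k with hf
  have hfk : ∀ k, inner ℝ (b k) f = inner ℝ (b k) d - l k * inner ℝ (b k) z.w := by
    intro k
    rw [hf, inner_sub_right, inner_sum]
    simp [inner_smul_right, b.inner_eq_ite]
  -- In the skewness, the part from `d` is at most `‖d‖ / l k ≤ 1 / ε` and the other is a component
  -- of the mean velocity, which is bounded by `W`.
  have hκ : ∀ k, (2 * inner ℝ (b k) f / l k) ^ 2 ≤ (2 * (1 / ε + W)) ^ 2 := by
    intro k
    have t1 : |inner ℝ (b k) d| ≤ ‖d‖ := by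
      simpa [b.orthonormal.1 k] using abs_real_inner_le_norm (b k) d
    have t2 : |inner ℝ (b k) z.w| ≤ ‖z.w‖ := by
      simpa [b.orthonormal.1 k] using abs_real_inner_le_norm (b k) z.w
    have t3 : 2 * inner ℝ (b k) f / l k = 2 * (inner ℝ (b k) d / l k - inner ℝ (b k) z.w) := by
      rw [hfk]
      have := (hl0 k).ne'
      field_simp
    have t4 : |inner ℝ (b k) d / l k| ≤ 1 / ε := by
      rw [abs_div, abs_of_pos (hl0 k), div_le_div_iff₀ (hl0 k) hε]
      have := hld k
      nlinarith
    refine sq_le_sq' ?_ ?_ <;> rw [t3] <;>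
      linarith [abs_le.1 t4, abs_le.1 t2, (abs_le.1 t4).1, (abs_le.1 t2).1, (abs_le.1 t4).2,
        (abs_le.1 t2).2]
  have hγ : ∀ (ρ : ℝ) (x : E n), 0 < ρ → ρ ≤ ρp → ‖x‖ ^ 2 ≤ 2 * B / ρm → ∀ k,
      ρ * (‖x‖ ^ 2 + (2 * inner ℝ (b k) f / l k) ^ 2) + 4 * (n * l k)
        ≤ energyBound n ρm ρp ε B := by
    intro ρ x h3 h4 h5 k
    rw [energyBound]
    have t1 := hκ k
    have t2 := hlB k
    gcongr
  have k1 := turbulentState_mem_convexHull hn (ρm := ρm) (Or.inr rfl) hρp q b hl0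
    (hγ ρp u hρp le_rfl hWu)
  have k2 := turbulentState_mem_convexHull hn (ρp := ρp) (Or.inl rfl) hρm q b hl0
    (hγ ρm v hρm (h1.trans h2).le hWv)
  convert convex_convexHull ℝ _ k1 k2 hα0 hα1 (by ring) using 1
  have hlin : ∑ k, (l k * inner ℝ (b k) z.w) • b k
      = α • ∑ k, (l k * inner ℝ (b k) u) • b k + (1 - α) • ∑ k, (l k * inner ℝ (b k) v) • b k := by
    rw [Finset.smul_sum, Finset.smul_sum, ← Finset.sum_add_distrib]
    refine Finset.sum_congr rfl fun k _ => ?_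
    rw [hw, inner_add_right, inner_smul_right, inner_smul_right]
    module
  have hσ : z.2.2.2.2.1 = α • (ρp • devOuter u u + ∑ k, l k • devOuter (b k) (b k))
      + (1 - α) • (ρm • devOuter v v + ∑ k, l k • devOuter (b k) (b k)) := by
    have t1 : α • (ρp • devOuter u u + ∑ k, l k • devOuter (b k) (b k))
      + (1 - α) • (ρm • devOuter v v + ∑ k, l k • devOuter (b k) (b k))
      = (α * ρp) • devOuter u u + ((1 - α) * ρm) • devOuter v v
        + ∑ k, l k • devOuter (b k) (b k) := by module
    have t2 : ((∑ k, l k • devOuter (b k) (b k) : tracelessSym n) : Matrix (Fin n) (Fin n) ℝ)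
        = (2 / (n : ℝ) * z.e) • 1 - z.Mtilde ρm ρp - ((∑ k, l k) / n) • 1 := by
      conv_rhs => rw [hAb, ← sum_outer_orthonormalBasis b, Finset.smul_sum, ←
          Finset.sum_sub_distrib]
      rw [sum_outer_orthonormalBasis b, Finset.sum_div, Finset.sum_smul, ← Finset.sum_sub_distrib,
        Submodule.coe_sum]
      refine Finset.sum_congr rfl fun k _ => ?_
      rw [Submodule.coe_smul, coe_devOuter, real_inner_self_eq_norm_sq, b.orthonormal.1]
      simp only [hl]
      module
    apply Subtype.ext
    rw [t1, Submodule.coe_add, Submodule.coe_add, Submodule.coe_smul, Submodule.coe_smul, t2, hM,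
      hsum, coe_devOuter, coe_devOuter, real_inner_self_eq_norm_sq, real_inner_self_eq_norm_sq]
    change z.σ = _
    module
  have hee : z.e = α * (ρp * ‖u‖ ^ 2 / 2 + (∑ k, l k) / 2)
      + (1 - α) * (ρm * ‖v‖ ^ 2 / 2 + (∑ k, l k) / 2) := by
    rw [hsum]; ring
  refine Prod.ext hμ (Prod.ext hw (Prod.ext hm (Prod.ext ?_ (Prod.ext hσ hee))))
  change z.h = α • ((ρp * ‖u‖ ^ 2 / 2 + q + (∑ k, l k) / 2) • u
      + ∑ k, (l k * inner ℝ (b k) u) • b k + f)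
    + (1 - α) • ((ρm * ‖v‖ ^ 2 / 2 + q + (∑ k, l k) / 2) • v
      + ∑ k, (l k * inner ℝ (b k) v) • b k + f)
  have hh : z.h = d + (z.e + q) • z.w + z.etilde ρm ρp • (z.m - z.μ • z.w) := by
    rw [hd]; abel
  -- This is the covariance, over the two phases, of mean kinetic energy density and mean velocity.
  -- It explains the term with `ẽ` in the hypothesis.
  have hcov : z.etilde ρm ρp • (z.m - z.μ • z.w)
      = (α * (1 - α) * (ρp * ‖u‖ ^ 2 / 2 - ρm * ‖v‖ ^ 2 / 2)) • (u - v) := by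
    rw [State.etilde, Tp_eq, Tm_eq, ← hu, ← hv, hm, hw, hμ]
    clear_value α u v
    match_scalars <;> field_simp <;> ring
  rw [hh, hcov, hf, hlin, hw, hee]
  module

end Hull

/-! ### The explicit inequality as an open condition. -/

section HullInterior

variable {n : ℕ}

theorem continuous_stateDensity : Continuous (State.μ : State n → ℝ) := continuous_fst

theorem continuous_stateVelocity : Continuous (State.w : State n → E n) :=
  continuous_fst.comp continuous_snd

theorem continuous_stateMomentum : Continuous (State.m : State n → E n) :=
  continuous_fst.comp (continuous_snd.comp continuous_snd)

theorem continuous_stateFlux : Continuous (State.h : State n → E n) :=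
  continuous_fst.comp (continuous_snd.comp (continuous_snd.comp continuous_snd))

theorem continuous_stateStress : Continuous (State.σ : State n → Matrix (Fin n) (Fin n) ℝ) :=
  continuous_subtype_val.comp (continuous_fst.comp (continuous_snd.comp
    (continuous_snd.comp (continuous_snd.comp continuous_snd))))

theorem continuous_stateEnergy : Continuous (State.e : State n → ℝ) :=
  continuous_snd.comp (continuous_snd.comp (continuous_snd.comp
    (continuous_snd.comp continuous_snd)))

theorem continuousAt_phaseVelocity {ρ : ℝ} {z : State n} (h : z.μ ≠ ρ) :
    ContinuousAt (phaseVelocity ρ) z := by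
  have h1 := (continuous_stateDensity (n := n)).continuousAt (x := z)
  have h2 := (continuous_stateVelocity (n := n)).continuousAt (x := z)
  have h3 := (continuous_stateMomentum (n := n)).continuousAt (x := z)
  exact ((h1.sub continuousAt_const).inv₀ (sub_ne_zero.2 h)).smul (h3.sub (h2.const_smul ρ))

theorem continuousAt_Tp {ρm ρp : ℝ} {z : State n} (h : z.μ ≠ ρm) :
    ContinuousAt (State.Tp ρm ρp) z := by
  have h1 : State.Tp ρm ρp = fun z : State n => ρp * ‖phaseVelocity ρm z‖ ^ 2 / 2 :=
    funext (Tp_eq ρm ρp)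
  rw [h1]
  exact (continuousAt_const.mul ((continuousAt_phaseVelocity h).norm.pow 2)).div_const 2

theorem continuousAt_Tm {ρm ρp : ℝ} {z : State n} (h : z.μ ≠ ρp) :
    ContinuousAt (State.Tm ρm ρp) z := by
  have h1 : State.Tm ρm ρp = fun z : State n => ρm * ‖phaseVelocity ρp z‖ ^ 2 / 2 :=
    funext (Tm_eq ρm ρp)
  rw [h1]
  exact (continuousAt_const.mul ((continuousAt_phaseVelocity h).norm.pow 2)).div_const 2

theorem continuousAt_rational {X : Type*} [TopologicalSpace X] {μ a b c d s : X → ℝ} {x : X}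
    {ρm ρp : ℝ} (hμ : Continuous μ) (ha : Continuous a) (hb : Continuous b) (hc : Continuous c)
    (hd : Continuous d) (hs : Continuous s) (h1 : μ x ≠ ρm) (h2 : μ x ≠ ρp) :
    ContinuousAt (fun x => ((ρp - μ x) * (μ x - ρm))⁻¹ * (μ x * ρm * ρp * (a x * b x)
      - ρm * ρp * (c x * b x + a x * d x) + (ρp + ρm - μ x) * (c x * d x)) - s x) x := by
  refine ContinuousAt.sub (ContinuousAt.mul (ContinuousAt.inv₀ ?_ ?_) ?_) hs.continuousAt
  · exact Continuous.continuousAt (by fun_prop)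
  · exact mul_ne_zero (sub_ne_zero.2 h2.symm) (sub_ne_zero.2 h1)
  · exact Continuous.continuousAt (by fun_prop)

theorem continuousAt_Mtilde_apply {ρm ρp : ℝ} {z : State n} (h1 : z.μ ≠ ρm) (h2 : z.μ ≠ ρp)
    (i j : Fin n) : ContinuousAt (fun z : State n => z.Mtilde ρm ρp i j) z := by
  have hc : ∀ i : Fin n, Continuous fun v : E n => v i := fun i => by fun_prop
  have hw := continuous_stateVelocity (n := n)
  have hm := continuous_stateMomentum (n := n)
  have e : (fun z : State n => z.Mtilde ρm ρp i j) = fun z =>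
      ((ρp - z.μ) * (z.μ - ρm))⁻¹ * (z.μ * ρm * ρp * (z.w i * z.w j)
      - ρm * ρp * (z.m i * z.w j + z.w i * z.m j) + (ρp + ρm - z.μ) * (z.m i * z.m j))
      - z.σ i j := by
    ext z
    simp only [State.Mtilde, Matrix.sub_apply, Matrix.smul_apply, Matrix.add_apply, outer_apply,
      smul_eq_mul]
  rw [e]
  exact continuousAt_rational (a := fun z : State n => z.w i) (b := fun z : State n => z.w j)
    (c := fun z : State n => z.m i) (d := fun z : State n => z.m j)
    continuous_stateDensity ((hc i).comp hw) ((hc j).comp hw) ((hc i).comp hm)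
    ((hc j).comp hm) (continuous_stateStress.matrix_elem i j) h1 h2

/-- The explicit inequality implies that the state lies in the interior of the convex hull. -/
theorem mem_interior_convexHull_of_lambdaMax_lt (hn : n ≠ 0) {ρm ρp ε B : ℝ} (hρm : 0 < ρm)
    (hε : 0 < ε) {q : ℝ} {z : State n} (h1 : ρm < z.μ) (h2 : z.μ < ρp)
    (hq : lambdaMax (z.Mtilde ρm ρp)
      + ε * ‖z.h - (z.e + q) • z.w - z.etilde ρm ρp • (z.m - z.μ • z.w)‖ < 2 / (n : ℝ) * z.e)
    (hTm : z.Tm ρm ρp < B) (hTp : z.Tp ρm ρp < B) (he : z.e < B) :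
    z ∈ interior (convexHull ℝ (boundedConstraintSet n ρm ρp (energyBound n ρm ρp ε B) q)) := by
  have cμ := (continuous_stateDensity (n := n)).continuousAt (x := z)
  have cw := (continuous_stateVelocity (n := n)).continuousAt (x := z)
  have cm := (continuous_stateMomentum (n := n)).continuousAt (x := z)
  have ch := (continuous_stateFlux (n := n)).continuousAt (x := z)
  have ce := (continuous_stateEnergy (n := n)).continuousAt (x := z)
  have cTm := continuousAt_Tm (ρm := ρm) h2.ne
  have cTp := continuousAt_Tp (ρp := ρp) h1.ne'
  have cd : ContinuousAt (fun z : State n => ε *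
      ‖z.h - (z.e + q) • z.w - z.etilde ρm ρp • (z.m - z.μ • z.w)‖) z := by
    refine continuousAt_const.mul (ContinuousAt.norm ?_)
    exact (ch.sub ((ce.add continuousAt_const).smul cw)).sub
      (((cTp.sub cTm).div_const _).smul (cm.sub (cμ.smul cw)))
  rw [mem_interior_iff_mem_nhds]
  -- Continuity of the largest eigenvalue is bypassed: the strict inequality for the quadratic form
  -- on the compact unit sphere is stable under small changes of the state.
  have hev : ∀ᶠ x in 𝓝 z, ∀ v ∈ Metric.sphere (0 : E n) 1, quadForm (x.Mtilde ρm ρp) v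
      + ε * ‖x.h - (x.e + q) • x.w - x.etilde ρm ρp • (x.m - x.μ • x.w)‖
        < 2 / (n : ℝ) * x.e := by
    refine (isCompact_sphere (0 : E n) 1).eventually_forall_of_forall_eventually fun v hv => ?_
    have cq : ContinuousAt (fun x : State n × E n => quadForm (x.1.Mtilde ρm ρp) x.2) (z, v) := by
      refine tendsto_finsetSum _ fun i _ => tendsto_finsetSum _ fun j _ => ?_
      refine ContinuousAt.mul ?_ ?_
      · exact (continuousAt_Mtilde_apply h1.ne' h2.ne i j).fst'
      · exact Continuous.continuousAt (by fun_prop)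
    refine ContinuousAt.eventually_lt
      (cq.add cd.fst')
      (continuousAt_const.mul ce.fst') ?_
    refine lt_of_le_of_lt (add_le_add_left ?_ _) hq
    exact quadForm_le_lambdaMax (Mtilde_isSymm ρm ρp z) (by simpa using hv)
  filter_upwards [hev, continuousAt_const.eventually_lt cμ h1,
    cμ.eventually_lt continuousAt_const h2, cTm.eventually_lt continuousAt_const hTm,
    cTp.eventually_lt continuousAt_const hTp, ce.eventually_lt continuousAt_const he]
    with x x1 x2 x3 x4 x5 x6
  exact mem_convexHull_of_quadForm_lt hn hρm hε x2 x3
    (fun v hv => x1 v (by simpa using hv)) x4.le x5.le x6.le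

end HullInterior

/-! ### Geometry of the space-time domain and its fundamental cell. -/

section Domain

variable {n : ℕ}

theorem inner_lastVec {i : Fin n} (hi : (i : ℕ) + 1 = n) (x : E n) :
    inner ℝ x (lastVec n) = x i := by
  have h : ∀ j : Fin n, (j : ℕ) + 1 = n ↔ j = i := fun j => by
    rw [Fin.ext_iff]; omega
  simp [PiLp.inner_apply, lastVec, h]

theorem lastVec_apply_of_ne {i : Fin n} (hi : (i : ℕ) + 1 ≠ n) : lastVec n i = 0 := by
  simp [lastVec, hi]

theorem continuous_shift (g : ℝ) : Continuous (shift n g) := by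
  unfold shift
  fun_prop

namespace FlowDomain

/-- The representative of a point in the fundamental cell. -/
def reduce : FlowDomain n → E n → E n
  | bounded _ _ _ _, x => x
  | channel _ _, x => WithLp.toLp 2 fun i => if (i : ℕ) + 1 = n then x i else Int.fract (x i)

variable (Ω : FlowDomain n)

theorem reduce_add {k : E n} (hk : k ∈ Ω.periods) (x : E n) : Ω.reduce (x + k) = Ω.reduce x := by
  cases Ω with
  | bounded _ _ _ _ =>
    obtain rfl : k = 0 := hk
    rw [add_zero]
  | channel L hL =>
    ext i
    by_cases hi : (i : ℕ) + 1 = n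
    · simp [reduce, hi, (hk i).2 hi]
    · obtain ⟨a, ha⟩ := (hk i).1 hi
      simp [reduce, hi, ha]

theorem reduce_of_mem_cell {x : E n} (hx : x ∈ Ω.cell) : Ω.reduce x = x := by
  cases Ω with
  | bounded _ _ _ _ => rfl
  | channel L hL =>
    ext i
    by_cases hi : (i : ℕ) + 1 = n
    · simp [reduce, hi]
    · simpa [reduce, hi] using Int.fract_eq_self.2 (hx i hi)

theorem reduce_mem_cell (x : E n) : Ω.reduce x ∈ Ω.cell := by
  cases Ω with
  | bounded _ _ _ _ => trivial
  | channel L hL =>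
    intro i hi
    simp [reduce, hi, Int.fract_nonneg, Int.fract_lt_one]

theorem exists_period_reduce (x : E n) : ∃ k ∈ Ω.periods, Ω.reduce x = x + k := by
  refine ⟨Ω.reduce x - x, ?_, by abel⟩
  cases Ω with
  | bounded _ _ _ _ => simp [reduce, periods]
  | channel L hL =>
    intro i
    refine ⟨fun hi => ⟨-⌊x i⌋, ?_⟩, fun hi => ?_⟩
    · change (if (i : ℕ) + 1 = n then x i else Int.fract (x i)) - x i = _
      rw [if_neg hi, ← Int.self_sub_floor]
      push_cast
      ring
    · simp [reduce, hi]

theorem convex_cell : Convex ℝ Ω.cell := by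
  cases Ω with
  | bounded _ _ _ _ => exact convex_univ
  | channel L hL =>
    intro x hx y hy a b ha hb hab i hi
    exact convex_Ico (0 : ℝ) 1 (hx i hi) (hy i hi) ha hb hab

theorem interior_cell_nonempty : (interior Ω.cell).Nonempty := by
  cases Ω with
  | bounded _ _ _ _ => simp [cell]
  | channel L hL =>
    refine ⟨WithLp.toLp 2 fun _ => 1 / 2, ?_⟩
    have ho : IsOpen {x : E n | ∀ i : Fin n, x i ∈ Ioo (0 : ℝ) 1} := by
      simp only [ofPred_forall]
      exact isOpen_iInter_of_finite fun i => isOpen_Ioo.preimage (by fun_prop)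
    have hs : {x : E n | ∀ i : Fin n, x i ∈ Ioo (0 : ℝ) 1} ⊆ (channel L hL).cell :=
      fun x hx i _ => Ioo_subset_Ico_self (hx i)
    refine interior_maximal hs ho fun i => ?_
    norm_num

theorem cell_subset_closure_interior : Ω.cell ⊆ closure (interior Ω.cell) := by
  rw [Ω.convex_cell.closure_interior_eq_closure_of_nonempty_interior Ω.interior_cell_nonempty]
  exact subset_closure

theorem sub_smul_lastVec_mem_cell {x : E n} (hx : x ∈ Ω.cell) (c : ℝ) :
    x - c • lastVec n ∈ Ω.cell := by
  cases Ω with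
  | bounded _ _ _ _ => trivial
  | channel L hL =>
    intro i hi
    simpa [lastVec_apply_of_ne hi] using hx i hi

theorem isBounded_carrier_inter_cell :
    Bornology.IsBounded (Ω.carrier ∩ Ω.cell) := by
  cases Ω with
  | bounded Ω₀ h1 h2 h3 => exact h3.subset inter_subset_left
  | channel L hL =>
    refine isBounded_iff_forall_norm_le.2 ⟨√(∑ _i : Fin n, (L + 1) ^ 2), ?_⟩
    rintro x ⟨hx1, hx2⟩
    rw [EuclideanSpace.norm_eq]
    refine Real.sqrt_le_sqrt (Finset.sum_le_sum fun i _ => ?_)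
    refine pow_le_pow_left₀ (norm_nonneg _) ?_ 2
    rw [Real.norm_eq_abs]
    by_cases hi : (i : ℕ) + 1 = n
    · have : |inner ℝ x (lastVec n)| < L := hx1
      rw [inner_lastVec hi] at this
      linarith
    · have := hx2 i hi
      rw [abs_of_nonneg this.1]
      linarith [this.2]

theorem isOpen_carrier : IsOpen Ω.carrier := by
  cases Ω with
  | bounded Ω₀ h1 h2 h3 => exact h1
  | channel L hL => exact isOpen_lt (by fun_prop) continuous_const

end FlowDomain

variable (Ω : FlowDomain n) (g T : ℝ)

theorem isOpen_spaceTime : IsOpen (spaceTime Ω g T) := by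
  refine (isOpen_Ioo.preimage continuous_snd).inter (Ω.isOpen_carrier.preimage ?_)
  exact continuous_fst.sub ((continuous_shift g).comp continuous_snd)

theorem isBounded_spaceTime_inter_cell :
    Bornology.IsBounded (spaceTime Ω g T ∩ (Ω.cell ×ˢ univ)) := by
  have h1 := Ω.isBounded_carrier_inter_cell.isCompact_closure.prod
    (isCompact_Icc (a := (0 : ℝ)) (b := T))
  have h2 : Continuous fun p : E n × ℝ => (p.1 + shift n g p.2, p.2) :=
    (continuous_fst.add ((continuous_shift g).comp continuous_snd)).prodMk continuous_snd
  refine (h1.image h2).isBounded.subset ?_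
  rintro ⟨x, t⟩ ⟨⟨ht, hx⟩, hc, -⟩
  exact ⟨(x - shift n g t, t),
    ⟨subset_closure ⟨hx, Ω.sub_smul_lastVec_mem_cell hc _⟩, Ioo_subset_Icc_self ht⟩, by simp⟩

theorem isFiniteMeasure_bulkMeasure : IsFiniteMeasure (bulkMeasure Ω g T) :=
  ⟨by simpa [bulkMeasure] using (isBounded_spaceTime_inter_cell Ω g T).measure_lt_top⟩

theorem ae_mem_bulk : ∀ᵐ p ∂bulkMeasure Ω g T, p ∈ spaceTime Ω g T ∩ (Ω.cell ×ˢ univ) := by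
  refine ae_restrict_mem₀ ((isOpen_spaceTime Ω g T).measurableSet.nullMeasurableSet.inter ?_)
  exact (Ω.convex_cell.prod convex_univ).nullMeasurableSet volume

/-- The cell is convex, so its frontier is a null set and passing to its interior loses nothing. -/
theorem ae_mem_interior_cell : ∀ᵐ p ∂bulkMeasure Ω g T, p.1 ∈ interior Ω.cell := by
  have h1 : volume (frontier Ω.cell ×ˢ (univ : Set ℝ)) = 0 := by
    rw [Measure.volume_eq_prod, Measure.prod_prod, Ω.convex_cell.addHaar_frontier volume, zero_mul]
  have h2 : ∀ᵐ p ∂bulkMeasure Ω g T, p ∉ frontier Ω.cell ×ˢ (univ : Set ℝ) :=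
    ae_restrict_of_ae (measure_eq_zero_iff_ae_notMem.1 h1)
  filter_upwards [h2, ae_mem_bulk Ω g T] with p hp hc
  by_contra h
  exact hp ⟨⟨subset_closure hc.2.1, h⟩, trivial⟩

/-- The part of `U` over the interior of the fundamental cell. -/
def interiorPart (U : Set (E n × ℝ)) : Set (E n × ℝ) := U ∩ (interior Ω.cell ×ˢ univ)

variable {Ω g T} {U : Set (E n × ℝ)}

theorem isOpen_interiorPart (hU : IsOpen U) : IsOpen (interiorPart Ω U) :=
  hU.inter (isOpen_interior.prod isOpen_univ)

theorem interiorPart_subset (hU : U ⊆ spaceTime Ω g T) :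
    interiorPart Ω U ⊆ spaceTime Ω g T ∩ (Ω.cell ×ˢ univ) :=
  inter_subset_inter hU (prod_mono interior_subset subset_rfl)

/-- A period moves a point of `U` into the cell, which lies in the closure of its interior; openness
of `U` does the rest. -/
theorem interiorPart_nonempty (hU : IsOpen U) (hne : U.Nonempty)
    (hper : Ω.SpacePeriodic fun p => p ∈ U) : (interiorPart Ω U).Nonempty := by
  obtain ⟨⟨x, t⟩, hx⟩ := hne
  obtain ⟨k, hk, hkx⟩ := Ω.exists_period_reduce x
  have h1 : (Ω.reduce x, t) ∈ U := by
    rw [hkx]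
    exact (hper k hk x t).mpr hx
  have h2 : IsOpen {y | (y, t) ∈ U} := hU.preimage (by fun_prop)
  obtain ⟨y, hy1, hy2⟩ := mem_closure_iff.1
    (Ω.cell_subset_closure_interior (Ω.reduce_mem_cell x)) _ h2 h1
  exact ⟨(y, t), hy1, hy2, trivial⟩

theorem ae_mem_interiorPart : ∀ᵐ p ∂bulkMeasure Ω g T, p ∈ U → p ∈ interiorPart Ω U := by
  filter_upwards [ae_mem_interior_cell Ω g T] with p hp hU
  exact ⟨hU, hp, trivial⟩

theorem restrict_bulkMeasure (hU : IsOpen U) (hsub : U ⊆ spaceTime Ω g T) :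
    (bulkMeasure Ω g T).restrict (interiorPart Ω U) = volume.restrict (interiorPart Ω U) := by
  rw [bulkMeasure, Measure.restrict_restrict (isOpen_interiorPart hU).measurableSet,
    inter_eq_left.2 (interiorPart_subset hsub)]

end Domain

/-! ### From the linear system with constraints to the Euler system. -/

section Euler

variable {n : ℕ}

/-- No integrability of `F` is needed: if it fails, both integrals are zero by convention. -/
theorem integral_add_of_isNullIntegral {X : Type*} [MeasurableSpace X] {m : Measure X}
    {F G : X → ℝ} (hG : IsNullIntegral m G) : ∫ x, (F x + G x) ∂m = ∫ x, F x ∂m := by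
  by_cases hF : Integrable F m
  · rw [integral_add hF hG.1, hG.2, add_zero]
  · rw [integral_undef hF, integral_undef]
    intro h
    refine hF ((h.sub hG.1).congr (Eventually.of_forall fun x => ?_))
    simp

theorem memLp_velocity {X : Type*} [MeasurableSpace X] {m : Measure X} {z : X → State n}
    {r : ENNReal} (h : ∀ l : State n →L[ℝ] ℝ, MemLp (fun p => l (z p)) r m) :
    MemLp (fun p => (z p).w) r m := by
  let l : Fin n → State n →L[ℝ] ℝ := fun i => LinearMap.toContinuousLinearMap
    { toFun := fun z => z.w i
      map_add' := fun x y => by simp [State.w]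
      map_smul' := fun c x => by simp [State.w] }
  have hl : ∀ i z, l i z = z.w i := fun _ _ => rfl
  have h1 := memLp_finsetSum Finset.univ (f := fun i p => l i (z p) • EuclideanSpace.single i
      (1 : ℝ))
    (p := r) (μ := m) fun i _ => (ContinuousLinearMap.toSpanSingleton ℝ
      (EuclideanSpace.single i (1 : ℝ))).comp_memLp' (h (l i))
  refine h1.ae_eq (Eventually.of_forall fun p => ?_)
  ext j
  simp [hl, Finset.sum_apply, Pi.single_apply]

/-- The boundary and initial terms and `ν` depend only on the data, so the linear identities pass
from `z` to `z'` once the differences of the bulk terms vanish. The pointwise constraints turn these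
into the nonlinear ones. -/
theorem isEulerSolution_of_mem_constraintSet (hn : n ≠ 0) {ρm ρp g T : ℝ} {Ω : FlowDomain n}
    {μ₀ : E n → ℝ} {w₀ : E n → E n} {z z' : E n × ℝ → State n} {q : E n × ℝ → ℝ}
    {ν : testFunctions Ω T ℝ →ₗ[ℝ] ℝ} (hz : IsLinearSolution Ω g T μ₀ w₀ z q ν)
    (hper : Ω.SpacePeriodic z')
    (hbd : ∀ l : State n →L[ℝ] ℝ, MemLp (fun p => l (z' p)) ⊤ (bulkMeasure Ω g T))
    (hK : ∀ᵐ p ∂bulkMeasure Ω g T, z' p ∈ constraintSet n ρm ρp (q p))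
    (hG : ∀ G ∈ linearForms n, IsNullIntegral (bulkMeasure Ω g T) fun p => G p (z' p - z p)) :
    IsEulerSolution ρm ρp Ω g T μ₀ w₀ (fun p => (z' p).μ) (fun p => (z' p).w) q ν := by
  refine ⟨fun k hk x t => congrArg State.μ (hper k hk x t),
    fun k hk x t => congrArg State.w (hper k hk x t),
    hbd (ContinuousLinearMap.fst ℝ ℝ _), memLp_velocity hbd, hz.pressure, hz.negative,
    hK.mono fun p hp => hp.2.2.2, fun Φ hΦ => ?_, fun ψ hψ => ?_, fun ψ hψ => ?_, fun ψ => ?_⟩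
  · refine Eq.trans ?_ (hz.momentum Φ hΦ)
    congr 2
    refine Eq.trans (integral_congr_ae ?_)
      (integral_add_of_isNullIntegral (hG _ (Or.inl ⟨Φ, hΦ.1, rfl⟩)))
    filter_upwards [hK] with p hp
    simp only [map_sub, momentumForm_apply]
    rw [hp.2.2.1, ← hp.1]
    simp only [contractGrad_add, contractGrad_smul]
    ring
  · refine Eq.trans (integral_congr_ae (Eventually.of_forall fun p => ?_))
      ((integral_add_of_isNullIntegral (hG _ (Or.inr ⟨ψ, hψ.1, Or.inl rfl⟩))).trans
        (hz.incompressibility ψ hψ))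
    change _ = _ + inner ℝ ((z' p).w - (z p).w) (spaceGrad ψ p)
    simp only [inner_sub_left]
    ring
  · refine Eq.trans ?_ (hz.mass ψ hψ)
    congr 1
    refine Eq.trans (integral_congr_ae ?_) (integral_add_of_isNullIntegral
      (hG _ (Or.inr ⟨ψ, hψ.1, Or.inr (Or.inl rfl)⟩)))
    filter_upwards [hK] with p hp
    rw [← hp.1]
    change _ = _ + (((z' p).μ - (z p).μ) * dt ψ p + inner ℝ ((z' p).m - (z p).m) (spaceGrad ψ p))
    rw [inner_sub_left]
    ring
  · refine Eq.trans ?_ (hz.energy ψ)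
    congr 2
    refine Eq.trans (integral_congr_ae ?_) (integral_add_of_isNullIntegral
      (hG _ (Or.inr ⟨ψ, ψ.2.1, Or.inr (Or.inr rfl)⟩)))
    filter_upwards [hK] with p hp
    rw [← energy_of_mem_constraintSet hn hp, ← hp.2.1]
    change _ = _ + (((z' p).e - (z p).e) * dt (ψ : E n × ℝ → ℝ) p
      + inner ℝ ((z' p).h - (z p).h) (spaceGrad (ψ : E n × ℝ → ℝ) p))
    rw [inner_sub_left]
    ring

/-- On bounded sets, the linear constraints can be evaluated on bounded states. -/
theorem integrable_linearForm {U : Set (E n × ℝ)} (hU : MeasurableSet U)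
    (hb : Bornology.IsBounded U) {G : E n × ℝ → State n →L[ℝ] ℝ} (hG : G ∈ linearForms n)
    {y : E n × ℝ → State n} (hy : ∀ l : State n →L[ℝ] ℝ, IntegrableOn (fun p => l (y p)) U) :
    IntegrableOn (fun p => G p (y p)) U := by
  set b := Module.finBasis ℝ (State n)
  have h1 : ∀ p, G p (y p)
      = ∑ j, G p (b j) * LinearMap.toContinuousLinearMap (b.coord j) (y p) := by
    intro p
    conv_lhs => rw [← b.sum_repr (y p), map_sum]
    refine Finset.sum_congr rfl fun j _ => ?_
    rw [map_smul, smul_eq_mul, mul_comm]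
    rfl
  simp only [h1]
  refine integrable_finsetSum _ fun j _ => ?_
  exact (hy _).continuousOn_mul_of_subset
    (continuous_of_mem_linearForms hG (b j)).continuousOn hb.isCompact_closure hU subset_closure

theorem ContinuousOn.abs_le_of_ae_le {U : Set (E n × ℝ)} (hU : IsOpen U) {f : E n × ℝ → ℝ}
    (hf : ContinuousOn f U) {C : ℝ} (h : ∀ᵐ p ∂volume.restrict U, |f p| ≤ C) :
    ∀ p ∈ U, |f p| ≤ C := by
  intro p hp
  by_contra hlt
  have ho : IsOpen (U ∩ (fun p => |f p|) ⁻¹' Ioi C) := hf.abs.isOpen_inter_preimage hU isOpen_Ioi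
  refine (ho.measure_pos volume ⟨p, hp, not_le.1 hlt⟩).ne' ?_
  rw [ae_restrict_iff' hU.measurableSet] at h
  refine measure_mono_null (fun x hx => ?_) (ae_iff.1 h)
  exact fun hC => not_le.2 hx.2 (hC hx.1)

/-- The set for `q` is the image of a fixed compact set under a map that is affine in `q`. This
makes the exact states essentially bounded. -/
theorem exists_bound_boundedConstraintSet (hn : n ≠ 0) {ρm ρp : ℝ} (hρm : 0 < ρm) (hρp : 0 < ρp)
    (γ C : ℝ) (l : State n →L[ℝ] ℝ) :
    ∃ M : ℝ, ∀ q, |q| ≤ C → ∀ z ∈ boundedConstraintSet n ρm ρp γ q, |l z| ≤ M := by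
  have hK := isCompact_boundedConstraintSet hn hρm hρp γ 0
  obtain ⟨M₁, h1⟩ := hK.exists_bound_of_continuousOn l.continuous.continuousOn
  obtain ⟨M₂, h2⟩ := hK.exists_bound_of_continuousOn
    (l.comp (velocityToFlux n)).continuous.continuousOn
  refine ⟨M₁ + C * M₂, fun q hq z hz => ?_⟩
  rw [← image_pressureShift hn] at hz
  obtain ⟨x, hx, rfl⟩ := hz
  rw [pressureShift_eq, map_add, map_smul, smul_eq_mul]
  refine (abs_add_le _ _).trans (add_le_add (h1 x hx) ?_)
  rw [abs_mul]
  exact mul_le_mul hq (h2 x hx) (abs_nonneg _) ((abs_nonneg _).trans hq)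

theorem eq_of_mem_constraintSet (hn : n ≠ 0) {ρm ρp q : ℝ} {x y : State n}
    (hx : x ∈ constraintSet n ρm ρp q) (hy : y ∈ constraintSet n ρm ρp q) (hμ : x.μ = y.μ)
    (hw : x.w = y.w) : x = y := by
  obtain ⟨ρ₁, w₁, -, rfl⟩ := (mem_constraintSet_iff hn).1 hx
  obtain ⟨ρ₂, w₂, -, rfl⟩ := (mem_constraintSet_iff hn).1 hy
  obtain rfl : ρ₁ = ρ₂ := hμ
  obtain rfl : w₁ = w₂ := hw
  rfl

end Euler

/-! ### Periodic extension of the modified states. -/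

section Gluing

variable {n : ℕ} {Ω : FlowDomain n} {g T : ℝ} {U : Set (E n × ℝ)}

open Classical in
/-- Replace `z` by `f` over the interior of the fundamental cell of `U`, and extend the result
periodically. -/
def glue (Ω : FlowDomain n) (U : Set (E n × ℝ)) (f z : E n × ℝ → State n) (p : E n × ℝ) :
    State n :=
  (interiorPart Ω U).piecewise f z (Ω.reduce p.1, p.2)

theorem spacePeriodic_glue (f z : E n × ℝ → State n) : Ω.SpacePeriodic (glue Ω U f z) := by
  intro k hk x t
  classical
  exact congrArg (fun y => (interiorPart Ω U).piecewise f z (y, t)) (Ω.reduce_add hk x)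

theorem glue_of_mem {f z : E n × ℝ → State n} {p : E n × ℝ} (hp : p ∈ interiorPart Ω U) :
    glue Ω U f z p = f p := by
  classical
  have h : (Ω.reduce p.1, p.2) = p :=
    Prod.ext (Ω.reduce_of_mem_cell (interior_subset hp.2.1)) rfl
  rw [glue, h, piecewise_eq_of_mem _ _ _ hp]

theorem glue_of_notMem {f z : E n × ℝ → State n} {p : E n × ℝ} (hc : p.1 ∈ Ω.cell)
    (hp : p ∉ interiorPart Ω U) : glue Ω U f z p = z p := by
  classical
  have h : (Ω.reduce p.1, p.2) = p := Prod.ext (Ω.reduce_of_mem_cell hc) rfl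
  rw [glue, h, piecewise_eq_of_notMem _ _ _ hp]

theorem glue_sub_ae_eq (f z : E n × ℝ → State n) :
    ∀ᵐ p ∂bulkMeasure Ω g T, (glue Ω U f z p - z p)
      = (interiorPart Ω U).indicator (fun p => f p - z p) p := by
  filter_upwards [ae_mem_bulk Ω g T] with p hc
  by_cases hp : p ∈ interiorPart Ω U
  · rw [glue_of_mem hp, indicator_of_mem hp]
  · rw [glue_of_notMem hc.2.1 hp, indicator_of_notMem hp, sub_self]

theorem memLp_glue (hU : IsOpen U) (hsub : U ⊆ spaceTime Ω g T) {f z : E n × ℝ → State n}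
    {l : State n →L[ℝ] ℝ}
    (hf : MemLp (fun p => l (f p)) ⊤ (volume.restrict (interiorPart Ω U)))
    (hz : MemLp (fun p => l (z p)) ⊤ (bulkMeasure Ω g T)) :
    MemLp (fun p => l (glue Ω U f z p)) ⊤ (bulkMeasure Ω g T) := by
  rw [← restrict_bulkMeasure hU hsub] at hf
  classical
  refine (MemLp.piecewise (isOpen_interiorPart hU).measurableSet hf (hz.restrict _)).ae_eq ?_
  filter_upwards [ae_mem_bulk Ω g T] with p hc
  by_cases hp : p ∈ interiorPart Ω U
  · rw [glue_of_mem hp, piecewise_eq_of_mem _ _ _ hp]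
  · rw [glue_of_notMem hc.2.1 hp, piecewise_eq_of_notMem _ _ _ hp]

theorem setIntegral_glue_sub (hU : IsOpen U) (hsub : U ⊆ spaceTime Ω g T)
    (f z : E n × ℝ → State n) {F : E n × ℝ → State n → ℝ} (hF : ∀ p, F p 0 = 0) :
    ∫ p, F p (glue Ω U f z p - z p) ∂bulkMeasure Ω g T
      = ∫ p in interiorPart Ω U, F p (f p - z p) := by
  rw [← restrict_bulkMeasure hU hsub, ← integral_indicator (isOpen_interiorPart hU).measurableSet]
  refine integral_congr_ae ?_
  filter_upwards [glue_sub_ae_eq f z] with p hp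
  rw [hp]
  by_cases h : p ∈ interiorPart Ω U
  · rw [indicator_of_mem h, indicator_of_mem h]
  · rw [indicator_of_notMem h, indicator_of_notMem h, hF]

end Gluing

/-! ### Assembly of the solutions. -/

section Main

variable {n : ℕ} {Ω : FlowDomain n} {g T : ℝ} {U : Set (E n × ℝ)}

/-- Applied to the energy component, this provides the pointwise energy bound that the explicit
criterion needs. -/
theorem exists_bound_of_memLp_top {z : E n × ℝ → State n}
    (hU : IsOpen U) (hsub : U ⊆ spaceTime Ω g T) (hz : ContinuousOn z U) {l : State n →L[ℝ] ℝ}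
    (hl : MemLp (fun p => l (z p)) ⊤ (bulkMeasure Ω g T)) :
    ∃ C, ∀ p ∈ interiorPart Ω U, |l (z p)| ≤ C := by
  obtain ⟨C, hC⟩ : ∃ C, ∀ᵐ p ∂bulkMeasure Ω g T, |l (z p)| ≤ C :=
    ⟨_, ae_le_lpNorm_exponent_top hl⟩
  refine ⟨C, ContinuousOn.abs_le_of_ae_le (isOpen_interiorPart hU) (f := fun p => l (z p))
    (l.continuous.comp_continuousOn (hz.mono inter_subset_left)) ?_⟩
  rw [← restrict_bulkMeasure hU hsub]
  exact ae_restrict_of_ae hC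

/-- A subsolution that is strict on `U` in the sense of the convex hulls is a weak limit of
solutions. -/
theorem exists_seq_isEulerSolution (hn : 2 ≤ n) {ρm ρp γ : ℝ} (hρm : 0 < ρm) (hρ : ρm < ρp)
    {μ₀ : E n → ℝ} {w₀ : E n → E n} {z : E n × ℝ → State n} {q : E n × ℝ → ℝ}
    {ν : testFunctions Ω T ℝ →ₗ[ℝ] ℝ} (hz : IsLinearSolution Ω g T μ₀ w₀ z q ν)
    (hUopen : IsOpen U) (hUne : U.Nonempty) (hUsub : U ⊆ spaceTime Ω g T)
    (hUper : Ω.SpacePeriodic fun p => p ∈ U) (hzU : ContinuousOn z U) (hqU : ContinuousOn q U)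
    (hqbdd : ∃ C : ℝ, ∀ p ∈ U, |q p| ≤ C)
    (hmem : ∀ p ∈ interiorPart Ω U,
      z p ∈ interior (convexHull ℝ (boundedConstraintSet n ρm ρp γ (q p))))
    (hout : ∀ᵐ p ∂bulkMeasure Ω g T, p ∉ U → z p ∈ constraintSet n ρm ρp (q p)) :
    ∃ zs : ℕ → E n × ℝ → State n,
      (∀ k, IsEulerSolution ρm ρp Ω g T μ₀ w₀ (fun p => (zs k p).μ) (fun p => (zs k p).w) q ν) ∧
      (∀ k, ∀ᵐ p ∂bulkMeasure Ω g T, zs k p ∈ constraintSet n ρm ρp (q p)) ∧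
      (∀ j k, j ≠ k → ¬ ∀ᵐ p ∂bulkMeasure Ω g T,
        (zs j p).μ = (zs k p).μ ∧ (zs j p).w = (zs k p).w) ∧
      (∀ k, ∀ᵐ p ∂bulkMeasure Ω g T, p ∉ U → (zs k p).μ = (z p).μ ∧ (zs k p).w = (z p).w) ∧
      WeaklyConverges Ω g T zs z := by
  have hn0 : n ≠ 0 := by omega
  have := isFiniteMeasure_bulkMeasure Ω g T
  obtain ⟨C, hC⟩ := hqbdd
  have hVo : IsOpen (interiorPart Ω U) := isOpen_interiorPart hUopen
  have hVs : interiorPart Ω U ⊆ spaceTime Ω g T ∩ (Ω.cell ×ˢ univ) := interiorPart_subset hUsub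
  have hVb := (isBounded_spaceTime_inter_cell Ω g T).subset hVs
  have hVU : interiorPart Ω U ⊆ U := inter_subset_left
  have hVm : volume.restrict (interiorPart Ω U) ≤ bulkMeasure Ω g T :=
    Measure.restrict_mono hVs le_rfl
  have hfin : IsFiniteMeasure (volume.restrict (interiorPart Ω U)) :=
    ⟨by simpa using hVb.measure_lt_top⟩
  obtain ⟨f, f1, f2, f3, f4, f5⟩ := exists_seq_mem_boundedConstraintSet hn hρm (hρm.trans hρ) hVo
    hVb (interiorPart_nonempty hUopen hUne hUper) (hzU.mono hVU) (hqU.mono hVU)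
    (fun p hp => hC p (hVU hp)) hmem
  have hfbd : ∀ k (l : State n →L[ℝ] ℝ),
      MemLp (fun p => l (f k p)) ⊤ (volume.restrict (interiorPart Ω U)) := by
    intro k l
    obtain ⟨M, hM⟩ := exists_bound_boundedConstraintSet hn0 hρm (hρm.trans hρ) γ C l
    refine memLp_top_of_bound (f1 k l).1 M ?_
    filter_upwards [f2 k, ae_restrict_mem hVo.measurableSet] with p hp hpV
    exact hM _ (hC p (hVU hpV)) _ hp
  have hbd : ∀ k (l : State n →L[ℝ] ℝ),
      MemLp (fun p => l (glue Ω U (f k) z p)) ⊤ (bulkMeasure Ω g T) := fun k l =>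
    memLp_glue hUopen hUsub (hfbd k l) (hz.bounded l)
  have hK : ∀ k, ∀ᵐ p ∂bulkMeasure Ω g T,
      p ∈ interiorPart Ω U → f k p ∈ constraintSet n ρm ρp (q p) := by
    intro k
    rw [← ae_restrict_iff' hVo.measurableSet, restrict_bulkMeasure hUopen hUsub]
    exact (f2 k).mono fun p hp => hp.1
  have hKs : ∀ k, ∀ᵐ p ∂bulkMeasure Ω g T,
      glue Ω U (f k) z p ∈ constraintSet n ρm ρp (q p) := by
    intro k
    filter_upwards [hK k, hout, ae_mem_bulk Ω g T, ae_mem_interiorPart (U := U)] with p h1 h2 h3 h4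
    by_cases hp : p ∈ interiorPart Ω U
    · rw [glue_of_mem hp]
      exact h1 hp
    · rw [glue_of_notMem h3.2.1 hp]
      exact h2 fun h => hp (h4 h)
  have hnull : ∀ k, ∀ G ∈ linearForms n, IsNullIntegral (bulkMeasure Ω g T)
      fun p => G p (glue Ω U (f k) z p - z p) := by
    intro k G hG
    refine ⟨?_, ?_⟩
    · have h1 : IntegrableOn (fun p => G p (f k p - z p)) (interiorPart Ω U) := by
        refine integrable_linearForm hVo.measurableSet hVb hG fun l => ?_
        simp only [map_sub]
        exact ((hfbd k l).sub ((hz.bounded l).mono_measure hVm)).integrable le_top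
      rw [IntegrableOn, ← restrict_bulkMeasure hUopen hUsub, ← IntegrableOn,
        ← integrable_indicator_iff hVo.measurableSet] at h1
      refine h1.congr ?_
      filter_upwards [glue_sub_ae_eq (U := U) (f k) z] with p hp
      rw [hp]
      by_cases h : p ∈ interiorPart Ω U
      · rw [indicator_of_mem h, indicator_of_mem h]
      · rw [indicator_of_notMem h, indicator_of_notMem h, map_zero]
    · rw [setIntegral_glue_sub hUopen hUsub (F := fun p x => G p x) _ _ fun p => map_zero _]
      exact f3 k G hG
  refine ⟨fun k => glue Ω U (f k) z, fun k => isEulerSolution_of_mem_constraintSet hn0 hz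
    (spacePeriodic_glue _ _) (hbd k) (hKs k) (hnull k), hKs, fun j k hjk h => ?_, fun k => ?_,
    fun l => ⟨fun k => (hbd k l).mono_exponent le_top, (hz.bounded l).mono_exponent le_top,
      fun φ hφ => ?_⟩⟩
  -- Density and velocity determine a state that satisfies the constraints, so different states mean
  -- different solutions.
  · refine f5 j k hjk ?_
    rw [← restrict_bulkMeasure hUopen hUsub, EventuallyEq, ae_restrict_iff' hVo.measurableSet]
    filter_upwards [h, hK j, hK k] with p h1 h2 h3 hp
    rw [glue_of_mem hp, glue_of_mem hp] at h1
    exact eq_of_mem_constraintSet hn0 (h2 hp) (h3 hp) h1.1 h1.2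
  · filter_upwards [ae_mem_bulk Ω g T] with p hc hp
    rw [glue_of_notMem hc.2.1 fun h => hp (hVU h)]
    exact ⟨rfl, rfl⟩
  · have h1 := f4 l φ (hφ.mono_measure hVm)
    have h2 : ∀ k, ∫ p, l (glue Ω U (f k) z p) * φ p ∂bulkMeasure Ω g T
        = (∫ p, l (z p) * φ p ∂bulkMeasure Ω g T)
          + ∫ p in interiorPart Ω U, l (f k p - z p) * φ p := by
      intro k
      have i1 : Integrable (fun p => l (glue Ω U (f k) z p) * φ p) (bulkMeasure Ω g T) :=
        MemLp.integrable_mul (p := 2) (q := 2) ((hbd k l).mono_exponent le_top) hφ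
      have i2 : Integrable (fun p => l (z p) * φ p) (bulkMeasure Ω g T) :=
        MemLp.integrable_mul (p := 2) (q := 2) ((hz.bounded l).mono_exponent le_top) hφ
      rw [← setIntegral_glue_sub hUopen hUsub (F := fun p x => l x * φ p) _ _ (by simp)]
      simp only [map_sub, sub_mul]
      rw [integral_sub i1 i2]
      ring
    simp only [h2]
    simpa using h1.const_add (∫ p, l (z p) * φ p ∂bulkMeasure Ω g T)

end Main

end MixingEuler

end

theorem theorem1p3 (n : ℕ) (hn : n = 2 ∨ n = 3)
    (ρm ρp g T : ℝ) (hρm : 0 < ρm) (hρ : ρm < ρp) (hg : 0 < g) (hT : 0 < T)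
    (Ω : MixingEuler.FlowDomain n)
    -- initial data
    (μ₀ : MixingEuler.E n → ℝ) (w₀ : MixingEuler.E n → MixingEuler.E n)
    (h₀ : MixingEuler.IsInitialData ρm ρp Ω μ₀ w₀)
    -- the subsolution `z`, its pressure `q`, and its dissipation measure `ν`
    (z : MixingEuler.E n × ℝ → MixingEuler.State n) (q : MixingEuler.E n × ℝ → ℝ)
    (ν : MixingEuler.testFunctions Ω T ℝ →ₗ[ℝ] ℝ)
    (hz : MixingEuler.IsLinearSolution Ω g T μ₀ w₀ z q ν)
    -- the mixing zone `U`
    (U : Set (MixingEuler.E n × ℝ)) (hUopen : IsOpen U) (hUne : U.Nonempty)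
    (hUsub : U ⊆ MixingEuler.spaceTime Ω g T)
    (hUper : Ω.SpacePeriodic fun p => p ∈ U)
    (hzU : ContinuousOn z U) (hqU : ContinuousOn q U)
    (hqbdd : ∃ C : ℝ, ∀ p ∈ U, |q p| ≤ C)
    (hTbdd : ∃ C : ℝ, ∀ p ∈ U, |(z p).Tm ρm ρp| ≤ C ∧ |(z p).Tp ρm ρp| ≤ C)
    -- the condition on `U`: the explicit one, or the abstract one
    (hU : (∃ ε : ℝ, 0 < ε ∧ ∀ p ∈ U,
            ρm < (z p).μ ∧ (z p).μ < ρp ∧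
            MixingEuler.lambdaMax ((z p).Mtilde ρm ρp)
              + ε * ‖(z p).h - ((z p).e + q p) • (z p).w
                  - (z p).etilde ρm ρp • ((z p).m - (z p).μ • (z p).w)‖
              < 2 / (n : ℝ) * (z p).e)
        ∨ (∃ γ : ℝ, 0 < γ ∧ ∀ p ∈ U,
            z p ∈ interior
              (convexHull ℝ (MixingEuler.boundedConstraintSet n ρm ρp γ (q p)))))
    -- outside `U` the pointwise constraints hold
    (hout : ∀ᵐ p ∂(MixingEuler.bulkMeasure Ω g T),
      p ∉ U → z p ∈ MixingEuler.constraintSet n ρm ρp (q p)) :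
    ∃ zs : ℕ → MixingEuler.E n × ℝ → MixingEuler.State n,
      -- every `(μ_k, w_k)` is a weak solution with the same pressure and dissipation measure
      (∀ k, MixingEuler.IsEulerSolution ρm ρp Ω g T μ₀ w₀
        (fun p => (zs k p).μ) (fun p => (zs k p).w) q ν) ∧
      -- the other components of `z_k` are given by `(μ_k, w_k)` through the constraints
      (∀ k, ∀ᵐ p ∂(MixingEuler.bulkMeasure Ω g T),
        zs k p ∈ MixingEuler.constraintSet n ρm ρp (q p)) ∧
      -- the solutions are pairwise different
      (∀ j k, j ≠ k → ¬ ∀ᵐ p ∂(MixingEuler.bulkMeasure Ω g T),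
        (zs j p).μ = (zs k p).μ ∧ (zs j p).w = (zs k p).w) ∧
      -- they coincide with `(μ, w)` outside `U`
      (∀ k, ∀ᵐ p ∂(MixingEuler.bulkMeasure Ω g T),
        p ∉ U → (zs k p).μ = (z p).μ ∧ (zs k p).w = (z p).w) ∧
      -- and they converge to the subsolution weakly in `L²`
      MixingEuler.WeaklyConverges Ω g T zs z := by
  have hn2 : 2 ≤ n := by omega
  rcases hU with ⟨ε, hε, h⟩ | ⟨γ, -, h⟩
  · obtain ⟨C, hC⟩ := hTbdd
    let l : MixingEuler.State n →L[ℝ] ℝ := LinearMap.toContinuousLinearMap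
      { toFun := fun z => z.e
        map_add' := fun _ _ => rfl
        map_smul' := fun _ _ => rfl }
    obtain ⟨C', hC'⟩ := MixingEuler.exists_bound_of_memLp_top hUopen hUsub hzU (hz.bounded l)
    -- The summand `1` makes the bounds for `T₋`, `T₊` and `e` strict, as needed for an interior
    -- point. The resulting `γ` is the same at all points of the mixing zone.
    refine MixingEuler.exists_seq_isEulerSolution hn2 hρm hρ hz hUopen hUne hUsub hUper hzU hqU
      hqbdd (γ := MixingEuler.energyBound n ρm ρp ε (max C C' + 1)) (fun p hp => ?_) hout
    obtain ⟨h1, h2, h3⟩ := h p hp.1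
    have h4 := (abs_le.1 (hC p hp.1).1).2
    have h5 := (abs_le.1 (hC p hp.1).2).2
    have h6 : (z p).e ≤ C' := (abs_le.1 (hC' p hp)).2
    have h7 := le_max_left C C'
    have h8 := le_max_right C C'
    exact MixingEuler.mem_interior_convexHull_of_lambdaMax_lt (by omega) hρm hε h1 h2 h3
      (by linarith) (by linarith) (by linarith)
  · exact MixingEuler.exists_seq_isEulerSolution hn2 hρm hρ hz hUopen hUne hUsub hUper hzU hqU hqbdd
      (fun p hp => h p hp.1) hout
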